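/- Let $M$ be an oriented smooth Riemannian manifold of dimension three (without boundary), with volume form $dV$, Hodge star $\star$ (so $\alpha\wedge\star\beta=\langle\alpha,\beta\rangle dV$), codifferential $\delta=(-1)^{3i+1}\star d\star$ on $i$-forms and musical isomorphisms $\flat,\sharp$. For functions $f$ and vector fields $Y,Z$ put $\nabla f=(df)^\sharp$, $\operatorname{div}Y=\delta(Y^\flat)$, $\operatorname{curl}Y=(\star d(Y^\flat))^\sharp$ and $Y\times Z=(\star(Y^\flat\wedge Z^\flat))^\sharp$. Let $R=\mathbb R[\epsilon,d\epsilon]$ be the free graded commutative differential graded algebra with $|\epsilon|=-1$, $|d\epsilon|=-2$, $d(\epsilon)=d\epsilon$, and extend it by the time parameter to $R[[t,dt]]$ with $|t|=0$, $|dt|=-1$, $d(t)=dt$. Time dependence is understood in either of the following two ways, and the result holds for each of them: (a) all time-dependent functions, vector fields and forms are formal power series in $t$ with smooth coefficients on $M$; (b) they are smooth jointly in $t\in J$ and $x\in M$, where $J\subseteq\mathbb R$ is a nondegenerate interval, and such functions of $t$ replace power series in $R[[t,dt]]$. A collection of homotopy random variables parametrized by a ring $R'$ (here $R'=R$ or $R'=R[[t,dt]]$)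 is a smooth element $\mathcal X$ of degree zero of the (completed) graded tensor product $\Omega^\bullet(M)\otimes R'$ with $\delta(\exp\mathcal X)=0$ for the total differential $\alpha\otimes r\mapsto\delta\alpha\otimes r+(-1)^{|\alpha|}\alpha\otimes dr$. A homotopy of $R$-collections is a collection parametrized by $R[[t,dt]]$, $$\mathcal X=f+X\,dt+V\epsilon+\pi\,dt\,\epsilon+\sigma\,d\epsilon+\Phi\,dt\,d\epsilon+\Psi\,\epsilon\,d\epsilon ,$$ with $f,X,V,\pi,\sigma,\Phi,\Psi$ time-dependent forms of degrees $0,1,1,2,2,3,3$, whose values $\mathcal X|_{t=s,\,dt=0}$ ($s=0$ in case (a), every $s\in J$ in case (b)) are collections parametrized by $R$. A solution of the compressible Euler equations is a time-dependent triple $(\rho,u,p)$ of a function $\rho>0$ (in case (a): with positive constant coefficient), a vector field $u$ and a function $p$ such that $$\dot\rho+\operatorname{div}(\rho u)=0,\qquad \dot u+\nabla\left(\tfrac{u\cdot u}{2}\right)-u\times(\operatorname{curl}u)+\frac{\nabla p}{\rho}=0 .$$ 1. For every solution $(\rho,u,p)$ of the compressible Euler equations there is exactly one homotopy $\mathcal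 X$ of $R$-collections of homotopy random variables satisfying the identifications $$\rho=e^f,\quad X=u^\flat,\quad V=-\frac{\star d(\rho X)}{\rho},\quad \pi=\tfrac12\delta(X\wedge\star X)-\delta(X)\star X,\quad \sigma=\star X,\quad \Phi=\frac{\star p}{\rho},\quad \Psi=X\wedge dX .$$ 2. Conversely, let $\mathcal X$ be a homotopy of $R$-collections of homotopy random variables with $\sigma=\star X$ (velocity constraint) and $\pi=\tfrac12\delta(X\wedge\star X)-\delta(X)\star X$ (modified kinetic constraint). Then $\rho=e^f$, $u=X^\sharp$ and $p=\star(\rho\Phi)$ form a solution $(\rho,u,p)$ of the compressible Euler equations, and $\mathcal X$ and $(\rho,u,p)$ satisfy all the identifications of 1. -/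

import Mathlib

open scoped Manifold ContDiff Topology Nat
open Bundle

noncomputable section

namespace FluidHPT

/-- The model space of three-dimensional manifolds. -/
abbrev E3 : Type := EuclideanSpace ℝ (Fin 3)

/-! ### Exterior algebra of a vector space -/

section Fibre

variable {V : Type} [AddCommGroup V] [Module ℝ V]

/-- The exterior product of alternating forms (the sum over shuffles), with the degree `i + j`
of the result written as `k`. -/
def wedge {i j k : ℕ} (h : i + j = k) (α : V [⋀^Fin i]→ₗ[ℝ] ℝ) (β : V [⋀^Fin j]→ₗ[ℝ] ℝ) :
    V [⋀^Fin k]→ₗ[ℝ] ℝ :=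
  ((LinearMap.mul' ℝ ℝ).compAlternatingMap (α.domCoprod β)).domDomCongr
    (finSumFinEquiv.trans (finCongr h))

/-- Insertion of `k` vectors into the first `k` slots: `w ↦ η (v 0, …, v (k - 1), w)`. -/
def contract {j : ℕ} : (k : ℕ) → V [⋀^Fin (j + k)]→ₗ[ℝ] ℝ → (Fin k → V) → V [⋀^Fin j]→ₗ[ℝ] ℝ
  | 0, η, _ => η
  | k + 1, η, v => contract k (AlternatingMap.curryLeft η (v 0)) (Fin.tail v)

end Fibre

section OrientedFibre

variable {V : Type} [NormedAddCommGroup V] [InnerProductSpace ℝ V]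
  [Fact (Module.finrank ℝ V = 3)]

/-- A positively oriented orthonormal basis `e₀, e₁, e₂`. -/
def frame (o : Orientation ℝ V (Fin 3)) : OrthonormalBasis (Fin 3) ℝ V :=
  o.finOrthonormalBasis (by norm_num) Fact.out

/-- The Hodge star from `k`-forms to `j`-forms, `k + j = 3`:
`(⋆β)(w) = (1/k!) ∑_I β(e_I) dV(e_I, w)`, the sum being over all `I : Fin k → Fin 3`. It is the
operator with `α ∧ ⋆β = ⟨α, β⟩ dV`, where `⟨α, β⟩ = (1/k!) ∑_I α(e_I) β(e_I)`. -/
def hodge (o : Orientation ℝ V (Fin 3)) {k j : ℕ} (h : k + j = 3) (β : V [⋀^Fin k]→ₗ[ℝ] ℝ) :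
    V [⋀^Fin j]→ₗ[ℝ] ℝ :=
  (k ! : ℝ)⁻¹ • ∑ I : Fin k → Fin 3, β (fun a => frame o (I a)) •
    contract k (o.volumeForm.domDomCongr (finCongr (by omega : 3 = j + k)))
      (fun a => frame o (I a))

/-- The one-form `v♭ = ⟨v, ·⟩`. -/
def flat (v : V) : V [⋀^Fin 1]→ₗ[ℝ] ℝ :=
  AlternatingMap.ofSubsingleton ℝ V ℝ (0 : Fin 1) (innerₗ V v)

/-- The vector `α♯` of a one-form; `♯` is the inverse of `♭`. -/
def sharp (o : Orientation ℝ V (Fin 3)) (α : V [⋀^Fin 1]→ₗ[ℝ] ℝ) : V :=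
  ∑ i, α (fun _ => frame o i) • frame o i

theorem sharp_flat (o : Orientation ℝ V (Fin 3)) (v : V) : sharp o (flat v) = v := by
  simp only [sharp, flat, AlternatingMap.ofSubsingleton_apply_apply, innerₗ_apply_apply]
  conv_rhs => rw [← (frame o).sum_repr' v]
  simp only [real_inner_comm]

/-- The cross product `v × w = (⋆(v♭ ∧ w♭))♯`. -/
def cross (o : Orientation ℝ V (Fin 3)) (v w : V) : V :=
  sharp o (hodge o (rfl : 2 + 1 = 3) (wedge (rfl : 1 + 1 = 2) (flat v) (flat w)))

end OrientedFibre

/-! ### The three ways in which quantities may depend on time -/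

/-- `point`: no time parameter. `formal`: formal power series in `t`, a time-dependent quantity
being its sequence of coefficients. `interval J`: functions of `t ∈ J`. -/
inductive TimeModel : Type
  | point : TimeModel
  | formal : TimeModel
  | interval (J : Set ℝ) : TimeModel

namespace TimeModel

/-- A time-dependent element of `A` is a map `T.Idx → A`. -/
def Idx : TimeModel → Type
  | point => Unit
  | formal => ℕ
  | interval J => J

/-- The extension by zero of a function on `J`. -/
def extendZero {A : Type} [Zero A] (J : Set ℝ) (a : J → A) (s : ℝ) : A :=
  open Classical in if h : s ∈ J then a ⟨s, h⟩ else 0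

/-- The product of time-dependent quantities induced by a bilinear product `F`: the Cauchy product
for formal power series, the pointwise product for functions of time. -/
def conv {A B C : Type} [AddCommMonoid C] (F : A → B → C) :
    (T : TimeModel) → (T.Idx → A) → (T.Idx → B) → T.Idx → C
  | point, a, b => fun t => F (a t) (b t)
  | formal, a, b => fun (n : ℕ) => ∑ q ∈ Finset.HasAntidiagonal.antidiagonal n, F (a q.1) (b q.2)
  | interval _, a, b => fun t => F (a t) (b t)

/-- The constant `1`. -/
def one : (T : TimeModel) → T.Idx → ℝ
  | point => fun _ => 1
  | formal => fun n => PowerSeries.coeff n (1 : PowerSeries ℝ)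
  | interval _ => fun _ => 1

/-- The powers of a time-dependent number. -/
def pow (T : TimeModel) (a : T.Idx → ℝ) : ℕ → T.Idx → ℝ
  | 0 => T.one
  | n + 1 => T.conv (fun r s => r * s) a (pow T a n)

/-- The multiplicative inverse of a time-dependent number. -/
def inv : (T : TimeModel) → (T.Idx → ℝ) → T.Idx → ℝ
  | point, a => fun t => (a t)⁻¹
  | formal, a => fun n => PowerSeries.coeff n (PowerSeries.mk a)⁻¹
  | interval _, a => fun t => (a t)⁻¹

/-- The time derivative. -/
def ddt {A : Type} [NormedAddCommGroup A] [NormedSpace ℝ A] :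
    (T : TimeModel) → (T.Idx → A) → T.Idx → A
  | point, _ => fun _ => 0
  | formal, a => fun (n : ℕ) => ((n : ℝ) + 1) • a (n + 1 : ℕ)
  | interval J, a => fun (t : J) => derivWithin (extendZero J a) J (t : ℝ)

/-- The indices `s` for which `a s` is the value of `a` at an instant: for a power series only
`t = 0`, for a function every `t ∈ J`. -/
def IsInstant : (T : TimeModel) → T.Idx → Prop
  | point, _ => True
  | formal, n => n = (0 : ℕ)
  | interval _, _ => True

/-- Smoothness on an open set `U` of a time-dependent function: smoothness of every coefficient of
a power series, joint smoothness in time and space for functions of time. -/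
def SmoothOn {F : Type} [NormedAddCommGroup F] [NormedSpace ℝ F] :
    (T : TimeModel) → (T.Idx → E3 → F) → Set E3 → Prop
  | point, w, U => ContDiffOn ℝ ∞ (w ()) U
  | formal, w, U => ∀ n : ℕ, ContDiffOn ℝ ∞ (w n) U
  | interval J, w, U =>
      ContDiffOn ℝ ∞ (fun q : ℝ × E3 => extendZero J (fun t => w t q.2) q.1) (J ×ˢ U)

/-- `T` really has a time parameter: formal power series, or functions on a nondegenerate
interval. -/
def IsTime : TimeModel → Prop
  | point => False
  | formal => True
  | interval J => J.OrdConnected ∧ J.Nontrivial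

end TimeModel

/-! ### Differential forms on a three-manifold -/

/-- An alternating form on the model space is continuous. -/
def toCont {k : ℕ} (α : E3 [⋀^Fin k]→ₗ[ℝ] ℝ) : E3 [⋀^Fin k]→L[ℝ] ℝ :=
  { α with
    cont := by
      have key : ∀ v : Fin k → E3, α v = ∑ r : Fin k → Fin 3,
          (∏ a, v a (r a)) • α (fun a => EuclideanSpace.basisFun (Fin 3) ℝ (r a)) := by
        intro v
        have hv : v = fun a => ∑ i, v a i • EuclideanSpace.basisFun (Fin 3) ℝ i := by
          funext a
          conv_lhs => rw [← (EuclideanSpace.basisFun (Fin 3) ℝ).sum_repr (v a)]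
          rfl
        conv_lhs => rw [hv]
        rw [← AlternatingMap.coe_multilinearMap, MultilinearMap.map_sum]
        refine Finset.sum_congr rfl fun r _ => ?_
        rw [MultilinearMap.map_smul_univ]
      have hc : Continuous fun v : Fin k → E3 => ∑ r : Fin k → Fin 3,
          (∏ a, v a (r a)) • α (fun a => EuclideanSpace.basisFun (Fin 3) ℝ (r a)) := by
        fun_prop
      exact hc.congr fun v => (key v).symm }

section Manifold

variable (M : Type*) [TopologicalSpace M] [ChartedSpace E3 M]

/-- Differential `k`-forms (with no regularity imposed). -/
abbrev Form (k : ℕ) : Type _ := (x : M) → TangentSpace (𝓡 3) x [⋀^Fin k]→ₗ[ℝ] ℝ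

/-- Vector fields (with no regularity imposed). -/
abbrev VField : Type _ := (x : M) → TangentSpace (𝓡 3) x

/-- Time-dependent functions. -/
abbrev TFun (T : TimeModel) : Type _ := T.Idx → M → ℝ

/-- Time-dependent vector fields. -/
abbrev TVec (T : TimeModel) : Type _ := T.Idx → VField M

/-- Time-dependent `k`-forms. -/
abbrev TForm (T : TimeModel) (k : ℕ) : Type _ := T.Idx → Form M k

variable {M}

instance factFinrank (x : M) : Fact (Module.finrank ℝ (TangentSpace (𝓡 3) x) = 3) :=
  ⟨finrank_euclideanSpace_fin (𝕜 := ℝ) (n := 3)⟩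

/-- The function underlying a `0`-form. -/
def Form.toFun (w : Form M 0) (x : M) : ℝ := w x ![]

/-- A function as a `0`-form. -/
def Form.ofFun (f : M → ℝ) : Form M 0 := fun x =>
  AlternatingMap.constOfIsEmpty ℝ (TangentSpace (𝓡 3) x) (Fin 0) (f x)

variable [IsManifold (𝓡 3) ∞ M]

/-- A form at `x`, written in the coordinates of the chart at `x₀`. -/
def toModel {k : ℕ} (x₀ x : M) (α : TangentSpace (𝓡 3) x [⋀^Fin k]→ₗ[ℝ] ℝ) :
    E3 [⋀^Fin k]→L[ℝ] ℝ :=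
  toCont (α.compLinearMap
    ((trivializationAt E3 (TangentSpace (𝓡 3)) x₀).symmL ℝ x : E3 →ₗ[ℝ] TangentSpace (𝓡 3) x))

/-- The form at `x` with given expression in the coordinates of the chart at `x₀`. -/
def ofModel {k : ℕ} (x₀ x : M) (α : E3 [⋀^Fin k]→L[ℝ] ℝ) :
    TangentSpace (𝓡 3) x [⋀^Fin k]→ₗ[ℝ] ℝ :=
  α.toAlternatingMap.compLinearMap
    ((trivializationAt E3 (TangentSpace (𝓡 3)) x₀).continuousLinearMapAt ℝ x :
      TangentSpace (𝓡 3) x →ₗ[ℝ] E3)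

/-- The expression of a form in the chart at `x₀`. -/
def chartRep {k : ℕ} (w : Form M k) (x₀ : M) (y : E3) : E3 [⋀^Fin k]→L[ℝ] ℝ :=
  toModel x₀ ((extChartAt (𝓡 3) x₀).symm y) (w ((extChartAt (𝓡 3) x₀).symm y))

/-- The exterior derivative. -/
def d {k : ℕ} (w : Form M k) : Form M (k + 1) := fun x =>
  ofModel x x (extDeriv (chartRep w x) (extChartAt (𝓡 3) x x))

variable {T : TimeModel}

/-- Smoothness of a time-dependent function. -/
def SmoothFun (f : TFun M T) : Prop :=
  ∀ x₀ : M, T.SmoothOn (fun i y => f i ((extChartAt (𝓡 3) x₀).symm y))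
    (extChartAt (𝓡 3) x₀).target

/-- Smoothness of a time-dependent vector field. -/
def SmoothVec (u : TVec M T) : Prop :=
  ∀ x₀ : M, T.SmoothOn
    (fun i y => (trivializationAt E3 (TangentSpace (𝓡 3)) x₀).continuousLinearMapAt ℝ
      ((extChartAt (𝓡 3) x₀).symm y) (u i ((extChartAt (𝓡 3) x₀).symm y)))
    (extChartAt (𝓡 3) x₀).target

/-- Smoothness of a time-dependent form. -/
def SmoothForm {k : ℕ} (w : TForm M T k) : Prop :=
  ∀ x₀ : M, T.SmoothOn (fun i y => chartRep (w i) x₀ y) (extChartAt (𝓡 3) x₀).target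

/-- The time derivative of a form, computed at each point in the cotangent space. -/
def TForm.ddt {k : ℕ} (w : TForm M T k) : TForm M T k := fun i x =>
  ofModel x x (T.ddt (fun j => toModel x x (w j x)) i)

/-- The product of a function and a form. -/
def TForm.smul {k : ℕ} (f : TFun M T) (w : TForm M T k) : TForm M T k := fun i x =>
  T.conv (fun (a : ℝ) (β : TangentSpace (𝓡 3) x [⋀^Fin k]→ₗ[ℝ] ℝ) => a • β)
    (fun j => f j x) (fun j => w j x) i

/-- The product of a function and a vector field. -/
def TVec.smul (f : TFun M T) (u : TVec M T) : TVec M T := fun i x =>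
  T.conv (fun (a : ℝ) (v : TangentSpace (𝓡 3) x) => a • v) (fun j => f j x) (fun j => u j x) i

/-- The multiplicative inverse of a function. -/
def TFun.inv (f : TFun M T) : TFun M T := fun i x => T.inv (fun j => f j x) i

/-- The exterior product. -/
def TForm.wedge {a b k : ℕ} (h : a + b = k) (α : TForm M T a) (β : TForm M T b) :
    TForm M T k := fun i x =>
  T.conv (FluidHPT.wedge (V := TangentSpace (𝓡 3) x) h) (fun j => α j x) (fun j => β j x) i

/-- `ρ = exp f`, the sum of the exponential series (for power series in `t`, coefficientwise). -/
def IsExpFun (f ρ : TFun M T) : Prop :=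
  ∀ (i : T.Idx) (x : M),
    HasSum (fun n : ℕ => (n ! : ℝ)⁻¹ * T.pow (fun j => f j x) n i) (ρ i x)

/-! ### Operators depending on the metric and the orientation -/

variable [RiemannianBundle (fun x : M => TangentSpace (𝓡 3) x)]

variable (o : (x : M) → Orientation ℝ (TangentSpace (𝓡 3) x) (Fin 3))

/-- The pointwise orientations `o x` form an orientation of the manifold: near every `x₀` the
coordinate frame of the chart at `x₀` is either positively oriented everywhere or negatively
oriented everywhere. -/
def IsOrientation : Prop :=
  ∀ x₀ : M,
    (∀ᶠ x in 𝓝 x₀, 0 < (o x).volumeForm (fun a =>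
      (trivializationAt E3 (TangentSpace (𝓡 3)) x₀).symmL ℝ x
        (EuclideanSpace.basisFun (Fin 3) ℝ a))) ∨
    (∀ᶠ x in 𝓝 x₀, (o x).volumeForm (fun a =>
      (trivializationAt E3 (TangentSpace (𝓡 3)) x₀).symmL ℝ x
        (EuclideanSpace.basisFun (Fin 3) ℝ a)) < 0)

/-- The Hodge star of a form. -/
def Form.hodge {k j : ℕ} (h : k + j = 3) (w : Form M k) : Form M j := fun x =>
  FluidHPT.hodge (o x) h (w x)

/-- The codifferential `δ = (-1)^(3 i + 1) ⋆ d ⋆` on `i`-forms, `i = k + 1`. (There are no nonzero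
forms of degree `i > 3`.) -/
def codiff {k : ℕ} (w : Form M (k + 1)) : Form M k :=
  if h : k + 1 ≤ 3 then
    (-1 : ℝ) ^ (3 * (k + 1) + 1) •
      Form.hodge o (by omega : (2 - k + 1) + k = 3)
        (d (Form.hodge o (by omega : (k + 1) + (2 - k) = 3) w))
  else 0

/-- `∇f = (df)♯`. -/
def grad (f : M → ℝ) : VField M := fun x => sharp (o x) (d (Form.ofFun f) x)

/-- `div X = δ(X♭)`. -/
def div (X : VField M) : M → ℝ := Form.toFun (codiff o (k := 0) fun x => flat (X x))

/-- `curl X = (⋆d(X♭))♯`. -/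
def curl (X : VField M) : VField M := fun x =>
  sharp (o x) (Form.hodge o (rfl : 2 + 1 = 3) (d (k := 1) fun y => flat (X y)) x)

/-- The Hodge star of a time-dependent form. -/
def TForm.hodge {k j : ℕ} (h : k + j = 3) (w : TForm M T k) : TForm M T j := fun i =>
  Form.hodge o h (w i)

/-- The codifferential of a time-dependent form. -/
def TForm.codiff {k : ℕ} (w : TForm M T (k + 1)) : TForm M T k := fun i =>
  FluidHPT.codiff o (w i)

/-- The exterior derivative of a time-dependent form. -/
def TForm.d {k : ℕ} (w : TForm M T k) : TForm M T (k + 1) := fun i => FluidHPT.d (w i)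

/-- `u♭`, for a time-dependent vector field `u`. -/
def TVec.flat (u : TVec M T) : TForm M T 1 := fun i x => FluidHPT.flat (u i x)

/-- `α♯`, for a time-dependent one-form `α`. -/
def TForm.sharp (α : TForm M T 1) : TVec M T := fun i x => FluidHPT.sharp (o x) (α i x)

/-- The inner product of time-dependent vector fields. -/
def TVec.inner (u v : TVec M T) : TFun M T := fun i x =>
  T.conv (fun a b : TangentSpace (𝓡 3) x => Inner.inner ℝ a b)
    (fun j => u j x) (fun j => v j x) i

/-- The cross product of time-dependent vector fields. -/
def TVec.cross (u v : TVec M T) : TVec M T := fun i x =>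
  T.conv (FluidHPT.cross (o x)) (fun j => u j x) (fun j => v j x) i

/-! ### The compressible Euler equations -/

/-- Solutions `(ρ, u, p)` of the compressible Euler equations, with positive density. -/
structure IsEulerSolution (ρ : TFun M T) (u : TVec M T) (p : TFun M T) : Prop where
  smooth_density : SmoothFun ρ
  smooth_velocity : SmoothVec u
  smooth_pressure : SmoothFun p
  density_pos : ∀ i, T.IsInstant i → ∀ x, 0 < ρ i x
  /-- `∂ρ/∂t + div (ρ u) = 0` -/
  mass : ∀ i x, T.ddt (fun j => ρ j x) i + div o (TVec.smul ρ u i) x = 0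
  /-- `∂u/∂t + ∇(u·u/2) - u × curl u + ∇p/ρ = 0` -/
  momentum : ∀ i x,
    T.ddt (fun j => u j x) i + grad o (fun y => TVec.inner u u i y / 2) x
      - TVec.cross o u (fun j => curl o (u j)) i x
      + TVec.smul (TFun.inv ρ) (fun j => grad o (p j)) i x = 0

/-! ### Collections of homotopy random variables -/

/-- The monomial `dt^dt ε^ep (dε)^dep`. Here `dt` and `ε` have degree `-1` (and square to zero) and
`dε` has degree `-2`. -/
structure Mono where
  dt : Fin 2
  ep : Fin 2
  dep : ℕ

/-- Minus the degree of a monomial. -/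
def Mono.deg (m : Mono) : ℕ := m.dt + m.ep + 2 * m.dep

variable (M T) in
/-- Elements `∑_{m,k} 𝒳 m k ⊗ m` of the (completed) tensor product of the forms on `M` and the
parameter ring. If `T` is `formal` or `interval J`, this parameter ring is
`ℝ[ε, dε][[t, dt]]` or its version with functions of `t ∈ J` in place of power series.
`𝒳 m k` is the component of form degree `k` of the coefficient of the monomial `m`; it is itself
time-dependent. -/
abbrev Coll : Type _ := Mono → (k : ℕ) → TForm M T k

/-- The unit. -/
def Coll.one : Coll M T := fun m k i x =>
  if h : (m.dt = 0 ∧ m.ep = 0 ∧ m.dep = 0) ∧ k = 0 then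
    T.one i • (AlternatingMap.constOfIsEmpty ℝ (TangentSpace (𝓡 3) x) (Fin 0) (1 : ℝ)).domDomCongr
      (finCongr h.2.symm)
  else 0

/-- The graded product: `(α ⊗ r)(β ⊗ s) = (-1)^(|r||β|) (α ∧ β) ⊗ r s`, and
`ε^a₁ · dt^c₂ = (-1)^(a₁ c₂) dt^c₂ ε^a₁`. -/
def Coll.mul (𝒳 𝒴 : Coll M T) : Coll M T := fun m k =>
  ∑ c₁ : Fin 2, ∑ c₂ : Fin 2, ∑ a₁ : Fin 2, ∑ a₂ : Fin 2,
    ∑ b ∈ Finset.HasAntidiagonal.antidiagonal m.dep, ∑ q ∈ (Finset.HasAntidiagonal.antidiagonal k).attach,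
      if (c₁ : ℕ) + c₂ = m.dt ∧ (a₁ : ℕ) + a₂ = m.ep then
        (-1 : ℝ) ^ (Mono.deg ⟨c₁, a₁, b.1⟩ * q.1.2 + a₁ * c₂) •
          TForm.wedge (Finset.HasAntidiagonal.mem_antidiagonal.1 q.2)
            (𝒳 ⟨c₁, a₁, b.1⟩ q.1.1) (𝒴 ⟨c₂, a₂, b.2⟩ q.1.2)
      else 0

/-- Powers. -/
def Coll.pow (𝒳 : Coll M T) : ℕ → Coll M T
  | 0 => Coll.one
  | n + 1 => Coll.mul 𝒳 (Coll.pow 𝒳 n)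

/-- `𝓔 = exp 𝒳 = ∑ 𝒳ⁿ / n!`, the series converging in every coefficient and at every point. -/
def Coll.IsExp (𝒳 𝓔 : Coll M T) : Prop :=
  ∀ m k i x (v : Fin k → TangentSpace (𝓡 3) x),
    HasSum (fun n : ℕ => (n ! : ℝ)⁻¹ * Coll.pow 𝒳 n m k i x v) (𝓔 m k i x v)

/-- The total differential, `α ⊗ r ↦ δα ⊗ r + (-1)^|α| α ⊗ dr`. On the parameter ring `d` is
the derivation given by `g(t) ↦ g'(t) dt` and `ε ↦ dε`. -/
def Coll.diff (𝒳 : Coll M T) : Coll M T := fun m k =>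
  TForm.codiff o (𝒳 m (k + 1))
    + (if m.dt = 1 then (-1 : ℝ) ^ k • TForm.ddt (𝒳 ⟨0, m.ep, m.dep⟩ k) else 0)
    + (if m.ep = 0 ∧ 0 < m.dep then
        (-1 : ℝ) ^ (k + (m.dt : ℕ)) • 𝒳 ⟨m.dt, 1, m.dep - 1⟩ k else 0)

/-- Collections of homotopy random variables: smooth elements of degree zero whose exponential
(the moment generating function) is closed. -/
structure IsCollection (𝒳 : Coll M T) : Prop where
  degree_zero : ∀ m k, k ≠ m.deg → 𝒳 m k = 0
  smooth : ∀ m k, SmoothForm (𝒳 m k)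
  closed : ∃ 𝓔 : Coll M T, Coll.IsExp 𝒳 𝓔 ∧ (∀ m k, SmoothForm (𝓔 m k)) ∧ Coll.diff o 𝓔 = 0

/-- Collections of homotopy random variables parametrized by `ℝ[ε, dε]`: there is no time
parameter, and `dt` does not occur. -/
def IsParamCollection (𝒴 : Coll M TimeModel.point) : Prop :=
  IsCollection o 𝒴 ∧ ∀ m k, m.dt = 1 → 𝒴 m k = 0

/-- The evaluation `𝒳|_{t = s, dt = 0}`. -/
def Coll.evalAt (𝒳 : Coll M T) (s : T.Idx) : Coll M TimeModel.point := fun m k _ =>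
  if m.dt = 0 then 𝒳 m k s else 0

/-- Homotopies of `ℝ[ε, dε]`-collections: collections of homotopy random variables parametrized by
`ℝ[ε, dε][[t, dt]]` whose values at all instants (the collections related by the homotopy)
are `ℝ[ε, dε]`-collections. -/
structure IsHomotopy (𝒳 : Coll M T) : Prop where
  isCollection : IsCollection o 𝒳
  eval : ∀ s, T.IsInstant s → IsParamCollection o (𝒳.evalAt s)

/-! The components of a degree zero element
`f + X dt + V ε + π dt ε + σ dε + Φ dt dε + Ψ ε dε`. -/

/-- The coefficient `f` of `1`. -/
def Coll.f (𝒳 : Coll M T) : TFun M T := fun i => Form.toFun (𝒳 ⟨0, 0, 0⟩ 0 i)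

/-- The coefficient `X` of `dt`. -/
def Coll.X (𝒳 : Coll M T) : TForm M T 1 := 𝒳 ⟨1, 0, 0⟩ 1

/-- The coefficient `V` of `ε`. -/
def Coll.V (𝒳 : Coll M T) : TForm M T 1 := 𝒳 ⟨0, 1, 0⟩ 1

/-- The coefficient `π` of `dt ε`. -/
def Coll.π (𝒳 : Coll M T) : TForm M T 2 := 𝒳 ⟨1, 1, 0⟩ 2

/-- The coefficient `σ` of `dε`. -/
def Coll.σ (𝒳 : Coll M T) : TForm M T 2 := 𝒳 ⟨0, 0, 1⟩ 2

/-- The coefficient `Φ` of `dt dε`. -/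
def Coll.Φ (𝒳 : Coll M T) : TForm M T 3 := 𝒳 ⟨1, 0, 1⟩ 3

/-- The coefficient `Ψ` of `ε dε`. -/
def Coll.Ψ (𝒳 : Coll M T) : TForm M T 3 := 𝒳 ⟨0, 1, 1⟩ 3

/-- `½ δ(X ∧ ⋆X) - δ(X) ⋆X`. -/
def kinetic (X : TForm M T 1) : TForm M T 2 :=
  (1 / 2 : ℝ) • TForm.codiff o (TForm.wedge (rfl : 1 + 2 = 3) X (TForm.hodge o (rfl : 1 + 2 = 3) X))
    - TForm.smul (fun i => Form.toFun (TForm.codiff o (k := 0) X i))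
        (TForm.hodge o (rfl : 1 + 2 = 3) X)

/-- `𝒳` and `(ρ, u, p)` correspond under the identifications `ρ = exp f`, `X = u♭`,
`V = -⋆d(ρX)/ρ`, `π = ½ δ(X ∧ ⋆X) - δ(X) ⋆X`, `σ = ⋆X`, `Φ = ⋆p/ρ`, `Ψ = X ∧ dX`. -/
structure Identified (ρ : TFun M T) (u : TVec M T) (p : TFun M T) (𝒳 : Coll M T) : Prop where
  density : IsExpFun 𝒳.f ρ
  X_eq : 𝒳.X = TVec.flat u
  V_eq : 𝒳.V = -TForm.smul (TFun.inv ρ)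
    (TForm.hodge o (rfl : 2 + 1 = 3) (TForm.d (TForm.smul ρ 𝒳.X)))
  π_eq : 𝒳.π = kinetic o 𝒳.X
  σ_eq : 𝒳.σ = TForm.hodge o (rfl : 1 + 2 = 3) 𝒳.X
  Φ_eq : 𝒳.Φ = TForm.smul (TFun.inv ρ)
    (TForm.hodge o (rfl : 0 + 3 = 3) fun i => Form.ofFun (p i))
  Ψ_eq : 𝒳.Ψ = TForm.wedge (rfl : 1 + 2 = 3) 𝒳.X (TForm.d 𝒳.X)

end Manifold

end FluidHPT

end

noncomputable section

namespace FluidHPT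
namespace TimeModel

/-! ### Time-dependent numbers as a commutative ring -/

section Conv

variable {A B C D : Type}

/-! Write `𝒳 = f + N`, where `N` collects the coefficients of positive form degree. A product of
three terms of `N` vanishes: in dimension three all three factors would have to be one-forms, and
their monomials then repeat `dt` or `ε`. Hence `exp 𝒳 = ρ (1 + N + N² / 2)` with `ρ = exp f`
(`Coll.isExp_expColl`), and its coefficients are ρ, ρX, ρV, ρσ, ρ(π − X∧V), ρ(Φ + X∧σ), ρ(Ψ + V∧σ).

Closedness of this element is read off at the monomials `dt`, `dε`, `dt dε`, `(dε)²`. It says δ(ρX)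
+ ∂ₜρ = 0, ρV = δ(ρσ), δ(ρ(Φ + X∧σ)) + ∂ₜ(ρσ) = ρ(π − X∧V) and ρ(Ψ + V∧σ) = 0. These are the
`Coll.BalanceLaws`. All other coefficients of the differential vanish as a consequence, because δδ =
0 and δ commutes with ∂ₜ (`Coll.diff_eq_zero_of`).

Now insert σ = ⋆X and the prescribed π. The first law is conservation of mass, the second one is the
formula V = −⋆d(ρX)/ρ. In the fourth, ρV∧⋆X = −X∧d(ρX) = −ρ X∧dX, so Ψ = X∧dX (`smul_helicity`). In
the third, set p = ⋆(ρΦ) and let u be the vector field with X = u♭. The terms containing ∂ₜρ, δX or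
dρ cancel by conservation of mass and u × (∇ρ × u) = |u|²∇ρ − (u·∇ρ)u. What is left is the star of
ρ(∂ₜX + d(|X|²/2) − (u × curl u)♭) + dp (`momentum_balance`). The star and ♭ are injective and ρ is
invertible, so this is the Euler momentum equation, and `balanceLaws_iff` is an equivalence.
Existence takes f = log ρ and the identifications as definitions; uniqueness uses that exp is
injective; the converse reads the equivalence the other way.

The time models are treated together. Evaluating a time-dependent form on fixed tangent vectors
gives an element of a commutative ring `T.Scalar`, with an operator `Scalar.D` obeying the product
rule on differentiable elements. Identities between forms thus become ring identities, checked at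
each point in an oriented orthonormal frame. Smoothness is handled separately, in coordinate frames:
there the star has coefficients built from the Gram matrix and the volume coefficient, which is plus
or minus the square root of the Gram determinant. -/

theorem conv_add_left [AddCommMonoid A] [AddCommMonoid C] (T : TimeModel) {F : A → B → C}
    (hF : ∀ a a' b, F (a + a') b = F a b + F a' b) (a a' : T.Idx → A) (b : T.Idx → B) :
    T.conv F (a + a') b = T.conv F a b + T.conv F a' b := by
  cases T with
  | point => funext t; exact hF _ _ _
  | interval J => funext t; exact hF _ _ _
  | formal =>
    funext n
    exact (Finset.sum_congr rfl fun q _ => hF _ _ _).trans Finset.sum_add_distrib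

theorem conv_swap [AddCommMonoid C] (T : TimeModel) (F : A → B → C)
    (a : T.Idx → A) (b : T.Idx → B) :
    T.conv F a b = T.conv (fun y x => F x y) b a := by
  cases T with
  | point => rfl
  | interval J => rfl
  | formal =>
    funext n
    exact (Finset.Nat.sum_antidiagonal_swap (n := (n : ℕ))
      (f := fun q : ℕ × ℕ => F (a q.1) (b q.2))).symm

theorem map_conv [AddCommMonoid C] [AddCommMonoid D] (T : TimeModel) (L : C →+ D) (F : A → B → C)
    (a : T.Idx → A) (b : T.Idx → B) (i : T.Idx) :
    L (T.conv F a b i) = T.conv (fun x y => L (F x y)) a b i := by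
  cases T with
  | point => rfl
  | interval J => rfl
  | formal => exact map_sum L _ _

theorem conv_fun_add [AddCommMonoid C] (T : TimeModel) (F G : A → B → C)
    (a : T.Idx → A) (b : T.Idx → B) :
    T.conv (fun x y => F x y + G x y) a b = T.conv F a b + T.conv G a b := by
  cases T with
  | point => rfl
  | interval J => rfl
  | formal => funext n; exact Finset.sum_add_distrib

theorem conv_fun_sum [AddCommMonoid C] (T : TimeModel) {ι : Type} (s : Finset ι)
    (F : ι → A → B → C) (a : T.Idx → A) (b : T.Idx → B) :
    T.conv (fun x y => ∑ j ∈ s, F j x y) a b = ∑ j ∈ s, T.conv (F j) a b := by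
  cases T with
  | point => funext n; simp [conv]
  | interval J => funext n; simp [conv]
  | formal =>
    funext n
    rw [Finset.sum_apply]
    exact Finset.sum_comm

theorem conv_fun_smul [AddCommGroup C] [Module ℝ C] (T : TimeModel) (c : ℝ) (F : A → B → C)
    (a : T.Idx → A) (b : T.Idx → B) :
    T.conv (fun x y => c • F x y) a b = c • T.conv F a b := by
  cases T with
  | point => rfl
  | interval J => rfl
  | formal => funext n; exact Finset.smul_sum.symm

/-- The zeroth coefficient of a Cauchy product has a single term. Evaluation at an instant is
therefore multiplicative, which is what makes restriction of a homotopy to an instant compatible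
with all products. -/
theorem conv_instant [AddCommMonoid C] (T : TimeModel) (F : A → B → C)
    (a : T.Idx → A) (b : T.Idx → B) {s : T.Idx} (hs : T.IsInstant s) :
    T.conv F a b s = F (a s) (b s) := by
  cases T with
  | point => rfl
  | interval J => rfl
  | formal =>
    obtain rfl : s = (0 : ℕ) := hs
    simp [conv]

end Conv
-- A wrapper around `T.Idx → ℝ`: the bare function type already has pointwise multiplication, which
-- is the wrong product in the formal model.
@[ext]
structure Scalar (T : TimeModel) where
  /-- The underlying time-dependent number. -/
  val : T.Idx → ℝ

namespace Scalar

variable {T : TimeModel}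

instance : Zero T.Scalar := ⟨⟨fun _ => 0⟩⟩
instance : One T.Scalar := ⟨⟨T.one⟩⟩
instance : Add T.Scalar := ⟨fun a b => ⟨fun i => a.val i + b.val i⟩⟩
instance : Neg T.Scalar := ⟨fun a => ⟨fun i => -a.val i⟩⟩
instance : Sub T.Scalar := ⟨fun a b => ⟨fun i => a.val i - b.val i⟩⟩
instance : SMul ℝ T.Scalar := ⟨fun c a => ⟨fun i => c * a.val i⟩⟩
instance : Mul T.Scalar := ⟨fun a b => ⟨T.conv (fun r s => r * s) a.val b.val⟩⟩

theorem one_val : (1 : T.Scalar).val = T.one := rfl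
theorem smul_val (c : ℝ) (a : T.Scalar) : (c • a).val = c • a.val := rfl
theorem mul_val (a b : T.Scalar) : (a * b).val = T.conv (fun r s => r * s) a.val b.val := rfl

/-- The power series with given coefficients. -/
def series (a : formal.Scalar) : PowerSeries ℝ := PowerSeries.mk fun n : ℕ => a.val n

theorem coeff_series (a : formal.Scalar) (n : ℕ) : PowerSeries.coeff n a.series = a.val n :=
  PowerSeries.coeff_mk _ _

/-- In the formal model, ring identities are transported from `PowerSeries ℝ` along this injection.
-/
theorem series_injective : Function.Injective series := by
  intro a b h
  refine Scalar.ext (funext fun n => ?_)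
  exact (coeff_series a n).symm.trans ((congrArg _ h).trans (coeff_series b n))

theorem series_mul (a b : formal.Scalar) : (a * b).series = a.series * b.series := by
  ext n
  rw [coeff_series, PowerSeries.coeff_mul]
  simp only [coeff_series]
  rfl

theorem series_add (a b : formal.Scalar) : (a + b).series = a.series + b.series := by
  ext n
  rw [map_add]
  simp only [coeff_series]
  rfl

theorem series_one : (1 : formal.Scalar).series = 1 := by
  ext n
  rw [coeff_series]
  rfl

protected theorem mul_comm' (a b : T.Scalar) : a * b = b * a := by
  apply Scalar.ext
  rw [mul_val, mul_val, conv_swap]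
  simp only [mul_comm]

protected theorem mul_assoc' (a b c : T.Scalar) : a * b * c = a * (b * c) := by
  cases T with
  | point => ext t; exact mul_assoc _ _ _
  | interval J => ext t; exact mul_assoc _ _ _
  | formal =>
    apply series_injective
    simp only [series_mul, mul_assoc]

protected theorem one_mul' (a : T.Scalar) : 1 * a = a := by
  cases T with
  | point => ext t; exact one_mul _
  | interval J => ext t; exact one_mul _
  | formal =>
    apply series_injective
    rw [series_mul, series_one, one_mul]

protected theorem add_mul' (a b c : T.Scalar) : (a + b) * c = a * c + b * c := by
  apply Scalar.ext
  exact conv_add_left T (fun _ _ _ => add_mul _ _ _) a.val b.val c.val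

instance : AddCommGroup T.Scalar where
  add_assoc a b c := by ext i; exact add_assoc _ _ _
  zero_add a := by ext i; exact zero_add _
  add_zero a := by ext i; exact add_zero _
  add_comm a b := by ext i; exact add_comm _ _
  neg_add_cancel a := by ext i; exact neg_add_cancel _
  sub_eq_add_neg a b := by ext i; exact sub_eq_add_neg _ _
  nsmul := nsmulRec
  zsmul := zsmulRec

protected theorem zero_mul' (a : T.Scalar) : 0 * a = 0 := by
  have h := Scalar.add_mul' 0 0 a
  rw [add_zero] at h
  exact left_eq_add.1 h

instance : CommRing T.Scalar where
  __ := (inferInstance : AddCommGroup T.Scalar)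
  mul_assoc := Scalar.mul_assoc'
  one_mul := Scalar.one_mul'
  mul_one a := (Scalar.mul_comm' _ _).trans (Scalar.one_mul' a)
  left_distrib a b c := by
    rw [Scalar.mul_comm' a, Scalar.mul_comm' a, Scalar.mul_comm' a, Scalar.add_mul']
  right_distrib := Scalar.add_mul'
  zero_mul := Scalar.zero_mul'
  mul_zero a := (Scalar.mul_comm' _ _).trans (Scalar.zero_mul' a)
  mul_comm := Scalar.mul_comm'

instance : Module ℝ T.Scalar where
  one_smul a := by ext i; exact one_mul _
  mul_smul c c' a := by ext i; exact mul_assoc _ _ _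
  smul_zero c := by ext i; exact mul_zero _
  smul_add c a b := by ext i; exact mul_add _ _ _
  add_smul c c' a := by ext i; exact add_mul _ _ _
  zero_smul a := by ext i; exact zero_mul _

protected theorem smul_mul' (c : ℝ) (a b : T.Scalar) : (c • a) * b = c • (a * b) := by
  cases T with
  | point => ext t; exact mul_assoc _ _ _
  | interval J => ext t; exact mul_assoc _ _ _
  | formal =>
    refine Scalar.ext ((conv_fun_smul formal c (fun r s : ℝ => r * s) a.val b.val).symm.trans ?_).symm
    exact congrArg (fun F => formal.conv F a.val b.val) (by funext r s; exact (mul_assoc c r s).symm)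

instance : Algebra ℝ T.Scalar :=
  Algebra.ofModule Scalar.smul_mul' fun c a b => by
    rw [Scalar.mul_comm' a, Scalar.smul_mul', Scalar.mul_comm' a]

theorem natCast_mul_val (n : ℕ) (a : T.Scalar) (i : T.Idx) :
    ((n : T.Scalar) * a).val i = (n : ℝ) * a.val i := by
  rw [← nsmul_eq_mul, ← Nat.cast_smul_eq_nsmul ℝ]
  rfl

theorem sum_val {ι : Type} (s : Finset ι) (a : ι → T.Scalar) (i : T.Idx) :
    (∑ j ∈ s, a j).val i = ∑ j ∈ s, (a j).val i := by
  classical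
  induction s using Finset.induction_on with
  | empty => rfl
  | insert j s hj ih =>
    rw [Finset.sum_insert hj, Finset.sum_insert hj, ← ih]
    rfl

/-- Evaluation of a product at an index. -/
theorem conv_mul {A B : Type} (l : A → ℝ) (m : B → ℝ) (a : T.Idx → A) (b : T.Idx → B) :
    T.conv (fun x y => l x * m y) a b =
      ((⟨fun j => l (a j)⟩ : T.Scalar) * ⟨fun j => m (b j)⟩).val := by
  cases T <;> rfl

theorem pow_val (a : T.Scalar) (n : ℕ) : T.pow a.val n = (a ^ n).val := by
  induction n with
  | zero => rw [pow_zero]; rfl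
  | succ n ih =>
    rw [pow_succ']
    change T.conv _ a.val (T.pow a.val n) = _
    rw [ih]
    rfl

theorem mul_val_instant (a b : T.Scalar) {s : T.Idx} (hs : T.IsInstant s) :
    (a * b).val s = a.val s * b.val s :=
  conv_instant T _ _ _ hs

theorem pow_val_instant (a : T.Scalar) (n : ℕ) {s : T.Idx} (hs : T.IsInstant s) :
    (a ^ n).val s = a.val s ^ n := by
  induction n with
  | zero =>
    rw [pow_zero, pow_zero, one_val]
    cases T with
    | point => rfl
    | interval J => rfl
    | formal =>
      obtain rfl : s = (0 : ℕ) := hs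
      exact PowerSeries.coeff_zero_one
  | succ n ih => rw [pow_succ, pow_succ, mul_val_instant _ _ hs, ih]

/-- The multiplicative inverse. -/
def recip (a : T.Scalar) : T.Scalar := ⟨T.inv a.val⟩

theorem constantCoeff_series (a : formal.Scalar) :
    PowerSeries.constantCoeff a.series = a.val (0 : ℕ) := by
  rw [← PowerSeries.coeff_zero_eq_constantCoeff_apply, coeff_series]

theorem series_recip (a : formal.Scalar) : a.recip.series = a.series⁻¹ := by
  ext n
  rw [coeff_series]
  rfl

/-- Only instants matter: a power series over a field is invertible as soon as its constant
coefficient is nonzero. -/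
theorem mul_recip {a : T.Scalar} (ha : ∀ i, T.IsInstant i → a.val i ≠ 0) : a * a.recip = 1 := by
  cases T with
  | point => ext t; exact mul_inv_cancel₀ (ha t trivial)
  | interval J => ext t; exact mul_inv_cancel₀ (ha t trivial)
  | formal =>
    apply series_injective
    rw [series_mul, series_one, series_recip, PowerSeries.mul_inv_cancel]
    rw [constantCoeff_series]
    exact ha (0 : ℕ) rfl

theorem mul_left_cancel_of_instant {a b c : T.Scalar} (ha : ∀ i, T.IsInstant i → a.val i ≠ 0)
    (h : a * b = a * c) : b = c := by
  have h1 := mul_recip ha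
  linear_combination a.recip * h + (c - b) * h1

end Scalar

/-! ### The time derivative -/

/-- Differentiability with respect to time. -/
def Diff {A : Type} [NormedAddCommGroup A] [NormedSpace ℝ A] : (T : TimeModel) → (T.Idx → A) → Prop
  | point, _ => True
  | formal, _ => True
  | interval J, a => DifferentiableOn ℝ (extendZero J a) J

/-- Either there is no time parameter, or it ranges over formal power series or over a nondegenerate
interval. -/
def Good : TimeModel → Prop
  | point => True
  | formal => True
  | interval J => J.OrdConnected ∧ J.Nontrivial

theorem IsTime.good {T : TimeModel} (h : T.IsTime) : T.Good := by
  cases T with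
  | point => trivial
  | formal => trivial
  | interval J => exact h

theorem nonempty_interior_of_nontrivial {J : Set ℝ} (h : J.OrdConnected ∧ J.Nontrivial) :
    (interior J).Nonempty := by
  obtain ⟨a, ha, b, hb, hab⟩ := h.2
  wlog hlt : a < b generalizing a b
  · exact this b hb a ha hab.symm (lt_of_le_of_ne (not_lt.1 hlt) hab.symm)
  refine (Set.nonempty_Ioo.2 hlt).mono (interior_maximal ?_ isOpen_Ioo)
  exact Set.Ioo_subset_Icc_self.trans (h.1.out ha hb)

theorem uniqueDiffOn_of_nontrivial {J : Set ℝ} (h : J.OrdConnected ∧ J.Nontrivial) :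
    UniqueDiffOn ℝ J :=
  uniqueDiffOn_convex h.1.convex (nonempty_interior_of_nontrivial h)

theorem extendZero_of_mem {A : Type} [Zero A] {J : Set ℝ} (a : J → A) {s : ℝ} (h : s ∈ J) :
    extendZero J a s = a ⟨s, h⟩ := by
  simp [extendZero, h]

theorem extendZero_of_notMem {A : Type} [Zero A] {J : Set ℝ} (a : J → A) {s : ℝ} (h : s ∉ J) :
    extendZero J a s = 0 := by
  simp [extendZero, h]

theorem extendZero_coe {A : Type} [Zero A] {J : Set ℝ} (a : J → A) (t : J) :
    extendZero J a t = a t := extendZero_of_mem a t.2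

/-- Because `L 0 = 0`, the two extensions agree off `J` as well, so this is an equality of functions
on the whole line and can be used under `derivWithin` and `ContDiffOn`. -/
theorem extendZero_map {A B : Type} [Zero A] [Zero B] (J : Set ℝ) (L : A → B) (hL : L 0 = 0)
    (a : J → A) : extendZero J (fun j => L (a j)) = fun s => L (extendZero J a s) := by
  funext s
  by_cases h : s ∈ J
  · rw [extendZero_of_mem _ h, extendZero_of_mem _ h]
  · rw [extendZero_of_notMem _ h, extendZero_of_notMem _ h, hL]

section ddt

variable {T : TimeModel} {A B : Type} [NormedAddCommGroup A] [NormedSpace ℝ A]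
  [NormedAddCommGroup B] [NormedSpace ℝ B]

theorem diff_interval {J : Set ℝ} {a : (interval J).Idx → A} :
    (interval J).Diff a ↔ DifferentiableOn ℝ (extendZero J a) J := Iff.rfl

theorem Diff.map {a : T.Idx → A} (ha : T.Diff a) (L : A →L[ℝ] B) : T.Diff (fun j => L (a j)) := by
  cases T with
  | point => trivial
  | formal => trivial
  | interval J =>
    rw [diff_interval]
    exact (L.differentiable.comp_differentiableOn ha).congr fun s _ =>
      congrFun (extendZero_map J L (map_zero L) a) s

/-- Differentiability matters in the interval model: `L ∘ a` may be differentiable where `a` is not,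
and there `derivWithin` of `a` has the default value zero. Nondegeneracy of the interval makes the
derivative within it unique. -/
theorem ddt_map (hT : T.Good) {a : T.Idx → A} (ha : T.Diff a) (L : A →L[ℝ] B) (i : T.Idx) :
    T.ddt (fun j => L (a j)) i = L (T.ddt a i) := by
  cases T with
  | point => exact (map_zero L).symm
  | formal => exact (map_smul L _ _).symm
  | interval J =>
    have h : ∀ t : J, (interval J).ddt (fun j => L (a j)) t = L ((interval J).ddt a t) := by
      intro t
      refine (congrArg (fun g => derivWithin g J (t : ℝ))
        (extendZero_map J L (map_zero L) a)).trans ?_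
      exact (L.hasFDerivAt.comp_hasDerivWithinAt _ (ha t t.2).hasDerivWithinAt).derivWithin
        (uniqueDiffOn_of_nontrivial hT t t.2)
    exact h i

theorem extendZero_add {A : Type} [AddZeroClass A] {J : Set ℝ} (a b : J → A) :
    extendZero J (a + b) = extendZero J a + extendZero J b := by
  funext s
  by_cases h : s ∈ J <;> simp [extendZero, h]

theorem Diff.add {a b : T.Idx → A} (ha : T.Diff a) (hb : T.Diff b) : T.Diff (a + b) := by
  cases T with
  | point => trivial
  | formal => trivial
  | interval J =>
    exact (DifferentiableOn.add ha hb).congr fun s _ => congrFun (extendZero_add (J := J) a b) s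

theorem ddt_add (hT : T.Good) {a b : T.Idx → A} (ha : T.Diff a) (hb : T.Diff b) :
    T.ddt (a + b) = T.ddt a + T.ddt b := by
  cases T with
  | point => funext i; exact (add_zero _).symm
  | formal => funext n; exact smul_add _ _ _
  | interval J =>
    have h : ∀ t : J, (interval J).ddt (a + b) t = (interval J).ddt a t + (interval J).ddt b t := by
      intro t
      refine (congrArg (fun g => derivWithin g J (t : ℝ)) (extendZero_add (J := J) a b)).trans ?_
      exact derivWithin_add (ha t t.2) (hb t t.2)
    exact funext h

theorem extendZero_zero {A : Type} [Zero A] {J : Set ℝ} : extendZero J (0 : J → A) = fun _ => 0 := by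
  funext s
  simp [extendZero]

theorem diff_zero : T.Diff (0 : T.Idx → A) := by
  cases T with
  | point => trivial
  | formal => trivial
  | interval J =>
    exact (differentiableOn_const (0 : A)).congr fun s _ => congrFun (extendZero_zero (J := J)) s

theorem ddt_zero : T.ddt (0 : T.Idx → A) = 0 := by
  cases T with
  | point => rfl
  | formal => funext n; exact smul_zero _
  | interval J =>
    have h : ∀ t : J, (interval J).ddt (0 : J → A) t = 0 := by
      intro t
      refine (congrArg (fun g => derivWithin g J (t : ℝ)) (extendZero_zero (J := J))).trans ?_
      exact congrFun (derivWithin_fun_const J (0 : A)) (t : ℝ)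
    exact funext h

theorem Diff.sum {ι : Type} (s : Finset ι) {a : ι → T.Idx → A} (ha : ∀ j ∈ s, T.Diff (a j)) :
    T.Diff (∑ j ∈ s, a j) := by
  classical
  induction s using Finset.induction_on with
  | empty => exact diff_zero
  | insert j s hj ih =>
    rw [Finset.sum_insert hj]
    exact (ha j (Finset.mem_insert_self _ _)).add
      (ih fun l hl => ha l (Finset.mem_insert_of_mem hl))

theorem ddt_sum (hT : T.Good) {ι : Type} (s : Finset ι) {a : ι → T.Idx → A}
    (ha : ∀ j ∈ s, T.Diff (a j)) : T.ddt (∑ j ∈ s, a j) = ∑ j ∈ s, T.ddt (a j) := by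
  classical
  induction s using Finset.induction_on with
  | empty => exact ddt_zero
  | insert j s hj ih =>
    have h : ∀ l ∈ s, T.Diff (a l) := fun l hl => ha l (Finset.mem_insert_of_mem hl)
    rw [Finset.sum_insert hj, Finset.sum_insert hj,
      ddt_add hT (ha j (Finset.mem_insert_self _ _)) (Diff.sum s h), ih h]

end ddt

namespace Scalar

variable {T : TimeModel}

theorem extendZero_mul {J : Set ℝ} (a b : (interval J).Scalar) :
    extendZero J (a * b).val = extendZero J a.val * extendZero J b.val := by
  funext s
  by_cases h : s ∈ J
  · rw [Pi.mul_apply]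
    exact (extendZero_of_mem (J := J) _ h).trans (congrArg₂ (· * ·)
      (extendZero_of_mem (J := J) _ h).symm (extendZero_of_mem (J := J) _ h).symm)
  · rw [Pi.mul_apply]
    exact (extendZero_of_notMem (J := J) _ h).trans (by
      rw [extendZero_of_notMem (J := J) a.val h, zero_mul])

/-- The time derivative of a time-dependent number. -/
def D (a : T.Scalar) : T.Scalar := ⟨T.ddt a.val⟩

theorem series_D (a : formal.Scalar) : a.D.series = PowerSeries.derivative ℝ a.series := by
  ext n
  rw [coeff_series, PowerSeries.coeff_derivative, coeff_series, mul_comm]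
  rfl

/-- The product rule within `J` in the interval model, and the derivation property of
`PowerSeries.derivative` in the formal one. -/
theorem D_mul (hT : T.Good) {a b : T.Scalar} (ha : T.Diff a.val) (hb : T.Diff b.val) :
    D (a * b) = a * D b + D a * b := by
  cases T with
  | point =>
    ext i
    change (0 : ℝ) = a.val i * 0 + 0 * b.val i
    simp
  | interval J =>
    have h : ∀ t : J, (D (a * b)).val t = (a * D b + D a * b).val t := by
      intro t
      refine (congrArg (fun g => derivWithin g J (t : ℝ)) (extendZero_mul a b)).trans ?_
      rw [derivWithin_mul (ha t t.2) (hb t t.2), add_comm]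
      exact congrArg₂ (· + ·)
        (congrArg (· * derivWithin (extendZero J b.val) J (t : ℝ)) (extendZero_coe (J := J) a.val t))
        (congrArg (derivWithin (extendZero J a.val) J (t : ℝ) * ·) (extendZero_coe (J := J) b.val t))
    exact Scalar.ext (funext h)
  | formal =>
    apply series_injective
    rw [series_D, series_mul, Derivation.leibniz, series_add, series_mul, series_mul, series_D,
      series_D]
    simp only [smul_eq_mul]
    ring

end Scalar

end TimeModel
end FluidHPT

namespace FluidHPT
namespace TimeModel

/-! ### Exponential and logarithm of time-dependent numbers -/

namespace Scalar

variable {T : TimeModel}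

/-- `r = exp a`. -/
def IsExp (a r : T.Scalar) : Prop :=
  ∀ i, HasSum (fun n : ℕ => (n ! : ℝ)⁻¹ * (a ^ n).val i) (r.val i)

theorem IsExp.val_instant {a r : T.Scalar} (h : IsExp a r) {s : T.Idx} (hs : T.IsInstant s) :
    r.val s = Real.exp (a.val s) := by
  have h1 := h s
  simp only [pow_val_instant _ _ hs] at h1
  have h2 := NormedSpace.expSeries_div_hasSum_exp (a.val s)
  rw [← Real.exp_eq_exp_ℝ] at h2
  refine h1.unique ?_
  simpa only [div_eq_inv_mul] using h2

/-- Each coefficient of a Cauchy product is a finite sum, so coefficientwise convergence survives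
multiplication by a fixed series. -/
theorem hasSum_mul {g : ℕ → T.Scalar} {r : T.Scalar}
    (h : ∀ i, HasSum (fun n => (g n).val i) (r.val i)) (b : T.Scalar) (i : T.Idx) :
    HasSum (fun n => (g n * b).val i) ((r * b).val i) := by
  cases T with
  | point => exact (h i).mul_right _
  | interval J => exact (h i).mul_right _
  | formal =>
    have (m : ℕ) := hasSum_sum (s := Finset.HasAntidiagonal.antidiagonal m)
      fun (q : ℕ × ℕ) _ => (h q.1).mul_right (b.val q.2)
    exact this i

theorem hasSum_of_shift {f g : ℕ → ℝ} {s : ℝ} (j : ℕ) (h0 : ∀ n < j, f n = 0)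
    (h : ∀ n, f (n + j) = g n) (hg : HasSum g s) : HasSum f s := by
  rw [← hasSum_nat_add_iff' j, Finset.sum_eq_zero fun n hn => h0 n (Finset.mem_range.1 hn),
    sub_zero]
  exact hg.congr_fun h

theorem IsExp.hasSum_smul {a r : T.Scalar} (h : IsExp a r) (b : T.Scalar) (i : T.Idx) :
    HasSum (fun n : ℕ => (n ! : ℝ)⁻¹ * (a ^ n * b).val i) ((r * b).val i) := by
  have := hasSum_mul (g := fun n => (n ! : ℝ)⁻¹ • a ^ n) (r := r) h b i
  simp only [smul_mul_assoc] at this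
  exact this

/-- Summation of `n a ^ (n - 1) / n!`. -/
theorem IsExp.hasSum_linear {a r : T.Scalar} (h : IsExp a r) (b : T.Scalar) (i : T.Idx) :
    HasSum (fun n : ℕ => (n ! : ℝ)⁻¹ * ((n : T.Scalar) * (a ^ (n - 1) * b)).val i)
      ((r * b).val i) := by
  refine hasSum_of_shift 1 (fun n hn => ?_) (fun n => ?_) (h.hasSum_smul b i)
  · obtain rfl : n = 0 := by omega
    rw [Nat.cast_zero, zero_mul]
    exact mul_zero _
  · rw [natCast_mul_val, Nat.factorial_succ, add_tsub_cancel_right]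
    push_cast
    field_simp

/-- Summation of `n (n - 1) a ^ (n - 2) / n!`. -/
theorem IsExp.hasSum_quadratic {a r : T.Scalar} (h : IsExp a r) (b : T.Scalar) (i : T.Idx) :
    HasSum (fun n : ℕ => (n ! : ℝ)⁻¹ * (((n * (n - 1) : ℕ) : T.Scalar) * (a ^ (n - 2) * b)).val i)
      ((r * b).val i) := by
  refine hasSum_of_shift 2 (fun n hn => ?_) (fun n => ?_) (h.hasSum_smul b i)
  · have : n * (n - 1) = 0 := by interval_cases n <;> rfl
    rw [this, Nat.cast_zero, zero_mul]
    exact mul_zero _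
  · rw [natCast_mul_val, Nat.factorial_succ, Nat.factorial_succ, add_tsub_cancel_right]
    push_cast [show n + 2 - 1 = n + 1 from rfl]
    field_simp
    ring

theorem isExp_interval_iff {J : Set ℝ} {a r : (interval J).Scalar} :
    IsExp a r ↔ ∀ t, r.val t = Real.exp (a.val t) := by
  refine ⟨fun h t => h.val_instant trivial, fun h t => ?_⟩
  have h2 := NormedSpace.expSeries_div_hasSum_exp (a.val t)
  rw [← Real.exp_eq_exp_ℝ, ← h t] at h2
  simpa only [div_eq_inv_mul, pow_val_instant a _ (s := t) trivial] using h2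

theorem isExp_point_iff {a r : point.Scalar} :
    IsExp a r ↔ ∀ t, r.val t = Real.exp (a.val t) := by
  refine ⟨fun h t => h.val_instant trivial, fun h t => ?_⟩
  have h2 := NormedSpace.expSeries_div_hasSum_exp (a.val t)
  rw [← Real.exp_eq_exp_ℝ, ← h t] at h2
  simpa only [div_eq_inv_mul, pow_val_instant a _ (s := t) trivial] using h2

theorem series_pow (a : formal.Scalar) (n : ℕ) : (a ^ n).series = a.series ^ n := by
  induction n with
  | zero => rw [pow_zero, pow_zero, series_one]
  | succ n ih => rw [pow_succ, pow_succ, series_mul, ih]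

theorem D_one : D (1 : formal.Scalar) = 0 := by
  apply series_injective
  rw [series_D, series_one, Derivation.map_one_eq_zero]
  rfl

theorem D_pow (a : formal.Scalar) (n : ℕ) : D (a ^ n) = (n : formal.Scalar) * (a ^ (n - 1) * D a) := by
  induction n with
  | zero =>
    rw [pow_zero, D_one, Nat.cast_zero, zero_mul]
  | succ n ih =>
    rw [pow_succ, D_mul (T := formal) trivial trivial trivial, ih]
    rcases n with _ | n
    · simp
    · push_cast [add_tsub_cancel_right]
      ring

/-- Coefficient `n` of `D r` is a multiple of coefficient `n + 1` of `r`, so the exponential series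
may be differentiated term by term. In the formal model this differential equation, with the
constant coefficient, determines the exponential. -/
theorem IsExp.D_eq {a r : formal.Scalar} (h : IsExp a r) : D r = r * D a := by
  refine Scalar.ext (funext fun (n : ℕ) => ?_)
  have h1 := (h (n + 1 : ℕ)).mul_left ((n : ℝ) + 1)
  have h2 := h.hasSum_linear (D a) (n : ℕ)
  refine h1.unique (h2.congr_fun fun m => ?_)
  rw [← D_pow]
  change _ = (m ! : ℝ)⁻¹ * (((n : ℝ) + 1) * (a ^ m).val (n + 1 : ℕ))
  ring

/-- Split off the constant coefficient, a = c + tN, and expand aⁿ binomially. The powers (tN)ʲ with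
j > i do not reach coefficient i, so that coefficient of the series is a finite combination of
shifted exponential series of the real number c. -/
theorem exists_isExp_formal (a : formal.Scalar) : ∃ r, IsExp a r := by
  suffices h : ∀ i : ℕ, ∃ s : ℝ,
      HasSum (fun n : ℕ => (n ! : ℝ)⁻¹ * PowerSeries.coeff i (a.series ^ n)) s by
    choose r hr using h
    refine ⟨⟨r⟩, fun i => ?_⟩
    refine (hr i).congr_fun fun n => ?_
    rw [← series_pow]
    exact congrArg _ (coeff_series (a ^ n) i).symm
  intro i
  set c := PowerSeries.constantCoeff a.series
  obtain ⟨N, hN⟩ : ∃ N : PowerSeries ℝ, a.series = PowerSeries.X * N + PowerSeries.C c :=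
    ⟨_, (PowerSeries.eq_X_mul_shift_add_const _)⟩
  have hcoef : ∀ n : ℕ, (n ! : ℝ)⁻¹ * PowerSeries.coeff i (a.series ^ n) =
      ∑ j ∈ Finset.range (i + 1), if j ≤ n then
        ((n - j)! : ℝ)⁻¹ * c ^ (n - j) *
          ((j ! : ℝ)⁻¹ * PowerSeries.coeff i ((PowerSeries.X * N) ^ j)) else 0 := by
    intro n
    have hz : ∀ j, i < j → PowerSeries.coeff i ((PowerSeries.X * N) ^ j) = 0 := by
      intro j hj
      rw [mul_pow, PowerSeries.coeff_X_pow_mul', if_neg (not_le.2 hj)]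
    have h1 : (n ! : ℝ)⁻¹ * PowerSeries.coeff i (a.series ^ n) =
        ∑ j ∈ Finset.range (n + 1), ((n - j)! : ℝ)⁻¹ * c ^ (n - j) *
          ((j ! : ℝ)⁻¹ * PowerSeries.coeff i ((PowerSeries.X * N) ^ j)) := by
      rw [hN, add_pow, map_sum, Finset.mul_sum]
      refine Finset.sum_congr rfl fun j hj => ?_
      have hj' : j ≤ n := Nat.lt_succ_iff.1 (Finset.mem_range.1 hj)
      rw [mul_assoc, ← map_pow, ← map_natCast (PowerSeries.C (R := ℝ)), ← map_mul,
        PowerSeries.coeff_mul_C, Nat.cast_choose ℝ hj']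
      have := Nat.factorial_ne_zero n
      field_simp
    rw [h1, ← Finset.sum_filter]
    -- The binomial sum runs over j ≤ n, whereas a range independent of n is needed to interchange
    -- it with the series. The terms with j > i are zero, so both ranges may be cut down to j ≤
    -- min(i, n).
    have : (Finset.range (i + 1)).filter (· ≤ n) = (Finset.range (n + 1)).filter (· ≤ i) := by
      ext j
      simp only [Finset.mem_filter, Finset.mem_range]
      omega
    rw [this, Finset.sum_filter_of_ne]
    intro j _ hj
    by_contra hlt
    exact hj (by rw [hz j (not_le.1 hlt), mul_zero, mul_zero])
  simp only [hcoef]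
  refine ⟨_, hasSum_sum fun j _ => (?_ : HasSum _ (Real.exp c *
    ((j ! : ℝ)⁻¹ * PowerSeries.coeff i ((PowerSeries.X * N) ^ j))))⟩
  have h2 := NormedSpace.expSeries_div_hasSum_exp c
  rw [← Real.exp_eq_exp_ℝ] at h2
  refine hasSum_of_shift j (fun n hn => if_neg (not_le.2 hn)) (fun n => ?_)
    (h2.mul_right ((j ! : ℝ)⁻¹ * PowerSeries.coeff i ((PowerSeries.X * N) ^ j)))
  rw [if_pos (Nat.le_add_left j n), add_tsub_cancel_right, div_eq_inv_mul]

/-- Coefficient `n + 1` is recovered from the derivative on division by `n + 1`, which is nonzero in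
characteristic zero. -/
theorem formal_ext {a b : formal.Scalar} (h0 : a.val (0 : ℕ) = b.val (0 : ℕ)) (h : D a = D b) :
    a = b := by
  refine Scalar.ext (funext fun (n : ℕ) => ?_)
  rcases n with _ | n
  · exact h0
  · have h1 : ((n : ℝ) + 1) * a.val (n + 1 : ℕ) = ((n : ℝ) + 1) * b.val (n + 1 : ℕ) :=
      congrFun (congrArg val h) (n : ℕ)
    exact mul_left_cancel₀ (by positivity) h1

/-- The logarithm of a time-dependent number with positive values. -/
def log : (T : TimeModel) → T.Scalar → T.Scalar
  | point, a => ⟨fun t => Real.log (a.val t)⟩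
  | interval _, a => ⟨fun t => Real.log (a.val t)⟩
  | formal, a => ⟨fun n : ℕ => Nat.casesOn n (Real.log (a.val (0 : ℕ)))
      fun m => ((m : ℝ) + 1)⁻¹ * (D a * a.recip).val (m : ℕ)⟩

theorem log_val_instant (a : T.Scalar) {s : T.Idx} (hs : T.IsInstant s) :
    (log T a).val s = Real.log (a.val s) := by
  cases T with
  | point => rfl
  | interval J => rfl
  | formal =>
    obtain rfl : s = (0 : ℕ) := hs
    rfl

theorem D_log (a : formal.Scalar) : D (log formal a) = D a * a.recip := by
  refine Scalar.ext (funext fun (n : ℕ) => ?_)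
  change ((n : ℝ) + 1) * (((n : ℝ) + 1)⁻¹ * (D a * a.recip).val (n : ℕ)) = _
  rw [mul_inv_cancel_left₀ (by positivity)]

/-- In the formal model let r' be the exponential of log r. Both r and r' solve y' = (Dr/r) y, so
r'/r has derivative zero; its constant coefficient is 1, whence r' = r. -/
theorem isExp_log {r : T.Scalar} (hr : ∀ i, T.IsInstant i → 0 < r.val i) : IsExp (log T r) r := by
  cases T with
  | point => exact isExp_point_iff.2 fun t => (Real.exp_log (hr t trivial)).symm
  | interval J => exact isExp_interval_iff.2 fun t => (Real.exp_log (hr t trivial)).symm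
  | formal =>
    have hne : ∀ i, formal.IsInstant i → r.val i ≠ 0 := fun i hi => (hr i hi).ne'
    obtain ⟨r', hr'⟩ := exists_isExp_formal (log formal r)
    have h1 := hr'.D_eq
    rw [D_log] at h1
    have h2 := mul_recip hne
    have h3 := D_mul (T := formal) trivial (a := r) (b := r.recip) trivial trivial
    rw [h2] at h3
    have hD1 := D_one
    have h4 := D_mul (T := formal) trivial (a := r') (b := r.recip) trivial trivial
    have h5 : r' * r.recip = 1 := by
      apply formal_ext
      · have h0 : formal.IsInstant (0 : ℕ) := rfl
        rw [mul_val_instant _ _ h0, hr'.val_instant h0, log_val_instant _ h0,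
          Real.exp_log (hr _ h0), ← mul_val_instant _ _ h0, h2]
      · rw [h4, h1]
        linear_combination -r' * r.recip * h3 + (r' * r.recip - 1) * hD1 - r' * D r.recip * h2
    have h6 : r' = r := by linear_combination r * h5 - r' * h2
    rwa [h6] at hr'

/-- At instants this is injectivity of the real exponential. For power series the higher
coefficients follow because r · Da = Dr = r · Db with r invertible. -/
theorem IsExp.injective {a b r : T.Scalar} (ha : IsExp a r) (hb : IsExp b r) : a = b := by
  have hinst : ∀ s, T.IsInstant s → a.val s = b.val s := fun s hs =>
    Real.exp_injective ((ha.val_instant hs).symm.trans (hb.val_instant hs))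
  cases T with
  | point => ext t; exact hinst t trivial
  | interval J => ext t; exact hinst t trivial
  | formal =>
    refine formal_ext (hinst _ rfl) ?_
    refine mul_left_cancel_of_instant (a := r) (fun i hi => ?_) (ha.D_eq.symm.trans hb.D_eq)
    rw [ha.val_instant hi]
    exact Real.exp_ne_zero _

end Scalar

end TimeModel
end FluidHPT

namespace FluidHPT

/-! ### Formulas in the exterior algebra of a three-dimensional space -/

theorem fin_one_eta {A : Type*} (f : Fin 1 → A) : f = ![f 0] := by
  funext a; fin_cases a; rfl

theorem fin_two_eta {A : Type*} (f : Fin 2 → A) : f = ![f 0, f 1] := by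
  funext a; fin_cases a <;> rfl

theorem fin_three_eta {A : Type*} (f : Fin 3 → A) : f = ![f 0, f 1, f 2] := by
  funext a; fin_cases a <;> rfl

section Fibre

variable {V : Type} [AddCommGroup V] [Module ℝ V]

/-- Antisymmetrizing the tensor product over all permutations counts every shuffle i! j! times. The
full permutation sum can be evaluated explicitly in low degrees, unlike the quotient indexing the
shuffles. -/
theorem wedge_apply {i j k : ℕ} (h : i + j = k) (α : V [⋀^Fin i]→ₗ[ℝ] ℝ) (β : V [⋀^Fin j]→ₗ[ℝ] ℝ)
    (v : Fin k → V) :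
    wedge h α β v = ((i ! * j ! : ℕ) : ℝ)⁻¹ * ∑ σ : Equiv.Perm (Fin k),
      ((Equiv.Perm.sign σ : ℤ) : ℝ) * (α (fun a => v (σ (Fin.cast h (Fin.castAdd j a)))) *
        β (fun b => v (σ (Fin.cast h (Fin.natAdd i b))))) := by
  subst h
  have h1 := congrArg (fun F => LinearMap.mul' ℝ ℝ (F (fun a => v (finSumFinEquiv a))))
    (MultilinearMap.domCoprod_alternization_eq α β)
  simp only [MultilinearMap.alternatization_apply, Fintype.card_fin, AlternatingMap.smul_apply,
    map_sum, map_nsmul] at h1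
  have h2 : wedge rfl α β v = LinearMap.mul' ℝ ℝ (α.domCoprod β fun a => v (finSumFinEquiv a)) := rfl
  have hne : ((i ! * j ! : ℕ) : ℝ) ≠ 0 := by positivity
  rw [h2, eq_inv_mul_iff_mul_eq₀ hne, ← nsmul_eq_mul, ← h1]
  refine Fintype.sum_equiv (finSumFinEquiv.permCongr) _ _ fun σ => ?_
  rw [Equiv.Perm.sign_permCongr]
  rcases Int.units_eq_one_or (Equiv.Perm.sign σ) with hσ | hσ <;>
  · rw [hσ]
    simp [finSumFinEquiv_symm_apply_castAdd, finSumFinEquiv_symm_apply_natAdd,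
      MultilinearMap.domDomCongr_apply, MultilinearMap.domCoprod_apply, Equiv.permCongr_apply]

theorem wedge_zero_left {k : ℕ} (h : 0 + k = k) (α : V [⋀^Fin 0]→ₗ[ℝ] ℝ) (β : V [⋀^Fin k]→ₗ[ℝ] ℝ)
    (v : Fin k → V) : wedge h α β v = α ![] * β v := by
  rw [wedge_apply]
  -- Every permutation contributes the same amount: its sign is cancelled by the sign from permuting
  -- the arguments of `β`. The k! equal terms then cancel the normalization.
  have : ∀ σ : Equiv.Perm (Fin k), ((Equiv.Perm.sign σ : ℤ) : ℝ) *
      (α (fun a => v (σ (Fin.cast h (Fin.castAdd k a)))) *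
        β (fun b => v (σ (Fin.cast h (Fin.natAdd 0 b))))) = α ![] * β v := by
    intro σ
    have h1 : (fun b => v (σ (Fin.cast h (Fin.natAdd 0 b)))) = v ∘ σ := by
      funext b
      simp [Function.comp]
    have h2 : (fun a => v (σ (Fin.cast h (Fin.castAdd k a)))) = ![] := Subsingleton.elim _ _
    rw [h1, h2, AlternatingMap.map_perm, Units.smul_def, zsmul_eq_mul]
    have h3 : ((Equiv.Perm.sign σ : ℤ) : ℝ) * ((Equiv.Perm.sign σ : ℤ) : ℝ) = 1 := by
      rw [← Int.cast_mul, Int.units_coe_mul_self, Int.cast_one]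
    linear_combination (α ![] * β v) * h3
  simp only [this, Finset.sum_const, Finset.card_univ, Fintype.card_perm, Fintype.card_fin,
    Nat.factorial_zero, one_mul, nsmul_eq_mul]
  exact inv_mul_cancel_left₀ (by positivity) _

theorem wedge_zero_right {k : ℕ} (h : k + 0 = k) (α : V [⋀^Fin k]→ₗ[ℝ] ℝ) (β : V [⋀^Fin 0]→ₗ[ℝ] ℝ)
    (v : Fin k → V) : wedge h α β v = α v * β ![] := by
  rw [wedge_apply]
  have : ∀ σ : Equiv.Perm (Fin k), ((Equiv.Perm.sign σ : ℤ) : ℝ) *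
      (α (fun a => v (σ (Fin.cast h (Fin.castAdd 0 a)))) *
        β (fun b => v (σ (Fin.cast h (Fin.natAdd k b))))) = α v * β ![] := by
    intro σ
    have h1 : (fun b => v (σ (Fin.cast h (Fin.castAdd 0 b)))) = v ∘ σ := by
      funext b
      simp [Function.comp]
    have h2 : (fun a => v (σ (Fin.cast h (Fin.natAdd k a)))) = ![] := Subsingleton.elim _ _
    rw [h1, h2, AlternatingMap.map_perm, Units.smul_def, zsmul_eq_mul]
    have h3 : ((Equiv.Perm.sign σ : ℤ) : ℝ) * ((Equiv.Perm.sign σ : ℤ) : ℝ) = 1 := by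
      rw [← Int.cast_mul, Int.units_coe_mul_self, Int.cast_one]
    linear_combination (α v * β ![]) * h3
  simp only [this, Finset.sum_const, Finset.card_univ, Fintype.card_perm, Fintype.card_fin,
    Nat.factorial_zero, mul_one, nsmul_eq_mul]
  exact inv_mul_cancel_left₀ (by positivity) _

theorem alternatingMap_sum_apply {ι : Type} {k : ℕ} (s : Finset ι) (α : ι → V [⋀^Fin k]→ₗ[ℝ] ℝ)
    (v : Fin k → V) : (∑ j ∈ s, α j) v = ∑ j ∈ s, α j v := by
  classical
  induction s using Finset.induction_on with
  | empty => rfl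
  | insert j s hj ih => rw [Finset.sum_insert hj, Finset.sum_insert hj, ← ih]; rfl

theorem two_form_swap (β : V [⋀^Fin 2]→ₗ[ℝ] ℝ) (v w : V) : β ![w, v] = -β ![v, w] := by
  have := β.map_swap ![v, w] (show (0 : Fin 2) ≠ 1 by decide)
  rw [← this]
  congr 1
  funext a
  fin_cases a <;> rfl

theorem wedge_one_one (h : 1 + 1 = 2) (α β : V [⋀^Fin 1]→ₗ[ℝ] ℝ) (v : Fin 2 → V) :
    wedge h α β v = α ![v 0] * β ![v 1] - α ![v 1] * β ![v 0] := by
  rw [wedge_apply, show (Finset.univ : Finset (Equiv.Perm (Fin 2))) = {1, Equiv.swap 0 1} by decide,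
    Finset.sum_insert (by decide), Finset.sum_singleton]
  simp only [fin_one_eta (fun a : Fin 1 => v _)]
  simp
  ring

theorem sum_perm_fin_three (F : Equiv.Perm (Fin 3) → ℝ) :
    ∑ σ, F σ = F 1 + F (Equiv.swap 0 1) + F (Equiv.swap 0 2) + F (Equiv.swap 1 2) +
      F (Equiv.swap 0 1 * Equiv.swap 1 2) + F (Equiv.swap 1 2 * Equiv.swap 0 1) := by
  rw [show (Finset.univ : Finset (Equiv.Perm (Fin 3))) = {1, Equiv.swap 0 1, Equiv.swap 0 2,
    Equiv.swap 1 2, Equiv.swap 0 1 * Equiv.swap 1 2, Equiv.swap 1 2 * Equiv.swap 0 1} by decide,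
    Finset.sum_insert (by decide), Finset.sum_insert (by decide), Finset.sum_insert (by decide),
    Finset.sum_insert (by decide), Finset.sum_insert (by decide), Finset.sum_singleton]
  ring

theorem swap_fin_three :
    (Equiv.swap 0 1 : Equiv.Perm (Fin 3)) 2 = 2 ∧ (Equiv.swap 0 2 : Equiv.Perm (Fin 3)) 1 = 1 ∧
      (Equiv.swap 1 2 : Equiv.Perm (Fin 3)) 0 = 0 := by decide

theorem wedge_one_two (h : 1 + 2 = 3) (α : V [⋀^Fin 1]→ₗ[ℝ] ℝ) (β : V [⋀^Fin 2]→ₗ[ℝ] ℝ)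
    (v : Fin 3 → V) :
    wedge h α β v = α ![v 0] * β ![v 1, v 2] - α ![v 1] * β ![v 0, v 2]
      + α ![v 2] * β ![v 0, v 1] := by
  rw [wedge_apply, sum_perm_fin_three]
  simp only [fin_one_eta (fun a : Fin 1 => v _), fin_two_eta (fun a : Fin 2 => v _)]
  simp [swap_fin_three]
  rw [two_form_swap β (v 0) (v 2), two_form_swap β (v 0) (v 1), two_form_swap β (v 1) (v 2)]
  ring

theorem wedge_two_one (h : 2 + 1 = 3) (β : V [⋀^Fin 2]→ₗ[ℝ] ℝ) (α : V [⋀^Fin 1]→ₗ[ℝ] ℝ)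
    (v : Fin 3 → V) :
    wedge h β α v = α ![v 0] * β ![v 1, v 2] - α ![v 1] * β ![v 0, v 2]
      + α ![v 2] * β ![v 0, v 1] := by
  rw [wedge_apply, sum_perm_fin_three]
  simp only [fin_one_eta (fun a : Fin 1 => v _), fin_two_eta (fun a : Fin 2 => v _)]
  simp [swap_fin_three]
  rw [two_form_swap β (v 0) (v 2), two_form_swap β (v 0) (v 1), two_form_swap β (v 1) (v 2)]
  ring

variable (b : Module.Basis (Fin 3) ℝ V)

theorem zero_form_ext {α β : V [⋀^Fin 0]→ₗ[ℝ] ℝ} (h : α ![] = β ![]) : α = β := by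
  ext v
  rw [Subsingleton.elim v ![], h]

theorem one_form_ext {α β : V [⋀^Fin 1]→ₗ[ℝ] ℝ} (h : ∀ i, α ![b i] = β ![b i]) : α = β := by
  refine b.ext_alternating fun v _ => ?_
  rw [fin_one_eta fun i => b (v i), h]

/-- The index pairs are taken in cyclic order, for which the Hodge star of an oriented orthonormal
frame involves no signs. -/
theorem two_form_ext {α β : V [⋀^Fin 2]→ₗ[ℝ] ℝ} (h0 : α ![b 1, b 2] = β ![b 1, b 2])
    (h1 : α ![b 2, b 0] = β ![b 2, b 0]) (h2 : α ![b 0, b 1] = β ![b 0, b 1]) : α = β := by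
  refine b.ext_alternating fun v hv => ?_
  rw [fin_two_eta fun i => b (v i)]
  have hne : v 0 ≠ v 1 := fun h => absurd (hv h) (by decide)
  generalize v 0 = i at hne ⊢
  generalize v 1 = j at hne ⊢
  fin_cases i <;> fin_cases j <;> first
    | exact absurd rfl hne
    | assumption
    | (rw [two_form_swap, two_form_swap β]; exact congrArg _ (by assumption))

theorem three_form_ext {α β : V [⋀^Fin 3]→ₗ[ℝ] ℝ}
    (h : α ![b 0, b 1, b 2] = β ![b 0, b 1, b 2]) : α = β := by
  have h' : α b = β b := by rw [fin_three_eta b]; exact h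
  rw [α.eq_smul_basis_det b, β.eq_smul_basis_det b, h']

theorem form_eq_zero_of_three_lt (b : Module.Basis (Fin 3) ℝ V) {k : ℕ} (hk : 3 < k)
    (α : V [⋀^Fin k]→ₗ[ℝ] ℝ) : α = 0 := by
  refine b.ext_alternating fun v hv => ?_
  have := Fintype.card_le_of_injective v hv
  simp only [Fintype.card_fin] at this
  omega

end Fibre

section OrientedFibre

theorem flat_apply {V : Type} [NormedAddCommGroup V] [InnerProductSpace ℝ V] (v w : V) :
    flat v ![w] = inner ℝ v w := rfl

variable {V : Type} [NormedAddCommGroup V] [InnerProductSpace ℝ V]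
  [Fact (Module.finrank ℝ V = 3)] (o : Orientation ℝ V (Fin 3))

theorem volumeForm_eq : o.volumeForm = (frame o).toBasis.det :=
  o.volumeForm_robust _ (o.finOrthonormalBasis_orientation _ _)

theorem volumeForm_apply (v : Fin 3 → V) :
    o.volumeForm v = Matrix.det (Matrix.of fun i j => inner ℝ (frame o i) (v j)) := by
  rw [volumeForm_eq, Module.Basis.det_apply]
  congr 1
  ext i j
  simp [Module.Basis.toMatrix_apply, OrthonormalBasis.repr_apply_apply]

theorem inner_frame (i j : Fin 3) : inner ℝ (frame o i) (frame o j) = if i = j then (1 : ℝ) else 0 :=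
  (orthonormal_iff_ite.1 (frame o).orthonormal) i j

theorem volumeForm_frame (i j k : Fin 3) :
    o.volumeForm ![frame o i, frame o j, frame o k] =
      Matrix.det (Matrix.of fun l m => if l = (![i, j, k] : Fin 3 → Fin 3) m then (1 : ℝ) else 0) := by
  rw [volumeForm_apply]
  congr 1
  ext l m
  fin_cases m <;> simp only [Matrix.of_apply] <;> exact (inner_frame o _ _).trans (by congr)

theorem volumeForm_frame_one : o.volumeForm ![frame o 0, frame o 1, frame o 2] = 1 := by
  rw [volumeForm_frame, Matrix.det_fin_three]
  simp

theorem sum_fin_succ_fun {n : ℕ} (F : (Fin (n + 1) → Fin 3) → ℝ) :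
    ∑ I, F I = ∑ i, ∑ J : Fin n → Fin 3, F (Fin.cons i J) := by
  rw [← Fintype.sum_prod_type']
  exact (Fintype.sum_equiv (Fin.consEquiv fun _ => Fin 3) _ _ fun _ => rfl).symm

theorem hodge_zero_three (h : 0 + 3 = 3) (α : V [⋀^Fin 0]→ₗ[ℝ] ℝ) (v : Fin 3 → V) :
    hodge o h α v = α ![] * o.volumeForm v := by
  simp only [hodge, AlternatingMap.smul_apply, alternatingMap_sum_apply, smul_eq_mul]
  rw [Fintype.sum_unique, Nat.factorial_zero, Nat.cast_one, inv_one, one_mul]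
  exact congrArg₂ (· * ·) (congrArg α (Subsingleton.elim _ _)) rfl

theorem hodge_one_two (h : 1 + 2 = 3) (α : V [⋀^Fin 1]→ₗ[ℝ] ℝ) (v w : V) :
    hodge o h α ![v, w] = ∑ i, α ![frame o i] * o.volumeForm ![frame o i, v, w] := by
  simp only [hodge, AlternatingMap.smul_apply, alternatingMap_sum_apply, smul_eq_mul]
  rw [Nat.factorial_one, Nat.cast_one, inv_one, one_mul, sum_fin_succ_fun]
  refine Finset.sum_congr rfl fun i _ => ?_
  rw [Fintype.sum_unique, fin_one_eta (fun a : Fin 1 => frame o _)]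
  congr 1

theorem hodge_two_one (h : 2 + 1 = 3) (β : V [⋀^Fin 2]→ₗ[ℝ] ℝ) (v : V) :
    hodge o h β ![v] = 2⁻¹ * ∑ i, ∑ j, β ![frame o i, frame o j] *
      o.volumeForm ![frame o i, frame o j, v] := by
  simp only [hodge, AlternatingMap.smul_apply, alternatingMap_sum_apply, smul_eq_mul]
  rw [Nat.factorial_two, Nat.cast_two, sum_fin_succ_fun]
  congr 1
  refine Finset.sum_congr rfl fun i _ => ?_
  rw [sum_fin_succ_fun]
  refine Finset.sum_congr rfl fun j _ => ?_
  rw [Fintype.sum_unique, fin_two_eta (fun a : Fin 2 => frame o _)]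
  congr 1

theorem hodge_three_zero (h : 3 + 0 = 3) (γ : V [⋀^Fin 3]→ₗ[ℝ] ℝ) :
    hodge o h γ ![] = 6⁻¹ * ∑ i, ∑ j, ∑ k, γ ![frame o i, frame o j, frame o k] *
      o.volumeForm ![frame o i, frame o j, frame o k] := by
  simp only [hodge, AlternatingMap.smul_apply, alternatingMap_sum_apply, smul_eq_mul]
  rw [show ((3 ! : ℕ) : ℝ) = 6 by norm_num [Nat.factorial], sum_fin_succ_fun]
  congr 1
  refine Finset.sum_congr rfl fun i _ => ?_
  rw [sum_fin_succ_fun]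
  refine Finset.sum_congr rfl fun j _ => ?_
  rw [sum_fin_succ_fun]
  refine Finset.sum_congr rfl fun k _ => ?_
  rw [Fintype.sum_unique, fin_three_eta (fun a : Fin 3 => frame o _)]
  congr 1

/-! The Hodge star in a positively oriented orthonormal frame. -/

theorem hodge_zero_three_frame (h : 0 + 3 = 3) (α : V [⋀^Fin 0]→ₗ[ℝ] ℝ) :
    hodge o h α ![frame o 0, frame o 1, frame o 2] = α ![] := by
  rw [hodge_zero_three, volumeForm_frame_one, mul_one]

theorem hodge_one_two_frame (h : 1 + 2 = 3) (α : V [⋀^Fin 1]→ₗ[ℝ] ℝ) :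
    hodge o h α ![frame o 1, frame o 2] = α ![frame o 0] ∧
    hodge o h α ![frame o 2, frame o 0] = α ![frame o 1] ∧
    hodge o h α ![frame o 0, frame o 1] = α ![frame o 2] := by
  refine ⟨?_, ?_, ?_⟩ <;>
  · rw [hodge_one_two]
    simp only [volumeForm_frame, Matrix.det_fin_three, Fin.sum_univ_three]
    simp

theorem hodge_two_one_frame (h : 2 + 1 = 3) (β : V [⋀^Fin 2]→ₗ[ℝ] ℝ) :
    hodge o h β ![frame o 0] = β ![frame o 1, frame o 2] ∧
    hodge o h β ![frame o 1] = β ![frame o 2, frame o 0] ∧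
    hodge o h β ![frame o 2] = β ![frame o 0, frame o 1] := by
  refine ⟨?_, ?_, ?_⟩ <;>
  · rw [hodge_two_one]
    simp only [volumeForm_frame, Matrix.det_fin_three, Fin.sum_univ_three]
    simp
    first
    | (rw [two_form_swap β (frame o 1) (frame o 2)]; ring)
    | (rw [two_form_swap β (frame o 2) (frame o 0)]; ring)
    | (rw [two_form_swap β (frame o 0) (frame o 1)]; ring)

theorem three_form_perm (γ : V [⋀^Fin 3]→ₗ[ℝ] ℝ) (i j k : Fin 3) :
    γ ![frame o i, frame o j, frame o k] = γ ![frame o 0, frame o 1, frame o 2] *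
      o.volumeForm ![frame o i, frame o j, frame o k] := by
  have h : γ = γ ![frame o 0, frame o 1, frame o 2] • o.volumeForm := by
    refine three_form_ext (frame o).toBasis ?_
    simp [volumeForm_frame_one]
  exact congrArg (fun γ' : V [⋀^Fin 3]→ₗ[ℝ] ℝ => γ' ![frame o i, frame o j, frame o k]) h

theorem sum_volumeForm_sq :
    ∑ i, ∑ j, ∑ k, o.volumeForm ![frame o i, frame o j, frame o k] ^ 2 = 6 := by
  simp only [volumeForm_frame, Matrix.det_fin_three, Fin.sum_univ_three]
  simp
  norm_num

/-- A three-form is a multiple of the volume form, so each term is γ(e₀, e₁, e₂) times a squared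
volume. The squares add up to 6, one for each permutation, cancelling the factor 1/3!. -/
theorem hodge_three_zero_frame (h : 3 + 0 = 3) (γ : V [⋀^Fin 3]→ₗ[ℝ] ℝ) :
    hodge o h γ ![] = γ ![frame o 0, frame o 1, frame o 2] := by
  have h1 : ∀ i j k, γ ![frame o i, frame o j, frame o k] *
      o.volumeForm ![frame o i, frame o j, frame o k] = γ ![frame o 0, frame o 1, frame o 2] *
      o.volumeForm ![frame o i, frame o j, frame o k] ^ 2 := by
    intro i j k
    rw [three_form_perm o γ i j k]
    ring
  rw [hodge_three_zero]
  simp only [h1, ← Finset.mul_sum, sum_volumeForm_sq]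
  ring

/-- In dimension three the sign (−1)^{k(3−k)} is always +1, so here and in the next three degrees
the star is an involution. -/
theorem hodge_hodge_zero (h : 0 + 3 = 3) (h' : 3 + 0 = 3) (α : V [⋀^Fin 0]→ₗ[ℝ] ℝ) :
    hodge o h' (hodge o h α) = α :=
  zero_form_ext (by rw [hodge_three_zero_frame, hodge_zero_three_frame])

theorem hodge_hodge_one (h : 1 + 2 = 3) (h' : 2 + 1 = 3) (α : V [⋀^Fin 1]→ₗ[ℝ] ℝ) :
    hodge o h' (hodge o h α) = α := by
  obtain ⟨h0, h1, h2⟩ := hodge_one_two_frame o h α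
  obtain ⟨k0, k1, k2⟩ := hodge_two_one_frame o h' (hodge o h α)
  refine one_form_ext (frame o).toBasis fun i => ?_
  rw [OrthonormalBasis.coe_toBasis]
  fin_cases i
  · exact k0.trans h0
  · exact k1.trans h1
  · exact k2.trans h2

theorem hodge_hodge_two (h : 2 + 1 = 3) (h' : 1 + 2 = 3) (β : V [⋀^Fin 2]→ₗ[ℝ] ℝ) :
    hodge o h' (hodge o h β) = β := by
  obtain ⟨h0, h1, h2⟩ := hodge_one_two_frame o h' (hodge o h β)
  obtain ⟨k0, k1, k2⟩ := hodge_two_one_frame o h β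
  refine two_form_ext (frame o).toBasis ?_ ?_ ?_ <;> rw [OrthonormalBasis.coe_toBasis]
  · exact h0.trans k0
  · exact h1.trans k1
  · exact h2.trans k2

theorem hodge_hodge_three (h : 3 + 0 = 3) (h' : 0 + 3 = 3) (γ : V [⋀^Fin 3]→ₗ[ℝ] ℝ) :
    hodge o h' (hodge o h γ) = γ := by
  refine three_form_ext (frame o).toBasis ?_
  rw [OrthonormalBasis.coe_toBasis, hodge_zero_three_frame, hodge_three_zero_frame]

/-- The Hodge star as a linear map. -/
def hodgeLin {k j : ℕ} (h : k + j = 3) : V [⋀^Fin k]→ₗ[ℝ] ℝ →ₗ[ℝ] V [⋀^Fin j]→ₗ[ℝ] ℝ where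
  toFun := hodge o h
  map_add' α β := by
    simp only [hodge, AlternatingMap.add_apply, add_smul, Finset.sum_add_distrib, smul_add]
  map_smul' c α := by
    rw [RingHom.id_apply, hodge, hodge, smul_comm c, Finset.smul_sum (r := c)]
    simp only [AlternatingMap.smul_apply, smul_eq_mul, mul_smul]

theorem flat_sharp (α : V [⋀^Fin 1]→ₗ[ℝ] ℝ) : flat (sharp o α) = α := by
  refine one_form_ext (frame o).toBasis fun i => ?_
  rw [OrthonormalBasis.coe_toBasis, flat_apply, sharp, sum_inner]
  simp only [inner_smul_left, inner_frame]
  simp [fin_one_eta fun _ : Fin 1 => frame o i]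

theorem flat_cross (v w : V) : flat (cross o v w) =
    hodge o (rfl : 2 + 1 = 3) (wedge (rfl : 1 + 1 = 2) (flat v) (flat w)) :=
  flat_sharp o _

theorem inner_eq_sum_frame (v w : V) :
    inner ℝ v w = ∑ i, inner ℝ v (frame o i) * inner ℝ w (frame o i) := by
  rw [← (frame o).sum_inner_mul_inner v w]
  simp only [real_inner_comm]

end OrientedFibre

end FluidHPT

namespace FluidHPT

/-! ### Coordinates -/

theorem two_le_infty : minSmoothness ℝ 2 ≤ ∞ := by
  rw [minSmoothness_of_isRCLikeNormedField]
  exact WithTop.coe_le_coe.2 (le_top : (2 : ℕ∞) ≤ ⊤)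

/-- An alternating form on the model space is determined by its values on basis vectors. -/
def evalBasis (k : ℕ) : (E3 [⋀^Fin k]→L[ℝ] ℝ) →ₗ[ℝ] ((Fin k → Fin 3) → ℝ) where
  toFun α r := α fun a => EuclideanSpace.basisFun (Fin 3) ℝ (r a)
  map_add' _ _ := rfl
  map_smul' _ _ := rfl

theorem evalBasis_injective (k : ℕ) : Function.Injective (evalBasis k) := by
  intro α β h
  apply ContinuousAlternatingMap.toAlternatingMap_injective
  refine (EuclideanSpace.basisFun (Fin 3) ℝ).toBasis.ext_alternating fun v _ => ?_
  rw [OrthonormalBasis.coe_toBasis]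
  exact congrFun h v

instance finiteDimensional_forms (k : ℕ) : FiniteDimensional ℝ (E3 [⋀^Fin k]→L[ℝ] ℝ) :=
  FiniteDimensional.of_injective (evalBasis k) (evalBasis_injective k)

/-- A continuous linear way back from coefficients to forms: it lets smoothness and
differentiability of form-valued maps be tested coefficient by coefficient. -/
theorem exists_reconstruct (k : ℕ) :
    ∃ R : ((Fin k → Fin 3) → ℝ) →L[ℝ] (E3 [⋀^Fin k]→L[ℝ] ℝ), ∀ α, R (evalBasis k α) = α := by
  obtain ⟨R, hR⟩ := (evalBasis k).exists_leftInverse_of_injective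
    (LinearMap.ker_eq_bot.2 (evalBasis_injective k))
  exact ⟨LinearMap.toContinuousLinearMap R, fun α => LinearMap.congr_fun hR α⟩

/-- Evaluation of alternating forms on fixed vectors. -/
def evalAt {k : ℕ} (v : Fin k → E3) : (E3 [⋀^Fin k]→L[ℝ] ℝ) →L[ℝ] ℝ :=
  LinearMap.toContinuousLinearMap
    { toFun := fun α => α v
      map_add' := fun _ _ => rfl
      map_smul' := fun _ _ => rfl }

theorem evalAt_apply {k : ℕ} (v : Fin k → E3) (α : E3 [⋀^Fin k]→L[ℝ] ℝ) : evalAt v α = α v := rfl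

theorem contDiffOn_form_iff {E : Type} [NormedAddCommGroup E] [NormedSpace ℝ E] {k : ℕ}
    {f : E → E3 [⋀^Fin k]→L[ℝ] ℝ} {U : Set E} :
    ContDiffOn ℝ ∞ f U ↔ ∀ r : Fin k → Fin 3,
      ContDiffOn ℝ ∞ (fun y => f y fun a => EuclideanSpace.basisFun (Fin 3) ℝ (r a)) U := by
  constructor
  · intro h r
    exact (evalAt fun a => EuclideanSpace.basisFun (Fin 3) ℝ (r a)).contDiff.comp_contDiffOn h
  · intro h
    obtain ⟨R, hR⟩ := exists_reconstruct k
    have h1 := R.contDiff.comp_contDiffOn (contDiffOn_pi.2 h)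
    refine h1.congr fun y _ => (hR (f y)).symm

section Coordinates

variable {M : Type*} [TopologicalSpace M] [ChartedSpace E3 M] [IsManifold (𝓡 3) ∞ M]

theorem mem_baseSet_iff {x₀ x : M} :
    x ∈ (trivializationAt E3 (TangentSpace (𝓡 3)) x₀).baseSet ↔ x ∈ (extChartAt (𝓡 3) x₀).source := by
  rw [extChartAt_source]
  rfl

theorem symm_mem_baseSet {x₀ : M} {y : E3} (hy : y ∈ (extChartAt (𝓡 3) x₀).target) :
    (extChartAt (𝓡 3) x₀).symm y ∈ (trivializationAt E3 (TangentSpace (𝓡 3)) x₀).baseSet :=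
  mem_baseSet_iff.2 ((extChartAt (𝓡 3) x₀).map_target hy)

/-- The coordinate vector fields of the chart at `x₀`. -/
def coordVec (x₀ x : M) (a : Fin 3) : TangentSpace (𝓡 3) x :=
  (trivializationAt E3 (TangentSpace (𝓡 3)) x₀).symmL ℝ x (EuclideanSpace.basisFun (Fin 3) ℝ a)

/-- The coordinate vectors of the chart at `x₀` form a basis. -/
def coordBasis (x₀ x : M) (hx : x ∈ (trivializationAt E3 (TangentSpace (𝓡 3)) x₀).baseSet) :
    Module.Basis (Fin 3) ℝ (TangentSpace (𝓡 3) x) :=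
  (EuclideanSpace.basisFun (Fin 3) ℝ).toBasis.map
    ((trivializationAt E3 (TangentSpace (𝓡 3)) x₀).continuousLinearEquivAt ℝ x hx).symm.toLinearEquiv

theorem coordBasis_apply (x₀ x : M)
    (hx : x ∈ (trivializationAt E3 (TangentSpace (𝓡 3)) x₀).baseSet) (a : Fin 3) :
    coordBasis x₀ x hx a = coordVec x₀ x a := by
  rw [coordBasis, Module.Basis.map_apply, OrthonormalBasis.coe_toBasis]
  exact congrFun (Bundle.Trivialization.symm_continuousLinearEquivAt_eq
    (trivializationAt E3 (TangentSpace (𝓡 3)) x₀) hx) _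

theorem coordBasis_coe (x₀ x : M)
    (hx : x ∈ (trivializationAt E3 (TangentSpace (𝓡 3)) x₀).baseSet) :
    ⇑(coordBasis x₀ x hx) = coordVec x₀ x := funext fun a => coordBasis_apply x₀ x hx a

theorem symmL_eq_sum (x₀ x : M) (v : E3) :
    (trivializationAt E3 (TangentSpace (𝓡 3)) x₀).symmL ℝ x v = ∑ a, v a • coordVec x₀ x a := by
  conv_lhs => rw [← (EuclideanSpace.basisFun (Fin 3) ℝ).sum_repr v]
  rw [map_sum]
  simp only [map_smul]
  rfl

theorem eq_sum_coordVec (x₀ x : M)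
    (hx : x ∈ (trivializationAt E3 (TangentSpace (𝓡 3)) x₀).baseSet) (v : TangentSpace (𝓡 3) x) :
    v = ∑ a, ((trivializationAt E3 (TangentSpace (𝓡 3)) x₀).continuousLinearMapAt ℝ x v) a •
      coordVec x₀ x a := by
  rw [← symmL_eq_sum, Bundle.Trivialization.symmL_continuousLinearMapAt _ hx]

theorem toModel_apply {k : ℕ} (x₀ x : M) (α : TangentSpace (𝓡 3) x [⋀^Fin k]→ₗ[ℝ] ℝ)
    (v : Fin k → E3) : toModel x₀ x α v =
      α fun a => (trivializationAt E3 (TangentSpace (𝓡 3)) x₀).symmL ℝ x (v a) := rfl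

theorem ofModel_apply {k : ℕ} (x₀ x : M) (α : E3 [⋀^Fin k]→L[ℝ] ℝ)
    (v : Fin k → TangentSpace (𝓡 3) x) : ofModel x₀ x α v =
      α fun a => (trivializationAt E3 (TangentSpace (𝓡 3)) x₀).continuousLinearMapAt ℝ x (v a) := rfl

theorem clm_symmL {x₀ x₁ x : M}
    (h₀ : x ∈ (trivializationAt E3 (TangentSpace (𝓡 3)) x₀).baseSet)
    (h₁ : x ∈ (trivializationAt E3 (TangentSpace (𝓡 3)) x₁).baseSet) (v : E3) :
    (trivializationAt E3 (TangentSpace (𝓡 3)) x₁).continuousLinearMapAt ℝ x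
      ((trivializationAt E3 (TangentSpace (𝓡 3)) x₀).symmL ℝ x v) =
      tangentCoordChange (𝓡 3) x₀ x₁ x v := by
  rw [TangentBundle.continuousLinearMapAt_trivializationAt_eq_core h₁,
    TangentBundle.symmL_trivializationAt_eq_core h₀]
  have := tangentCoordChange_comp (I := 𝓡 3) (w := x₀) (x := x) (y := x₁) (z := x) (v := v)
    ⟨⟨mem_baseSet_iff.1 h₀, mem_extChartAt_source x⟩, mem_baseSet_iff.1 h₁⟩
  exact this

/-- The transition map between two charts. -/
def transition (x₀ x₁ : M) (y : E3) : E3 := extChartAt (𝓡 3) x₁ ((extChartAt (𝓡 3) x₀).symm y)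

theorem transition_nhds {M : Type*} [TopologicalSpace M] [ChartedSpace E3 M] {x₀ x₁ : M}
    {y : E3} (hy : y ∈ (extChartAt (𝓡 3) x₀).target)
    (h₁ : (extChartAt (𝓡 3) x₀).symm y ∈ (extChartAt (𝓡 3) x₁).source) :
    ∀ᶠ y' in 𝓝 y, y' ∈ (extChartAt (𝓡 3) x₀).target ∧
      (extChartAt (𝓡 3) x₀).symm y' ∈ (extChartAt (𝓡 3) x₁).source := by
  have ho := (isOpen_extChartAt_target (I := 𝓡 3) x₀).mem_nhds hy
  refine Filter.Eventually.and ho ?_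
  exact (continuousAt_extChartAt_symm'' hy).preimage_mem_nhds
    ((isOpen_extChartAt_source (I := 𝓡 3) x₁).mem_nhds h₁)

theorem contDiffAt_transition {x₀ x₁ : M} {y : E3} (hy : y ∈ (extChartAt (𝓡 3) x₀).target)
    (h₁ : (extChartAt (𝓡 3) x₀).symm y ∈ (extChartAt (𝓡 3) x₁).source) :
    ContDiffAt ℝ ∞ (transition x₀ x₁) y := by
  have h := contDiffWithinAt_ext_coord_change (𝕜 := ℝ) (I := 𝓡 3) (n := ∞) x₁ x₀ (y := y)
    ⟨hy, h₁⟩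
  rw [modelWithCornersSelf_coe, Set.range_id] at h
  exact h.contDiffAt Filter.univ_mem

theorem fderiv_transition {x₀ x₁ : M} {y : E3} (hy : y ∈ (extChartAt (𝓡 3) x₀).target)
    (h₁ : (extChartAt (𝓡 3) x₀).symm y ∈ (extChartAt (𝓡 3) x₁).source) :
    fderiv ℝ (transition x₀ x₁) y =
      tangentCoordChange (𝓡 3) x₀ x₁ ((extChartAt (𝓡 3) x₀).symm y) := by
  have h := hasFDerivWithinAt_tangentCoordChange (I := 𝓡 3) (x := x₀) (y := x₁)
    (z := (extChartAt (𝓡 3) x₀).symm y) ⟨(extChartAt (𝓡 3) x₀).map_target hy, h₁⟩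
  rw [modelWithCornersSelf_coe, Set.range_id, hasFDerivWithinAt_univ,
    (extChartAt (𝓡 3) x₀).right_inv hy] at h
  exact h.fderiv

/-- Smoothness of a form. -/
def SmoothForm' {k : ℕ} (w : Form M k) : Prop :=
  ∀ x₀ : M, ContDiffOn ℝ ∞ (chartRep w x₀) (extChartAt (𝓡 3) x₀).target

theorem SmoothForm'.contDiffAt {k : ℕ} {w : Form M k} (hw : SmoothForm' w) {x₀ : M} {y : E3}
    (hy : y ∈ (extChartAt (𝓡 3) x₀).target) : ContDiffAt ℝ ∞ (chartRep w x₀) y :=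
  (hw x₀).contDiffAt ((isOpen_extChartAt_target (I := 𝓡 3) x₀).mem_nhds hy)

/-- The exterior derivative can be computed in any chart. -/
theorem chartRep_d {k : ℕ} {w : Form M k} (hw : SmoothForm' w) {x₀ : M} {y : E3}
    (hy : y ∈ (extChartAt (𝓡 3) x₀).target) :
    chartRep (d w) x₀ y = extDeriv (chartRep w x₀) y := by
  set x := (extChartAt (𝓡 3) x₀).symm y with hx
  have h₁ : x ∈ (extChartAt (𝓡 3) x).source := mem_extChartAt_source x
  have h₀ : x ∈ (extChartAt (𝓡 3) x₀).source := (extChartAt (𝓡 3) x₀).map_target hy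
  -- Near y the expressions of the form in the two charts are related by pullback along the
  -- transition map. An identity near y, not only at y, is needed in order to differentiate it.
  have hev : chartRep w x₀ =ᶠ[𝓝 y] fun y' => (chartRep w x (transition x₀ x y')).compContinuousLinearMap
      (fderiv ℝ (transition x₀ x) y') := by
    filter_upwards [transition_nhds hy h₁] with y' hy'
    ext v
    rw [fderiv_transition hy'.1 hy'.2]
    have hz : (extChartAt (𝓡 3) x).symm (transition x₀ x y') = (extChartAt (𝓡 3) x₀).symm y' :=
      (extChartAt (𝓡 3) x).left_inv hy'.2
    simp only [ContinuousAlternatingMap.compContinuousLinearMap_apply, chartRep, toModel_apply]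
    rw [hz]
    congr 1
    funext a
    have h := clm_symmL (symm_mem_baseSet hy'.1) (mem_baseSet_iff.2 hy'.2) (v a)
    simp only [Function.comp_apply]
    rw [← h, Bundle.Trivialization.symmL_continuousLinearMapAt _ (mem_baseSet_iff.2 hy'.2)]
  rw [hev.extDeriv_eq]
  have htx : transition x₀ x y = extChartAt (𝓡 3) x x := rfl
  -- Naturality of the exterior derivative under pullback; it rests on symmetry of the second
  -- derivative of the transition map.
  rw [extDeriv_pullback (r := ∞) ?_ (contDiffAt_transition hy h₁) ?_]
  · ext v
    rw [fderiv_transition hy h₁, htx]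
    simp only [ContinuousAlternatingMap.compContinuousLinearMap_apply, chartRep, toModel_apply, d,
      ofModel_apply]
    congr 1
    funext a
    exact clm_symmL (symm_mem_baseSet hy) (mem_baseSet_iff.2 h₁) (v a)
  · rw [htx]
    exact (hw.contDiffAt (mem_extChartAt_target x)).differentiableAt (by simp)
  · exact two_le_infty

theorem SmoothForm'.d {k : ℕ} {w : Form M k} (hw : SmoothForm' w) : SmoothForm' (d w) := by
  intro x₀
  have ho := isOpen_extChartAt_target (I := 𝓡 3) x₀
  refine ContDiffOn.congr ?_ fun y hy => chartRep_d hw hy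
  have h1 : ContDiffOn ℝ ∞ (fderiv ℝ (chartRep w x₀)) (extChartAt (𝓡 3) x₀).target :=
    (hw x₀).fderiv_of_isOpen ho (by simp)
  exact (ContinuousAlternatingMap.alternatizeUncurryFinCLM ℝ E3 ℝ).contDiff.comp_contDiffOn h1

theorem form_eq_of_chartRep {k : ℕ} {w w' : Form M k} {x : M}
    (h : chartRep w x (extChartAt (𝓡 3) x x) = chartRep w' x (extChartAt (𝓡 3) x x)) : w x = w' x := by
  have hx := mem_extChartAt_source (I := 𝓡 3) x
  unfold chartRep at h
  rw [extChartAt_to_inv] at h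
  ext v
  have := congrArg (fun α => α fun a =>
    (trivializationAt E3 (TangentSpace (𝓡 3)) x).continuousLinearMapAt ℝ x (v a)) h
  simp only [toModel_apply, Bundle.Trivialization.symmL_continuousLinearMapAt _ (mem_baseSet_iff.2 hx)]
    at this
  exact this

/-- The form `d w` is defined with a different chart at every point. By chart independence it is
represented near x by the exterior derivative of one single expression, so the identity on the model
space applies. -/
theorem d_d {k : ℕ} {w : Form M k} (hw : SmoothForm' w) : d (d w) = 0 := by
  funext x
  apply form_eq_of_chartRep
  have hy := mem_extChartAt_target (I := 𝓡 3) x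
  have hev : chartRep (d w) x =ᶠ[𝓝 (extChartAt (𝓡 3) x x)] extDeriv (chartRep w x) := by
    filter_upwards [(isOpen_extChartAt_target (I := 𝓡 3) x).mem_nhds hy] with y hy
    exact chartRep_d hw hy
  rw [chartRep_d hw.d hy, hev.extDeriv_eq, extDeriv_extDeriv_apply (hw.contDiffAt hy)]
  · ext v
    rfl
  · exact two_le_infty

/-- The coefficients of a form in the chart at `x₀`. -/
def coef {k : ℕ} (w : Form M k) (x₀ : M) (r : Fin k → Fin 3) (y : E3) : ℝ :=
  chartRep w x₀ y fun a => EuclideanSpace.basisFun (Fin 3) ℝ (r a)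

theorem coef_eq {k : ℕ} (w : Form M k) (x₀ : M) (r : Fin k → Fin 3) (y : E3) :
    coef w x₀ r y = w ((extChartAt (𝓡 3) x₀).symm y)
      fun a => coordVec x₀ ((extChartAt (𝓡 3) x₀).symm y) (r a) := rfl

theorem form_ext_coef {k : ℕ} {w w' : Form M k} {x : M}
    (h : ∀ r, coef w x r (extChartAt (𝓡 3) x x) = coef w' x r (extChartAt (𝓡 3) x x)) :
    w x = w' x :=
  form_eq_of_chartRep (evalBasis_injective k (funext h))

theorem smoothForm'_iff {k : ℕ} {w : Form M k} : SmoothForm' w ↔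
    ∀ x₀ r, ContDiffOn ℝ ∞ (coef w x₀ r) (extChartAt (𝓡 3) x₀).target :=
  forall_congr' fun _ => contDiffOn_form_iff

theorem coef_d {k : ℕ} {w : Form M k} (hw : SmoothForm' w) {x₀ : M} {y : E3}
    (hy : y ∈ (extChartAt (𝓡 3) x₀).target) (r : Fin (k + 1) → Fin 3) :
    coef (d w) x₀ r y = ∑ j : Fin (k + 1), (-1 : ℝ) ^ (j : ℕ) *
      fderiv ℝ (coef w x₀ fun a => r (j.succAbove a)) y (EuclideanSpace.basisFun (Fin 3) ℝ (r j)) := by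
  rw [coef, chartRep_d hw hy, extDeriv_apply ((hw.contDiffAt hy).differentiableAt (by simp))]
  refine Finset.sum_congr rfl fun j _ => ?_
  rw [zsmul_eq_mul]
  push_cast
  rfl

end Coordinates
end FluidHPT

namespace FluidHPT
namespace TimeModel

/-! ### Smooth time-dependent functions on an open set of the model space -/

/-! ### Partial derivatives in time and space on `J × U` -/

section Interval

variable {J : Set ℝ} {U : Set E3} {F : ℝ × E3 → ℝ}

theorem uniqueDiffOn_prod (hJ : J.OrdConnected ∧ J.Nontrivial) (hU : IsOpen U) :
    UniqueDiffOn ℝ (J ×ˢ U) :=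
  (uniqueDiffOn_of_nontrivial hJ).prod hU.uniqueDiffOn

theorem hasDerivWithinAt_fst (hF : DifferentiableOn ℝ F (J ×ˢ U)) {s : ℝ} {y : E3} (hs : s ∈ J)
    (hy : y ∈ U) :
    HasDerivWithinAt (fun s => F (s, y)) (fderivWithin ℝ F (J ×ˢ U) (s, y) (1, 0)) J s := by
  have h := (hF (s, y) ⟨hs, hy⟩).hasFDerivWithinAt
  have h2 : HasDerivWithinAt (fun s : ℝ => (s, y)) ((1 : ℝ), (0 : E3)) J s :=
    (hasDerivWithinAt_id s J).prodMk (hasDerivWithinAt_const s J y)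
  exact HasFDerivWithinAt.comp_hasDerivWithinAt s h h2 fun s' hs' => ⟨hs', hy⟩

theorem hasFDerivAt_snd (hU : IsOpen U) (hF : DifferentiableOn ℝ F (J ×ˢ U)) {s : ℝ} {y : E3}
    (hs : s ∈ J) (hy : y ∈ U) :
    HasFDerivAt (fun y => F (s, y))
      ((fderivWithin ℝ F (J ×ˢ U) (s, y)).comp (ContinuousLinearMap.inr ℝ ℝ E3)) y := by
  have h := (hF (s, y) ⟨hs, hy⟩).hasFDerivWithinAt
  have h2 : HasFDerivWithinAt (fun y : E3 => (s, y)) (ContinuousLinearMap.inr ℝ ℝ E3) U y :=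
    (hasFDerivAt_prodMk_right s y).hasFDerivWithinAt
  have h3 := h.comp y h2 fun y' hy' => ⟨hs, hy'⟩
  exact h3.hasFDerivAt (hU.mem_nhds hy)

theorem contDiffOn_fderivWithin_apply (hJ : J.OrdConnected ∧ J.Nontrivial) (hU : IsOpen U)
    (hF : ContDiffOn ℝ ∞ F (J ×ˢ U)) (v : ℝ × E3) :
    ContDiffOn ℝ ∞ (fun p => fderivWithin ℝ F (J ×ˢ U) p v) (J ×ˢ U) :=
  (hF.fderivWithin (uniqueDiffOn_prod hJ hU) (by simp)).clm_apply contDiffOn_const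

/-- Second derivatives within a set are symmetric at points in the closure of its interior. Since
`J` is a nondegenerate interval, this covers all of `J × U`, endpoints of `J` included. -/
theorem fderivWithin_comm (hJ : J.OrdConnected ∧ J.Nontrivial) (hU : IsOpen U)
    (hF : ContDiffOn ℝ ∞ F (J ×ˢ U)) {p : ℝ × E3} (hp : p ∈ J ×ˢ U) (v w : ℝ × E3) :
    fderivWithin ℝ (fun q => fderivWithin ℝ F (J ×ˢ U) q v) (J ×ˢ U) p w =
      fderivWithin ℝ (fun q => fderivWithin ℝ F (J ×ˢ U) q w) (J ×ˢ U) p v := by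
  have hu := uniqueDiffOn_prod hJ hU
  have hd : DifferentiableWithinAt ℝ (fderivWithin ℝ F (J ×ˢ U)) (J ×ˢ U) p :=
    (hF.fderivWithin (m := ∞) hu (by simp)).differentiableOn (by simp) p hp
  have key : ∀ v : ℝ × E3, fderivWithin ℝ (fun q => fderivWithin ℝ F (J ×ˢ U) q v) (J ×ˢ U) p =
      (fderivWithin ℝ (fderivWithin ℝ F (J ×ˢ U)) (J ×ˢ U) p).flip v := by
    intro v
    have h := hd.hasFDerivWithinAt.clm_apply (u := fun _ => v) (u' := 0)
      (hasFDerivWithinAt_const v p (J ×ˢ U))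
    refine (h.fderivWithin (hu p hp)).trans ?_
    rw [ContinuousLinearMap.comp_zero, zero_add]
  have hcl : p ∈ closure (interior (J ×ˢ U)) := by
    rw [interior_prod_eq, closure_prod_eq, hU.interior_eq]
    refine ⟨?_, subset_closure hp.2⟩
    have := (hJ.1.convex (𝕜 := ℝ)).closure_interior_eq_closure_of_nonempty_interior
      (nonempty_interior_of_nontrivial hJ)
    rw [this]
    exact subset_closure hp.1
  have hsym := (hF p hp).isSymmSndFDerivWithinAt two_le_infty hu hcl hp
  rw [key, key]
  exact hsym _ _

end Interval

variable {T : TimeModel} {U : Set E3}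

/-- Smoothness on `U` of a time-dependent function. -/
def TSmooth (W : E3 → T.Scalar) (U : Set E3) : Prop := T.SmoothOn (fun i y => (W y).val i) U

/-- The partial derivative in the direction `v`. -/
def pd (v : E3) (W : E3 → T.Scalar) (y : E3) : T.Scalar :=
  ⟨fun i => fderiv ℝ (fun y' => (W y').val i) y v⟩

/-- A function of time and space, extended by zero. -/
def spaceTime {J : Set ℝ} (W : E3 → (interval J).Scalar) (q : ℝ × E3) : ℝ :=
  extendZero J (W q.2).val q.1

theorem spaceTime_of_mem {J : Set ℝ} (W : E3 → (interval J).Scalar) {q : ℝ × E3} (h : q.1 ∈ J) :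
    spaceTime W q = (W q.2).val (⟨q.1, h⟩ : J) := extendZero_of_mem (J := J) _ h

theorem tsmooth_interval_iff {J : Set ℝ} {W : E3 → (interval J).Scalar} :
    TSmooth W U ↔ ContDiffOn ℝ ∞ (spaceTime W) (J ×ˢ U) := Iff.rfl

theorem tsmooth_congr {W W' : E3 → T.Scalar} (h : TSmooth W U) (he : ∀ y ∈ U, W' y = W y) :
    TSmooth W' U := by
  cases T with
  | point => exact ContDiffOn.congr h fun y hy => congrArg (fun a => a.val ()) (he y hy)
  | formal => exact fun n => (h n).congr fun y hy => congrArg (fun a => a.val n) (he y hy)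
  | interval J =>
    exact ContDiffOn.congr h fun q hq => congrArg (fun a => extendZero J a.val q.1) (he q.2 hq.2)

theorem TSmooth.slice {W : E3 → T.Scalar} (h : TSmooth W U) (i : T.Idx) :
    ContDiffOn ℝ ∞ (fun y => (W y).val i) U := by
  cases T with
  | point => exact h
  | formal => exact h i
  | interval J =>
    have h' (t : J) : ContDiffOn ℝ ∞ (fun y => (W y).val t) U := by
      have h1 : ContDiffOn ℝ ∞ (fun y : E3 => ((t : ℝ), y)) U :=
        contDiffOn_const.prodMk contDiffOn_id
      refine (ContDiffOn.comp h h1 fun y hy => ⟨t.2, hy⟩).congr fun y _ => ?_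
      exact (extendZero_coe (W y).val t).symm
    exact h' i

theorem TSmooth.diff {W : E3 → T.Scalar} (h : TSmooth W U) {y : E3} (hy : y ∈ U) :
    T.Diff (W y).val := by
  cases T with
  | point => trivial
  | formal => trivial
  | interval J =>
    have h1 : ContDiffOn ℝ ∞ (fun s : ℝ => (s, y)) J := contDiffOn_id.prodMk contDiffOn_const
    exact (ContDiffOn.comp h h1 fun s hs => ⟨hs, hy⟩).differentiableOn (by simp)

theorem TSmooth.add {W W' : E3 → T.Scalar} (h : TSmooth W U) (h' : TSmooth W' U) :
    TSmooth (fun y => W y + W' y) U := by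
  cases T with
  | point => exact ContDiffOn.add h h'
  | formal => exact fun n => (h n).add (h' n)
  | interval J =>
    exact (ContDiffOn.add h h').congr fun q _ =>
      congrFun (extendZero_add (J := J) (W q.2).val (W' q.2).val) q.1

theorem TSmooth.smulFun {g : E3 → ℝ} {W : E3 → T.Scalar} (hg : ContDiffOn ℝ ∞ g U)
    (h : TSmooth W U) : TSmooth (fun y => g y • W y) U := by
  cases T with
  | point => exact hg.mul h
  | formal => exact fun n => hg.mul (h n)
  | interval J =>
    have hg' : ContDiffOn ℝ ∞ (fun q : ℝ × E3 => g q.2) (J ×ˢ U) :=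
      hg.comp contDiffOn_snd fun q hq => hq.2
    exact (hg'.mul h).congr fun q _ =>
      congrFun (extendZero_map J (fun a : ℝ => g q.2 * a) (mul_zero _) (W q.2).val) q.1

theorem TSmooth.const_smul (c : ℝ) {W : E3 → T.Scalar} (h : TSmooth W U) :
    TSmooth (fun y => c • W y) U := TSmooth.smulFun contDiffOn_const h

theorem TSmooth.neg {W : E3 → T.Scalar} (h : TSmooth W U) : TSmooth (fun y => -W y) U :=
  tsmooth_congr (h.const_smul (-1)) fun y _ => (neg_one_smul ℝ (W y)).symm

theorem TSmooth.sub {W W' : E3 → T.Scalar} (h : TSmooth W U) (h' : TSmooth W' U) :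
    TSmooth (fun y => W y - W' y) U :=
  tsmooth_congr (h.add h'.neg) fun _ _ => sub_eq_add_neg _ _

theorem tsmooth_zero : TSmooth (fun _ => (0 : T.Scalar)) U := by
  cases T with
  | point => exact contDiffOn_const
  | formal => exact fun n => contDiffOn_const
  | interval J =>
    exact (contDiffOn_const (c := (0 : ℝ))).congr fun q _ =>
      congrFun (extendZero_zero (J := J) (A := ℝ)) q.1

theorem TSmooth.sum {ι : Type} (s : Finset ι) {W : ι → E3 → T.Scalar}
    (h : ∀ j ∈ s, TSmooth (W j) U) : TSmooth (fun y => ∑ j ∈ s, W j y) U := by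
  classical
  induction s using Finset.induction_on with
  | empty => exact tsmooth_zero
  | insert j s hj ih =>
    simp only [Finset.sum_insert hj]
    exact (h j (Finset.mem_insert_self _ _)).add
      (ih fun l hl => h l (Finset.mem_insert_of_mem hl))

theorem TSmooth.mul {W W' : E3 → T.Scalar} (h : TSmooth W U) (h' : TSmooth W' U) :
    TSmooth (fun y => W y * W' y) U := by
  cases T with
  | point => exact ContDiffOn.mul h h'
  | formal =>
    have key (n : ℕ) := ContDiffOn.sum (s := Finset.HasAntidiagonal.antidiagonal n)
      fun (q : ℕ × ℕ) _ => (h q.1).mul (h' q.2)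
    exact key
  | interval J =>
    exact (ContDiffOn.mul h h').congr fun q _ =>
      congrFun (Scalar.extendZero_mul (W q.2) (W' q.2)) q.1

/-- Together with `D_interval`, this identifies space and time derivatives with one derivative
within `J × U`, applied to (0, v) and (1, 0). Smoothness of both, and the fact that they commute,
follow from this description. -/
theorem pd_interval {J : Set ℝ} (hU : IsOpen U) {W : E3 → (interval J).Scalar}
    (h : TSmooth W U) (v : E3) {y : E3} (hy : y ∈ U) (t : J) :
    (pd v W y).val t = fderivWithin ℝ (spaceTime W) (J ×ˢ U) ((t : ℝ), y) (0, v) := by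
  have h1 := hasFDerivAt_snd hU ((tsmooth_interval_iff.1 h).differentiableOn (by simp)) t.2 hy
  have h2 : (fun y' => (W y').val t) = fun y' => spaceTime W ((t : ℝ), y') :=
    funext fun y' => (spaceTime_of_mem W (q := ((t : ℝ), y')) t.2).symm
  refine (congrArg (fun f => fderiv ℝ f y v) h2).trans ?_
  rw [h1.fderiv]
  simp

theorem D_interval {J : Set ℝ} (hJ : J.OrdConnected ∧ J.Nontrivial) {W : E3 → (interval J).Scalar}
    (h : TSmooth W U) {y : E3} (hy : y ∈ U) (t : J) :
    (W y).D.val t = fderivWithin ℝ (spaceTime W) (J ×ˢ U) ((t : ℝ), y) (1, 0) :=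
  (hasDerivWithinAt_fst ((tsmooth_interval_iff.1 h).differentiableOn (by simp)) t.2 hy).derivWithin
    (uniqueDiffOn_of_nontrivial hJ t t.2)

theorem spaceTime_pd {J : Set ℝ} (hU : IsOpen U) {W : E3 → (interval J).Scalar}
    (h : TSmooth W U) (v : E3) : ∀ q ∈ J ×ˢ U, spaceTime (pd v W) q =
      fderivWithin ℝ (spaceTime W) (J ×ˢ U) q (0, v) := fun q hq =>
  (spaceTime_of_mem _ hq.1).trans (pd_interval hU h v hq.2 ⟨q.1, hq.1⟩)

theorem spaceTime_D {J : Set ℝ} (hJ : J.OrdConnected ∧ J.Nontrivial) {W : E3 → (interval J).Scalar}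
    (h : TSmooth W U) : ∀ q ∈ J ×ˢ U, spaceTime (fun y => (W y).D) q =
      fderivWithin ℝ (spaceTime W) (J ×ˢ U) q (1, 0) := fun q hq =>
  (spaceTime_of_mem _ hq.1).trans (D_interval hJ h hq.2 ⟨q.1, hq.1⟩)

theorem tsmooth_D_formal {W : E3 → formal.Scalar} (h : TSmooth W U) :
    TSmooth (fun y => (W y).D) U := by
  have key (n : ℕ) : ContDiffOn ℝ ∞ (fun y => ((n : ℝ) + 1) * (W y).val (n + 1 : ℕ)) U :=
    contDiffOn_const.mul (h (n + 1 : ℕ))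
  exact key

theorem TSmooth.pd (hT : T.Good) (hU : IsOpen U) {W : E3 → T.Scalar} (h : TSmooth W U) (v : E3) :
    TSmooth (pd v W) U := by
  cases T with
  | point => exact (ContDiffOn.fderiv_of_isOpen h hU (by simp)).clm_apply contDiffOn_const
  | formal => exact fun n => ((h n).fderiv_of_isOpen hU (by simp)).clm_apply contDiffOn_const
  | interval J =>
    exact (contDiffOn_fderivWithin_apply hT hU h (0, v)).congr (spaceTime_pd hU h v)

theorem TSmooth.D (hT : T.Good) (hU : IsOpen U) {W : E3 → T.Scalar} (h : TSmooth W U) :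
    TSmooth (fun y => (W y).D) U := by
  cases T with
  | point => exact contDiffOn_const
  | formal => exact tsmooth_D_formal h
  | interval J => exact (contDiffOn_fderivWithin_apply hT hU h (1, 0)).congr (spaceTime_D hT h)

theorem fderiv_congr_of_isOpen (hU : IsOpen U) {f g : E3 → ℝ} (h : ∀ y ∈ U, f y = g y) {y : E3}
    (hy : y ∈ U) : fderiv ℝ f y = fderiv ℝ g y :=
  Filter.EventuallyEq.fderiv_eq (Filter.eventually_of_mem (hU.mem_nhds hy) h)

theorem pd_congr (hU : IsOpen U) {W W' : E3 → T.Scalar} (h : ∀ y ∈ U, W y = W' y) (v : E3) {y : E3}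
    (hy : y ∈ U) : pd v W y = pd v W' y := by
  refine Scalar.ext (funext fun i => ?_)
  change fderiv ℝ (fun y' => (W y').val i) y v = fderiv ℝ (fun y' => (W' y').val i) y v
  rw [fderiv_congr_of_isOpen hU (fun y' hy' => congrArg (fun a => a.val i) (h y' hy')) hy]

theorem differentiableAt_slice (hU : IsOpen U) {W : E3 → T.Scalar} (h : TSmooth W U) {y : E3}
    (hy : y ∈ U) (i : T.Idx) : DifferentiableAt ℝ (fun y => (W y).val i) y :=
  ((h.slice i).contDiffAt (hU.mem_nhds hy)).differentiableAt (by simp)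

theorem pd_add (hU : IsOpen U) {W W' : E3 → T.Scalar} (h : TSmooth W U) (h' : TSmooth W' U)
    (v : E3) {y : E3} (hy : y ∈ U) : pd v (fun y => W y + W' y) y = pd v W y + pd v W' y := by
  refine Scalar.ext (funext fun i => ?_)
  change fderiv ℝ (fun y' => (W y').val i + (W' y').val i) y v = _
  rw [fderiv_fun_add (differentiableAt_slice hU h hy i) (differentiableAt_slice hU h' hy i)]
  rfl

theorem fderiv_sum_mul (f g : ℕ → E3 → ℝ) (s : Finset (ℕ × ℕ)) {y : E3}
    (hf : ∀ n, DifferentiableAt ℝ (f n) y) (hg : ∀ n, DifferentiableAt ℝ (g n) y) (v : E3) :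
    fderiv ℝ (fun y => ∑ q ∈ s, f q.1 y * g q.2 y) y v =
      ∑ q ∈ s, f q.1 y * fderiv ℝ (g q.2) y v + ∑ q ∈ s, fderiv ℝ (f q.1) y v * g q.2 y := by
  rw [fderiv_fun_sum fun q _ => (hf q.1).mul (hg q.2), ← Finset.sum_add_distrib, sum_apply]
  refine Finset.sum_congr rfl fun q _ => ?_
  rw [fderiv_fun_mul (hf q.1) (hg q.2)]
  simp only [add_apply, smul_apply, smul_eq_mul]
  ring

theorem pd_mul (hU : IsOpen U) {W W' : E3 → T.Scalar} (h : TSmooth W U) (h' : TSmooth W' U)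
    (v : E3) {y : E3} (hy : y ∈ U) :
    pd v (fun y => W y * W' y) y = W y * pd v W' y + pd v W y * W' y := by
  have key : ∀ i j : T.Idx, fderiv ℝ (fun y' => (W y').val i * (W' y').val j) y v =
      (W y).val i * (pd v W' y).val j + (pd v W y).val i * (W' y).val j := by
    intro i j
    rw [fderiv_fun_mul (differentiableAt_slice hU h hy i) (differentiableAt_slice hU h' hy j)]
    simp only [add_apply, smul_apply, smul_eq_mul]
    change (W y).val i * (pd v W' y).val j + (W' y).val j * (pd v W y).val i = _
    ring
  refine Scalar.ext (funext fun i => ?_)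
  cases T with
  | point => exact key i i
  | interval J => exact key i i
  | formal =>
    have key (n : ℕ) := fderiv_sum_mul (fun n y => (W y).val n) (fun n y => (W' y).val n)
      (Finset.HasAntidiagonal.antidiagonal n)
      (differentiableAt_slice hU h hy) (differentiableAt_slice hU h' hy) v
    exact key i

/-- Symmetry of mixed derivatives in the interval model; for power series the time derivative only
shifts and rescales coefficients, so nothing more than linearity is involved. -/
theorem pd_D (hT : T.Good) (hU : IsOpen U) {W : E3 → T.Scalar} (h : TSmooth W U) (v : E3) {y : E3}
    (hy : y ∈ U) : pd v (fun y => (W y).D) y = (pd v W y).D := by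
  cases T with
  | point =>
    refine Scalar.ext (funext fun i => ?_)
    change fderiv ℝ (fun _ => (0 : ℝ)) y v = 0
    simp
  | formal =>
    have key (n : ℕ) : (pd v (fun y => (W y).D) y).val n = (pd v W y).D.val n := by
      have h1 := fderiv_const_mul (differentiableAt_slice hU h hy (n + 1 : ℕ)) ((n : ℝ) + 1)
      exact congrArg (fun L => L v) h1
    exact Scalar.ext (funext key)
  | interval J =>
    have key (t : J) : (pd v (fun y => (W y).D) y).val t = (pd v W y).D.val t := by
      have hp : ((t : ℝ), y) ∈ J ×ˢ U := ⟨t.2, hy⟩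
      rw [pd_interval hU (h.D hT hU) v hy t, D_interval hT (h.pd hT hU v) hy t,
        fderivWithin_congr (spaceTime_D hT h) (spaceTime_D hT h _ hp),
        fderivWithin_congr (spaceTime_pd hU h v) (spaceTime_pd hU h v _ hp)]
      exact fderivWithin_comm hT hU h hp (1, 0) (0, v)
    exact Scalar.ext (funext key)

/-- For power series the coefficients of the inverse satisfy a recursion whose only division is by
the constant coefficient, so smoothness follows by strong induction on the coefficient. -/
theorem TSmooth.recip {W : E3 → T.Scalar} (h : TSmooth W U)
    (hne : ∀ y ∈ U, ∀ i, T.IsInstant i → (W y).val i ≠ 0) : TSmooth (fun y => (W y).recip) U := by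
  cases T with
  | point => exact ContDiffOn.inv h fun y hy => hne y hy _ trivial
  | interval J =>
    have h' := tsmooth_interval_iff.1 h
    refine (h'.inv fun q hq => ?_).congr fun q hq => ?_
    · rw [spaceTime_of_mem W hq.1]
      exact hne q.2 hq.2 _ trivial
    · rw [Pi.inv_apply, spaceTime_of_mem W hq.1]
      exact extendZero_of_mem (J := J) _ hq.1
  | formal =>
    have h0 : ContDiffOn ℝ ∞ (fun y => ((W y).val (0 : ℕ))⁻¹) U :=
      (h (0 : ℕ)).inv fun y hy => hne y hy (0 : ℕ) rfl
    have key : ∀ n : ℕ, ContDiffOn ℝ ∞ (fun y => (W y).recip.val n) U := by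
      intro n
      induction n using Nat.strong_induction_on with
      | _ n ih =>
        have hrec : ∀ y, (W y).recip.val n = if n = 0 then ((W y).val (0 : ℕ))⁻¹ else
            -((W y).val (0 : ℕ))⁻¹ * ∑ q ∈ Finset.HasAntidiagonal.antidiagonal n,
              if q.2 < n then (W y).val q.1 * (W y).recip.val q.2 else 0 := by
          intro y
          rw [← Scalar.coeff_series, Scalar.series_recip, PowerSeries.coeff_inv,
            Scalar.constantCoeff_series]
          simp only [← Scalar.series_recip, Scalar.coeff_series]
        simp only [hrec]
        split_ifs with hn
        · exact h0
        · refine h0.neg.mul (ContDiffOn.sum fun q _ => ?_)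
          split_ifs with hq
          · exact (h q.1).mul (ih q.2 hq)
          · exact contDiffOn_const
    exact key

theorem TSmooth.log {W : E3 → T.Scalar} (h : TSmooth W U)
    (hpos : ∀ y ∈ U, ∀ i, T.IsInstant i → 0 < (W y).val i) :
    TSmooth (fun y => Scalar.log T (W y)) U := by
  cases T with
  | point => exact ContDiffOn.log h fun y hy => (hpos y hy _ trivial).ne'
  | interval J =>
    have h' := tsmooth_interval_iff.1 h
    refine (h'.log fun q hq => ?_).congr fun q hq => ?_
    · rw [spaceTime_of_mem W hq.1]
      exact (hpos q.2 hq.2 _ trivial).ne'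
    · rw [spaceTime_of_mem W hq.1]
      exact extendZero_of_mem (J := J) _ hq.1
  | formal =>
    have key : ∀ n : ℕ, ContDiffOn ℝ ∞ (fun y => (Scalar.log formal (W y)).val n) U := by
      intro n
      rcases n with _ | n
      · exact (h (0 : ℕ)).log fun y hy => (hpos y hy (0 : ℕ) rfl).ne'
      · have h1 : TSmooth (fun y => (W y).D * (W y).recip) U := by
          exact (tsmooth_D_formal h).mul (h.recip fun y hy i hi => (hpos y hy i hi).ne')
        exact contDiffOn_const.mul (h1 (n : ℕ))
    exact key

end TimeModel
end FluidHPT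

namespace FluidHPT

/-! ### The Hodge star in an arbitrary basis -/

section Fibre

variable {V : Type} [NormedAddCommGroup V] [InnerProductSpace ℝ V]
  [Fact (Module.finrank ℝ V = 3)] (o : Orientation ℝ V (Fin 3)) (b : Module.Basis (Fin 3) ℝ V)

/-- If A expresses the basis in the oriented orthonormal frame, its volume is det A and its Gram
matrix is AᵀA. -/
theorem volumeForm_sq : o.volumeForm b ^ 2 = Matrix.det (Matrix.of fun i j => inner ℝ (b i) (b j)) := by
  rw [volumeForm_apply]
  set A : Matrix (Fin 3) (Fin 3) ℝ := Matrix.of fun i j => inner ℝ (frame o i) (b j)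
  have : Matrix.of (fun i j => inner ℝ (b i) (b j)) = A.transpose * A := by
    ext i j
    rw [Matrix.mul_apply]
    simp only [A, Matrix.of_apply, Matrix.transpose_apply]
    rw [inner_eq_sum_frame o]
    simp only [real_inner_comm]
  rw [this, Matrix.det_mul, Matrix.det_transpose, pow_two]

theorem volumeForm_basis_ne_zero : o.volumeForm b ≠ 0 := by
  rw [volumeForm_eq]
  exact ((frame o).toBasis.isUnit_det b).ne_zero

theorem volumeForm_basis_comp (r : Fin 3 → Fin 3) : o.volumeForm (fun m => b (r m)) =
    o.volumeForm b * Matrix.det (Matrix.of fun l m => if l = r m then (1 : ℝ) else 0) := by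
  conv_lhs => rw [o.volumeForm.eq_smul_basis_det b]
  rw [AlternatingMap.smul_apply, smul_eq_mul, Module.Basis.det_apply]
  congr 2
  ext l m
  simp [Module.Basis.toMatrix_apply, Finsupp.single_apply, eq_comm]

theorem volumeForm_basis_vec (i j k : Fin 3) : o.volumeForm ![b i, b j, b k] = o.volumeForm b *
    Matrix.det (Matrix.of fun l m => if l = (![i, j, k] : Fin 3 → Fin 3) m then (1 : ℝ) else 0) := by
  rw [← volumeForm_basis_comp]
  congr 1
  funext m
  fin_cases m <;> rfl

/-- The star of α is the contraction of the volume form with α♯. In this form it can be expanded in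
a coordinate basis; the orthonormal `frame` is chosen point by point and need not vary smoothly. -/
theorem hodge_one_two_sharp (h : 1 + 2 = 3) (α : V [⋀^Fin 1]→ₗ[ℝ] ℝ) (v w : V) :
    hodge o h α ![v, w] = o.volumeForm ![sharp o α, v, w] := by
  rw [hodge_one_two]
  have hL : ∀ u : V, o.volumeForm ![u, v, w] =
      o.volumeForm.toMultilinearMap.toLinearMap ![0, v, w] 0 u := by
    intro u
    rw [MultilinearMap.toLinearMap_apply]
    refine congrArg o.volumeForm ?_
    funext m
    fin_cases m <;> rfl
  simp only [hL, sharp, map_sum, map_smul, smul_eq_mul]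
  refine Finset.sum_congr rfl fun i _ => ?_
  rw [fin_one_eta (fun _ : Fin 1 => frame o i)]

theorem volumeForm_sum_left (s : Fin 3 → ℝ) (v w : V) :
    o.volumeForm ![∑ a, s a • b a, v, w] = ∑ a, s a * o.volumeForm ![b a, v, w] := by
  have hL : ∀ u : V, o.volumeForm ![u, v, w] =
      o.volumeForm.toMultilinearMap.toLinearMap ![0, v, w] 0 u := by
    intro u
    rw [MultilinearMap.toLinearMap_apply]
    refine congrArg o.volumeForm ?_
    funext m
    fin_cases m <;> rfl
  simp only [hL, map_sum, map_smul, smul_eq_mul]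

theorem one_form_eq_inner_sharp (α : V [⋀^Fin 1]→ₗ[ℝ] ℝ) (v : V) :
    α ![v] = inner ℝ (sharp o α) v := by
  rw [← flat_apply, flat_sharp]

theorem hodge_three_zero_basis (h : 3 + 0 = 3) (γ : V [⋀^Fin 3]→ₗ[ℝ] ℝ) :
    hodge o h γ ![] = (o.volumeForm b)⁻¹ * γ b := by
  have h1 := congrArg (fun γ' : V [⋀^Fin 3]→ₗ[ℝ] ℝ => γ' b) (hodge_hodge_three o h rfl γ)
  simp only [hodge_zero_three] at h1
  rw [← h1, mul_comm (hodge o h γ ![]), inv_mul_cancel_left₀ (volumeForm_basis_ne_zero o b)]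

/-- Put α = ⋆β, so that β = ⋆α. The values of β on pairs of basis vectors are then the components of
α♯ times the volume of the basis, and lowering the index brings in the inner products. -/
theorem hodge_two_one_basis (h : 2 + 1 = 3) (β : V [⋀^Fin 2]→ₗ[ℝ] ℝ) (c : Fin 3) :
    hodge o h β ![b c] = (o.volumeForm b)⁻¹ * (β ![b 1, b 2] * inner ℝ (b 0) (b c) +
      β ![b 2, b 0] * inner ℝ (b 1) (b c) + β ![b 0, b 1] * inner ℝ (b 2) (b c)) := by
  set α := hodge o h β with hα
  have hβ : hodge o rfl α = β := hodge_hodge_two o h rfl β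
  set s := fun a => b.repr (sharp o α) a
  have hs : sharp o α = ∑ a, s a • b a := (b.sum_repr _).symm
  have hne := volumeForm_basis_ne_zero o b
  have h12 : β ![b 1, b 2] = s 0 * o.volumeForm b := by
    rw [← hβ, hodge_one_two_sharp, hs, volumeForm_sum_left]
    simp only [volumeForm_basis_vec, Matrix.det_fin_three, Fin.sum_univ_three]
    simp
  have h20 : β ![b 2, b 0] = s 1 * o.volumeForm b := by
    rw [← hβ, hodge_one_two_sharp, hs, volumeForm_sum_left]
    simp only [volumeForm_basis_vec, Matrix.det_fin_three, Fin.sum_univ_three]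
    simp
  have h01 : β ![b 0, b 1] = s 2 * o.volumeForm b := by
    rw [← hβ, hodge_one_two_sharp, hs, volumeForm_sum_left]
    simp only [volumeForm_basis_vec, Matrix.det_fin_three, Fin.sum_univ_three]
    simp
  rw [one_form_eq_inner_sharp o α, hs, h12, h20, h01, Fin.sum_univ_three]
  simp only [inner_add_left, inner_smul_left, RCLike.conj_to_real]
  field_simp

/-- The Gram matrix of a basis. -/
def gram : Matrix (Fin 3) (Fin 3) ℝ := Matrix.of fun i j => inner ℝ (b i) (b j)

/-- Raising an index inverts the Gram matrix. Writing the inverse through the adjugate shows that it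
is smooth in the metric coefficients. -/
theorem repr_sharp (α : V [⋀^Fin 1]→ₗ[ℝ] ℝ) (a : Fin 3) :
    b.repr (sharp o α) a = (gram b).det⁻¹ * ∑ c, (gram b).adjugate a c * α ![b c] := by
  have hG : (gram b).det ≠ 0 := by
    rw [gram, ← volumeForm_sq o b]
    exact pow_ne_zero 2 (volumeForm_basis_ne_zero o b)
  set s : Fin 3 → ℝ := fun a => b.repr (sharp o α) a
  have hs : sharp o α = ∑ a, s a • b a := (b.sum_repr _).symm
  have h1 : (fun c => α ![b c]) = (gram b).mulVec s := by
    funext c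
    rw [one_form_eq_inner_sharp o α, hs, sum_inner, Matrix.mulVec, dotProduct]
    refine Finset.sum_congr rfl fun a _ => ?_
    rw [inner_smul_left, gram, Matrix.of_apply, real_inner_comm]
    simp [mul_comm]
  have h2 : (gram b).adjugate.mulVec (fun c => α ![b c]) = (gram b).det • s := by
    rw [h1, Matrix.mulVec_mulVec, Matrix.adjugate_mul, Matrix.smul_mulVec, Matrix.one_mulVec]
  have h3 := congrFun h2 a
  rw [Matrix.mulVec, dotProduct, Pi.smul_apply, smul_eq_mul] at h3
  rw [h3, inv_mul_cancel_left₀ hG]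

end Fibre

/-! ### Smoothness of the metric and of the volume form -/

section Metric

variable {M : Type*} [TopologicalSpace M] [ChartedSpace E3 M] [IsManifold (𝓡 3) ∞ M]

theorem contMDiffOn_coordVec (x₀ : M) (a : Fin 3) :
    ContMDiffOn (𝓡 3) ((𝓡 3).prod 𝓘(ℝ, E3)) ∞
      (fun x => (⟨x, coordVec x₀ x a⟩ : TotalSpace E3 (TangentSpace (𝓡 3) : M → Type _)))
      (trivializationAt E3 (TangentSpace (𝓡 3)) x₀).baseSet := by
  refine (Bundle.Trivialization.contMDiffOn_section_baseSet_iff (𝕜 := ℝ) (IB := 𝓡 3)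
    (trivializationAt E3 (TangentSpace (𝓡 3)) x₀)).2 ?_
  refine (contMDiffOn_const (c := EuclideanSpace.basisFun (Fin 3) ℝ a)).congr fun x hx => ?_
  have h := Bundle.Trivialization.continuousLinearMapAt_symmL (R := ℝ)
    (trivializationAt E3 (TangentSpace (𝓡 3)) x₀) hx (EuclideanSpace.basisFun (Fin 3) ℝ a)
  rw [Bundle.Trivialization.continuousLinearMapAt_apply, Bundle.Trivialization.coe_linearMapAt_of_mem _ hx] at h
  exact h

theorem contDiffOn_comp_symm {f : M → ℝ} {x₀ : M}
    (hf : ContMDiffOn (𝓡 3) 𝓘(ℝ, ℝ) ∞ f (extChartAt (𝓡 3) x₀).source) :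
    ContDiffOn ℝ ∞ (fun y => f ((extChartAt (𝓡 3) x₀).symm y)) (extChartAt (𝓡 3) x₀).target := by
  rw [← contMDiffOn_iff_contDiffOn]
  exact hf.comp (contMDiffOn_extChartAt_symm x₀) fun y hy => (extChartAt (𝓡 3) x₀).map_target hy

variable [RiemannianBundle (fun x : M => TangentSpace (𝓡 3) x)]

/-- The coefficients of the metric. -/
def metricCoef (x₀ : M) (a c : Fin 3) (x : M) : ℝ := inner ℝ (coordVec x₀ x a) (coordVec x₀ x c)

theorem contDiffOn_metricCoef
    [IsContMDiffRiemannianBundle (𝓡 3) ∞ E3 (fun x : M => TangentSpace (𝓡 3) x)]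
    (x₀ : M) (a c : Fin 3) :
    ContDiffOn ℝ ∞ (fun y => metricCoef x₀ a c ((extChartAt (𝓡 3) x₀).symm y))
      (extChartAt (𝓡 3) x₀).target := by
  refine contDiffOn_comp_symm (f := metricCoef x₀ a c) ?_
  have h : (extChartAt (𝓡 3) x₀).source =
    (trivializationAt E3 (TangentSpace (𝓡 3)) x₀).baseSet := Set.ext fun x => mem_baseSet_iff.symm
  rw [h]
  exact (contMDiffOn_coordVec x₀ a).inner_bundle (contMDiffOn_coordVec x₀ c)

variable (o : (x : M) → Orientation ℝ (TangentSpace (𝓡 3) x) (Fin 3))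

/-- The coefficient of the volume form. -/
def volCoef (x₀ x : M) : ℝ := (o x).volumeForm (coordVec x₀ x)

theorem volCoef_ne_zero {x₀ x : M}
    (hx : x ∈ (trivializationAt E3 (TangentSpace (𝓡 3)) x₀).baseSet) : volCoef o x₀ x ≠ 0 := by
  rw [volCoef, ← coordBasis_coe x₀ x hx]
  exact volumeForm_basis_ne_zero (o x) _

theorem volCoef_sq {x₀ x : M}
    (hx : x ∈ (trivializationAt E3 (TangentSpace (𝓡 3)) x₀).baseSet) : volCoef o x₀ x ^ 2 =
      Matrix.det (Matrix.of fun a c => metricCoef x₀ a c x) := by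
  rw [volCoef, ← coordBasis_coe x₀ x hx, volumeForm_sq]
  simp only [coordBasis_apply]
  rfl

theorem volCoef_change {x₀ x₁ x : M}
    (h₀ : x ∈ (trivializationAt E3 (TangentSpace (𝓡 3)) x₀).baseSet)
    (h₁ : x ∈ (trivializationAt E3 (TangentSpace (𝓡 3)) x₁).baseSet) :
    volCoef o x₀ x = volCoef o x₁ x * (tangentCoordChange (𝓡 3) x₀ x₁ x).det := by
  have h : (fun a => (trivializationAt E3 (TangentSpace (𝓡 3)) x₁).symmL ℝ x
      (tangentCoordChange (𝓡 3) x₀ x₁ x (EuclideanSpace.basisFun (Fin 3) ℝ a))) =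
      coordVec x₀ x := by
    funext a
    rw [← clm_symmL h₀ h₁, Bundle.Trivialization.symmL_continuousLinearMapAt _ h₁]
    rfl
  rw [volCoef, ← h]
  set α : E3 [⋀^Fin 3]→ₗ[ℝ] ℝ := (o x).volumeForm.compLinearMap
    ((trivializationAt E3 (TangentSpace (𝓡 3)) x₁).symmL ℝ x : E3 →ₗ[ℝ] TangentSpace (𝓡 3) x)
  set B := (EuclideanSpace.basisFun (Fin 3) ℝ).toBasis
  have h2 : α (fun a => tangentCoordChange (𝓡 3) x₀ x₁ x (EuclideanSpace.basisFun (Fin 3) ℝ a)) =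
      α B * (tangentCoordChange (𝓡 3) x₀ x₁ x).det := by
    conv_lhs => rw [α.eq_smul_basis_det B]
    rw [AlternatingMap.smul_apply, smul_eq_mul]
    congr 1
    have h3 := B.det_comp ((tangentCoordChange (𝓡 3) x₀ x₁ x : E3 →L[ℝ] E3) : E3 →ₗ[ℝ] E3) B
    rw [B.det_self, mul_one] at h3
    refine Eq.trans (congrArg B.det ?_) h3
    funext a
    exact congrArg (tangentCoordChange (𝓡 3) x₀ x₁ x)
      (congrFun (EuclideanSpace.basisFun (Fin 3) ℝ).coe_toBasis a).symm
  refine h2.trans ?_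
  rw [OrthonormalBasis.coe_toBasis]
  rfl

/-- The orientation condition concerns only the chart centred at x, near x. Passing to another chart
multiplies by the determinant of the coordinate change, which is continuous and nonzero and so keeps
its sign near x. -/
theorem volCoef_sign (ho : IsOrientation o) {x₀ x : M}
    (hx : x ∈ (trivializationAt E3 (TangentSpace (𝓡 3)) x₀).baseSet) :
    (∀ᶠ z in 𝓝 x, 0 < volCoef o x₀ z) ∨ (∀ᶠ z in 𝓝 x, volCoef o x₀ z < 0) := by
  have hxx : x ∈ (trivializationAt E3 (TangentSpace (𝓡 3)) x).baseSet :=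
    mem_baseSet_iff.2 (mem_extChartAt_source x)
  have hev : ∀ᶠ z in 𝓝 x, volCoef o x₀ z = volCoef o x z * (tangentCoordChange (𝓡 3) x₀ x z).det := by
    filter_upwards [(trivializationAt E3 (TangentSpace (𝓡 3)) x₀).open_baseSet.mem_nhds hx,
      (trivializationAt E3 (TangentSpace (𝓡 3)) x).open_baseSet.mem_nhds hxx] with z h₀ h₁
    exact volCoef_change o h₀ h₁
  have hcont : ContinuousAt (fun z => (tangentCoordChange (𝓡 3) x₀ x z).det) x := by
    have h1 := (continuousOn_tangentCoordChange (I := 𝓡 3) x₀ x).continuousAt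
      (((isOpen_extChartAt_source (I := 𝓡 3) x₀).inter
        (isOpen_extChartAt_source (I := 𝓡 3) x)).mem_nhds
        ⟨mem_baseSet_iff.1 hx, mem_extChartAt_source x⟩)
    exact ContinuousLinearMap.continuous_det.continuousAt.comp h1
  have hne : (tangentCoordChange (𝓡 3) x₀ x x).det ≠ 0 := by
    intro h0
    have := volCoef_change o hx hxx
    rw [h0, mul_zero] at this
    exact volCoef_ne_zero o hx this
  have hdet : (∀ᶠ z in 𝓝 x, 0 < (tangentCoordChange (𝓡 3) x₀ x z).det) ∨
      (∀ᶠ z in 𝓝 x, (tangentCoordChange (𝓡 3) x₀ x z).det < 0) := by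
    rcases lt_or_gt_of_ne hne with h | h
    · exact Or.inr (hcont.eventually_lt continuousAt_const h)
    · exact Or.inl (continuousAt_const.eventually_lt hcont h)
  have hox : (∀ᶠ z in 𝓝 x, 0 < volCoef o x z) ∨ (∀ᶠ z in 𝓝 x, volCoef o x z < 0) := ho x
  rcases hox with h1 | h1 <;> rcases hdet with h2 | h2
  · left
    filter_upwards [hev, h1, h2] with z hz h1 h2
    rw [hz]
    exact mul_pos h1 h2
  · right
    filter_upwards [hev, h1, h2] with z hz h1 h2
    rw [hz]
    exact mul_neg_of_pos_of_neg h1 h2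
  · right
    filter_upwards [hev, h1, h2] with z hz h1 h2
    rw [hz]
    exact mul_neg_of_neg_of_pos h1 h2
  · left
    filter_upwards [hev, h1, h2] with z hz h1 h2
    rw [hz]
    exact mul_pos_of_neg_of_neg h1 h2

theorem contDiffOn_det {U : Set E3} {A : E3 → Matrix (Fin 3) (Fin 3) ℝ}
    (h : ∀ a c, ContDiffOn ℝ ∞ (fun y => A y a c) U) : ContDiffOn ℝ ∞ (fun y => (A y).det) U := by
  simp only [Matrix.det_apply']
  exact ContDiffOn.sum fun σ _ => contDiffOn_const.mul (contDiffOn_prod fun a _ => h _ _)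

theorem contDiffOn_adjugate {U : Set E3} {A : E3 → Matrix (Fin 3) (Fin 3) ℝ}
    (h : ∀ a c, ContDiffOn ℝ ∞ (fun y => A y a c) U) (a c : Fin 3) :
    ContDiffOn ℝ ∞ (fun y => (A y).adjugate a c) U := by
  simp only [Matrix.adjugate_apply]
  refine contDiffOn_det fun i j => ?_
  by_cases hi : i = c
  · subst hi
    simp only [Matrix.updateRow_self]
    exact contDiffOn_const
  · simp only [Matrix.updateRow_ne hi]
    exact h i j

/-- Up to a locally constant sign the volume coefficient is the square root of the Gram determinant.
This is where coherence of the pointwise orientations enters. -/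
theorem contDiffOn_volCoef
    [IsContMDiffRiemannianBundle (𝓡 3) ∞ E3 (fun x : M => TangentSpace (𝓡 3) x)]
    (ho : IsOrientation o) (x₀ : M) :
    ContDiffOn ℝ ∞ (fun y => volCoef o x₀ ((extChartAt (𝓡 3) x₀).symm y))
      (extChartAt (𝓡 3) x₀).target := by
  intro y hy
  refine ContDiffAt.contDiffWithinAt ?_
  have hU := (isOpen_extChartAt_target (I := 𝓡 3) x₀).mem_nhds hy
  have hdet : ContDiffAt ℝ ∞ (fun y => Matrix.det (Matrix.of fun a c => metricCoef x₀ a c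
      ((extChartAt (𝓡 3) x₀).symm y))) y :=
    (contDiffOn_det fun a c => contDiffOn_metricCoef x₀ a c).contDiffAt hU
  have hsq : ∀ᶠ y' in 𝓝 y, volCoef o x₀ ((extChartAt (𝓡 3) x₀).symm y') ^ 2 =
      Matrix.det (Matrix.of fun a c => metricCoef x₀ a c ((extChartAt (𝓡 3) x₀).symm y')) := by
    filter_upwards [hU] with y' hy'
    exact volCoef_sq o (symm_mem_baseSet hy')
  have hne : Matrix.det (Matrix.of fun a c => metricCoef x₀ a c ((extChartAt (𝓡 3) x₀).symm y)) ≠ 0 := by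
    rw [← volCoef_sq o (symm_mem_baseSet hy)]
    exact pow_ne_zero 2 (volCoef_ne_zero o (symm_mem_baseSet hy))
  have hc : Filter.Tendsto (extChartAt (𝓡 3) x₀).symm (𝓝 y) (𝓝 ((extChartAt (𝓡 3) x₀).symm y)) :=
    continuousAt_extChartAt_symm'' hy
  rcases volCoef_sign o ho (symm_mem_baseSet hy) with h | h
  · refine (hdet.sqrt hne).congr_of_eventuallyEq ?_
    filter_upwards [hsq, hc.eventually h] with y' h1 h2
    rw [← h1, Real.sqrt_sq h2.le]
  · refine (hdet.sqrt hne).neg.congr_of_eventuallyEq ?_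
    filter_upwards [hsq, hc.eventually h] with y' h1 h2
    rw [← h1, Real.sqrt_sq_eq_abs, abs_of_neg h2, neg_neg]

end Metric

end FluidHPT

namespace FluidHPT

/-! ### Smoothness of time-dependent objects in terms of coefficients -/

namespace TimeModel

variable {T : TimeModel} {U : Set E3} {F G : Type} [NormedAddCommGroup F] [NormedSpace ℝ F]
  [NormedAddCommGroup G] [NormedSpace ℝ G]

theorem SmoothOn.map {w : T.Idx → E3 → F} (h : T.SmoothOn w U) (L : F →L[ℝ] G) :
    T.SmoothOn (fun i y => L (w i y)) U := by
  cases T with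
  | point => exact L.contDiff.comp_contDiffOn h
  | formal => exact fun n => L.contDiff.comp_contDiffOn (h n)
  | interval J =>
    exact (L.contDiff.comp_contDiffOn h).congr fun q _ =>
      congrFun (extendZero_map J L (map_zero L) fun t => w t q.2) q.1

theorem smoothOn_pi {ι : Type} [Fintype ι] {w : T.Idx → E3 → ι → ℝ}
    (h : ∀ r, TSmooth (fun y => (⟨fun i => w i y r⟩ : T.Scalar)) U) : T.SmoothOn w U := by
  cases T with
  | point => exact contDiffOn_pi.2 h
  | formal => exact fun n => contDiffOn_pi.2 fun r => h r n
  | interval J =>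
    refine contDiffOn_pi.2 fun r => (h r).congr fun q _ => ?_
    exact (congrFun (extendZero_map J (fun a : ι → ℝ => a r) rfl fun t => w t q.2) q.1).symm

theorem diff_pi {ι : Type} [Fintype ι] {a : T.Idx → ι → ℝ} (h : ∀ r, T.Diff fun i => a i r) :
    T.Diff a := by
  cases T with
  | point => trivial
  | formal => trivial
  | interval J =>
    refine differentiableOn_pi.2 fun r => (h r).congr fun s _ => ?_
    exact (congrFun (extendZero_map J (fun a : ι → ℝ => a r) rfl a) s).symm

theorem smoothOn_form_iff {k : ℕ} {w : T.Idx → E3 → E3 [⋀^Fin k]→L[ℝ] ℝ} :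
    T.SmoothOn w U ↔ ∀ r : Fin k → Fin 3, TSmooth (fun y => (⟨fun i => w i y fun a =>
      EuclideanSpace.basisFun (Fin 3) ℝ (r a)⟩ : T.Scalar)) U := by
  constructor
  · intro h r
    exact h.map (evalAt fun a => EuclideanSpace.basisFun (Fin 3) ℝ (r a))
  · intro h
    obtain ⟨R, hR⟩ := exists_reconstruct k
    have h1 := (smoothOn_pi (w := fun i y => evalBasis k (w i y)) h).map R
    simpa only [hR] using h1

theorem diff_form {k : ℕ} {a : T.Idx → E3 [⋀^Fin k]→L[ℝ] ℝ}
    (h : ∀ r : Fin k → Fin 3, T.Diff fun i => a i fun b =>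
      EuclideanSpace.basisFun (Fin 3) ℝ (r b)) : T.Diff a := by
  obtain ⟨R, hR⟩ := exists_reconstruct k
  have h1 := (diff_pi (a := fun i => evalBasis k (a i)) h).map R
  simpa only [hR] using h1

theorem smoothOn_vec_iff {w : T.Idx → E3 → E3} : T.SmoothOn w U ↔
    ∀ a : Fin 3, TSmooth (fun y => (⟨fun i => w i y a⟩ : T.Scalar)) U := by
  constructor
  · intro h a
    exact h.map (EuclideanSpace.proj a : E3 →L[ℝ] ℝ)
  · intro h
    exact (smoothOn_pi (w := fun i y a => w i y a) h).map
      ((EuclideanSpace.equiv (Fin 3) ℝ).symm : (Fin 3 → ℝ) →L[ℝ] E3)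

end TimeModel

open TimeModel

section Manifold

variable {M : Type*} [TopologicalSpace M] [ChartedSpace E3 M] {T : TimeModel}

/-- The value of a time-dependent form on fixed vectors. -/
def ev {k : ℕ} (w : TForm M T k) (x : M) (v : Fin k → TangentSpace (𝓡 3) x) : T.Scalar :=
  ⟨fun i => w i x v⟩

/-- The value of a time-dependent function at a point. -/
def evF (f : TFun M T) (x : M) : T.Scalar := ⟨fun i => f i x⟩

theorem ev_ext {k : ℕ} {w w' : TForm M T k} (h : ∀ x v, ev w x v = ev w' x v) : w = w' := by
  funext i x
  ext v
  exact congrFun (congrArg Scalar.val (h x v)) i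

theorem evF_ext {M : Type*} {f g : TFun M T} (h : ∀ x, evF f x = evF g x) : f = g :=
  funext fun i => funext fun x => congrFun (congrArg Scalar.val (h x)) i

theorem ev_add {k : ℕ} (w w' : TForm M T k) (x : M) (v : Fin k → TangentSpace (𝓡 3) x) :
    ev (w + w') x v = ev w x v + ev w' x v := rfl

theorem ev_neg {k : ℕ} (w : TForm M T k) (x : M) (v : Fin k → TangentSpace (𝓡 3) x) :
    ev (-w) x v = -ev w x v := rfl

theorem ev_sub {k : ℕ} (w w' : TForm M T k) (x : M) (v : Fin k → TangentSpace (𝓡 3) x) :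
    ev (w - w') x v = ev w x v - ev w' x v := rfl

theorem ev_const_smul {k : ℕ} (c : ℝ) (w : TForm M T k) (x : M)
    (v : Fin k → TangentSpace (𝓡 3) x) : ev (c • w) x v = c • ev w x v := rfl

theorem ev_zero {k : ℕ} (x : M) (v : Fin k → TangentSpace (𝓡 3) x) :
    ev (0 : TForm M T k) x v = 0 := rfl

theorem ev_ofFun (f : TFun M T) (x : M) (v : Fin 0 → TangentSpace (𝓡 3) x) :
    ev (fun i => Form.ofFun (f i)) x v = evF f x := rfl

theorem evF_toFun (w : TForm M T 0) (x : M) : evF (fun i => Form.toFun (w i)) x = ev w x ![] := rfl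

/-- Evaluation on vectors, as an additive map. -/
def evalHom {V : Type} [AddCommGroup V] [Module ℝ V] {k : ℕ} (v : Fin k → V) :
    V [⋀^Fin k]→ₗ[ℝ] ℝ →+ ℝ where
  toFun α := α v
  map_zero' := rfl
  map_add' _ _ := rfl

/-- Evaluation on fixed vectors turns products of time-dependent objects into products in
`T.Scalar`; identities of forms can then be proved by ring arithmetic, whatever the time model. -/
theorem ev_smul {k : ℕ} (f : TFun M T) (w : TForm M T k) (x : M)
    (v : Fin k → TangentSpace (𝓡 3) x) : ev (TForm.smul f w) x v = evF f x * ev w x v := by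
  refine Scalar.ext (funext fun i => ?_)
  refine (map_conv T (evalHom v) _ (fun j => f j x) (fun j => w j x) i).trans ?_
  exact congrFun (Scalar.conv_mul (T := T) (fun a : ℝ => a) (evalHom v) (fun j => f j x)
    (fun j => w j x)) i

theorem ev_wedge {a b k : ℕ} (h : a + b = k) (α : TForm M T a) (β : TForm M T b) (x : M)
    (v : Fin k → TangentSpace (𝓡 3) x) : ev (TForm.wedge h α β) x v =
      ((a ! * b ! : ℕ) : ℝ)⁻¹ • ∑ σ : Equiv.Perm (Fin k), ((Equiv.Perm.sign σ : ℤ) : ℝ) •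
        (ev α x (fun c => v (σ (Fin.cast h (Fin.castAdd b c)))) *
          ev β x (fun c => v (σ (Fin.cast h (Fin.natAdd a c))))) := by
  refine Scalar.ext (funext fun i => ?_)
  refine (map_conv T (evalHom v) _ (fun j => α j x) (fun j => β j x) i).trans ?_
  have h1 : (fun (p : TangentSpace (𝓡 3) x [⋀^Fin a]→ₗ[ℝ] ℝ)
      (q : TangentSpace (𝓡 3) x [⋀^Fin b]→ₗ[ℝ] ℝ) => evalHom v (wedge h p q)) = fun p q =>
      ((a ! * b ! : ℕ) : ℝ)⁻¹ • ∑ σ : Equiv.Perm (Fin k), ((Equiv.Perm.sign σ : ℤ) : ℝ) •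
        (evalHom (fun c => v (σ (Fin.cast h (Fin.castAdd b c)))) p *
          evalHom (fun c => v (σ (Fin.cast h (Fin.natAdd a c)))) q) := by
    funext p q
    exact wedge_apply h p q v
  rw [h1, conv_fun_smul, conv_fun_sum, Scalar.smul_val, Pi.smul_apply, Pi.smul_apply,
    Finset.sum_apply, Scalar.sum_val]
  refine congrArg _ (Finset.sum_congr rfl fun σ _ => ?_)
  rw [conv_fun_smul, Scalar.conv_mul]
  rfl

/-- Transfers an explicit bilinear formula for the wedge in one fibre to time-dependent forms.
Bilinearity is essential: the time convolution distributes over such a sum term by term. -/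
theorem ev_wedge_of {a b k : ℕ} (h : a + b = k) (α : TForm M T a) (β : TForm M T b) (x : M)
    (v : Fin k → TangentSpace (𝓡 3) x) {ι : Type} (s : Finset ι) (c : ι → ℝ)
    (p : ι → Fin a → TangentSpace (𝓡 3) x) (q : ι → Fin b → TangentSpace (𝓡 3) x)
    (hw : ∀ (α : TangentSpace (𝓡 3) x [⋀^Fin a]→ₗ[ℝ] ℝ) (β : TangentSpace (𝓡 3) x [⋀^Fin b]→ₗ[ℝ] ℝ),
      wedge h α β v = ∑ j ∈ s, c j * (α (p j) * β (q j))) :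
    ev (TForm.wedge h α β) x v = ∑ j ∈ s, c j • (ev α x (p j) * ev β x (q j)) := by
  refine Scalar.ext (funext fun i => ?_)
  refine (map_conv T (evalHom v) _ (fun j => α j x) (fun j => β j x) i).trans ?_
  have h1 : (fun (α : TangentSpace (𝓡 3) x [⋀^Fin a]→ₗ[ℝ] ℝ)
      (β : TangentSpace (𝓡 3) x [⋀^Fin b]→ₗ[ℝ] ℝ) => evalHom v (wedge h α β)) = fun α β =>
      ∑ j ∈ s, c j • (evalHom (p j) α * evalHom (q j) β) := by
    funext α β
    exact hw α β
  rw [h1, conv_fun_sum, Finset.sum_apply, Scalar.sum_val]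
  refine Finset.sum_congr rfl fun j _ => ?_
  rw [conv_fun_smul, Scalar.conv_mul]
  rfl

theorem ev_wedge_zero_left {k : ℕ} (h : 0 + k = k) (α : TForm M T 0) (β : TForm M T k) (x : M)
    (v : Fin k → TangentSpace (𝓡 3) x) :
    ev (TForm.wedge h α β) x v = ev α x ![] * ev β x v := by
  rw [ev_wedge_of h α β x v (Finset.univ : Finset Unit) (fun _ => 1) (fun _ => ![]) (fun _ => v)
    fun α β => by simp [wedge_zero_left]]
  simp

theorem ev_wedge_zero_right {k : ℕ} (h : k + 0 = k) (α : TForm M T k) (β : TForm M T 0) (x : M)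
    (v : Fin k → TangentSpace (𝓡 3) x) :
    ev (TForm.wedge h α β) x v = ev α x v * ev β x ![] := by
  rw [ev_wedge_of h α β x v (Finset.univ : Finset Unit) (fun _ => 1) (fun _ => v) (fun _ => ![])
    fun α β => by simp [wedge_zero_right]]
  simp

theorem ev_wedge_one_one (h : 1 + 1 = 2) (α β : TForm M T 1) (x : M)
    (v : Fin 2 → TangentSpace (𝓡 3) x) : ev (TForm.wedge h α β) x v =
      ev α x ![v 0] * ev β x ![v 1] - ev α x ![v 1] * ev β x ![v 0] := by
  rw [ev_wedge_of h α β x v (Finset.univ : Finset (Fin 2)) ![1, -1]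
    ![![v 0], ![v 1]] ![![v 1], ![v 0]] fun α β => by simp [wedge_one_one]; ring]
  simp
  ring

theorem ev_wedge_one_two (h : 1 + 2 = 3) (α : TForm M T 1) (β : TForm M T 2) (x : M)
    (v : Fin 3 → TangentSpace (𝓡 3) x) : ev (TForm.wedge h α β) x v =
      ev α x ![v 0] * ev β x ![v 1, v 2] - ev α x ![v 1] * ev β x ![v 0, v 2]
        + ev α x ![v 2] * ev β x ![v 0, v 1] := by
  rw [ev_wedge_of h α β x v (Finset.univ : Finset (Fin 3)) ![1, -1, 1]
    ![![v 0], ![v 1], ![v 2]] ![![v 1, v 2], ![v 0, v 2], ![v 0, v 1]]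
    fun α β => by simp [wedge_one_two, Fin.sum_univ_three]; ring]
  simp [Fin.sum_univ_three]
  ring

theorem ev_wedge_two_one (h : 2 + 1 = 3) (β : TForm M T 2) (α : TForm M T 1) (x : M)
    (v : Fin 3 → TangentSpace (𝓡 3) x) : ev (TForm.wedge h β α) x v =
      ev α x ![v 0] * ev β x ![v 1, v 2] - ev α x ![v 1] * ev β x ![v 0, v 2]
        + ev α x ![v 2] * ev β x ![v 0, v 1] := by
  rw [ev_wedge_of h β α x v (Finset.univ : Finset (Fin 3)) ![1, -1, 1]
    ![![v 1, v 2], ![v 0, v 2], ![v 0, v 1]] ![![v 0], ![v 1], ![v 2]]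
    fun α β => by simp [wedge_two_one, Fin.sum_univ_three]; ring]
  simp [Fin.sum_univ_three]
  ring

theorem ev_two_swap (β : TForm M T 2) (x : M) (v w : TangentSpace (𝓡 3) x) :
    ev β x ![w, v] = -ev β x ![v, w] :=
  Scalar.ext (funext fun _ => two_form_swap _ _ _)

variable [IsManifold (𝓡 3) ∞ M]

/-- The coefficients of a time-dependent form in the chart at `x₀`. -/
def coefT {k : ℕ} (w : TForm M T k) (x₀ : M) (r : Fin k → Fin 3) (y : E3) : T.Scalar :=
  ⟨fun i => coef (w i) x₀ r y⟩

theorem coefT_eq {k : ℕ} (w : TForm M T k) (x₀ : M) (r : Fin k → Fin 3) (y : E3) :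
    coefT w x₀ r y = ev w ((extChartAt (𝓡 3) x₀).symm y)
      fun a => coordVec x₀ ((extChartAt (𝓡 3) x₀).symm y) (r a) := rfl

theorem form_ext_coefT {k : ℕ} {w w' : TForm M T k}
    (h : ∀ x r, coefT w x r (extChartAt (𝓡 3) x x) = coefT w' x r (extChartAt (𝓡 3) x x)) :
    w = w' :=
  funext fun i => funext fun x => form_ext_coef fun r => congrFun (congrArg Scalar.val (h x r)) i

theorem smoothForm_iff {k : ℕ} {w : TForm M T k} : SmoothForm w ↔
    ∀ x₀ r, TSmooth (coefT w x₀ r) (extChartAt (𝓡 3) x₀).target :=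
  forall_congr' fun _ => smoothOn_form_iff

theorem smoothFun_iff {M : Type*} [TopologicalSpace M] [ChartedSpace E3 M] {f : TFun M T} :
    SmoothFun f ↔ ∀ x₀ : M,
    TSmooth (fun y => evF f ((extChartAt (𝓡 3) x₀).symm y)) (extChartAt (𝓡 3) x₀).target := Iff.rfl

/-- The components of a time-dependent vector field in the chart at `x₀`. -/
def vecCoef (u : TVec M T) (x₀ : M) (a : Fin 3) (y : E3) : T.Scalar :=
  ⟨fun i => (trivializationAt E3 (TangentSpace (𝓡 3)) x₀).continuousLinearMapAt ℝ
      ((extChartAt (𝓡 3) x₀).symm y) (u i ((extChartAt (𝓡 3) x₀).symm y)) a⟩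

theorem smoothVec_iff {u : TVec M T} : SmoothVec u ↔ ∀ x₀ a,
    TSmooth (vecCoef u x₀ a) (extChartAt (𝓡 3) x₀).target :=
  forall_congr' fun _ => smoothOn_vec_iff

theorem SmoothForm.slice {k : ℕ} {w : TForm M T k} (h : SmoothForm w) (i : T.Idx) :
    SmoothForm' (w i) :=
  smoothForm'_iff.2 fun x₀ r => (smoothForm_iff.1 h x₀ r).slice i

theorem SmoothForm.diff {k : ℕ} {w : TForm M T k} (h : SmoothForm w) (x : M) :
    T.Diff fun i => toModel x x (w i x) := by
  have h1 : T.Diff fun i => chartRep (w i) x (extChartAt (𝓡 3) x x) :=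
    diff_form fun r => (smoothForm_iff.1 h x r).diff (mem_extChartAt_target x)
  unfold chartRep at h1
  rwa [extChartAt_to_inv] at h1

theorem toModel_clm {k : ℕ} (x : M) (α : TangentSpace (𝓡 3) x [⋀^Fin k]→ₗ[ℝ] ℝ)
    (v : Fin k → TangentSpace (𝓡 3) x) : toModel x x α (fun a =>
      (trivializationAt E3 (TangentSpace (𝓡 3)) x).continuousLinearMapAt ℝ x (v a)) = α v := by
  rw [toModel_apply]
  refine congrArg α (funext fun a => ?_)
  exact Bundle.Trivialization.symmL_continuousLinearMapAt _
    (mem_baseSet_iff.2 (mem_extChartAt_source x)) _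

theorem SmoothForm.diff_ev {k : ℕ} {w : TForm M T k} (h : SmoothForm w) (x : M)
    (v : Fin k → TangentSpace (𝓡 3) x) : T.Diff (ev w x v).val := by
  have h1 := (h.diff x).map (evalAt fun a =>
    (trivializationAt E3 (TangentSpace (𝓡 3)) x).continuousLinearMapAt ℝ x (v a))
  simp only [evalAt_apply, toModel_clm] at h1
  exact h1

/-- The time derivative is taken in the model space of alternating forms, where evaluation is
continuous and linear and hence commutes with it. -/
theorem ev_ddt (hT : T.Good) {k : ℕ} {w : TForm M T k} (h : SmoothForm w) (x : M)
    (v : Fin k → TangentSpace (𝓡 3) x) : ev (TForm.ddt w) x v = (ev w x v).D := by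
  refine Scalar.ext (funext fun i => ?_)
  have h1 := ddt_map hT (h.diff x) (evalAt fun a =>
    (trivializationAt E3 (TangentSpace (𝓡 3)) x).continuousLinearMapAt ℝ x (v a)) i
  simp only [evalAt_apply, toModel_clm] at h1
  exact h1.symm

theorem SmoothFun.diff_ev {f : TFun M T} (h : SmoothFun f) (x : M) : T.Diff (evF f x).val := by
  have h1 := (smoothFun_iff.1 h x).diff (mem_extChartAt_target x)
  rwa [extChartAt_to_inv] at h1

theorem coefT_ddt (hT : T.Good) {k : ℕ} {w : TForm M T k} (h : SmoothForm w) (x₀ : M)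
    (r : Fin k → Fin 3) (y : E3) : coefT (TForm.ddt w) x₀ r y = (coefT w x₀ r y).D :=
  ev_ddt hT h _ _

theorem SmoothForm.ddt (hT : T.Good) {k : ℕ} {w : TForm M T k} (h : SmoothForm w) :
    SmoothForm (TForm.ddt w) :=
  smoothForm_iff.2 fun x₀ r => tsmooth_congr
    ((smoothForm_iff.1 h x₀ r).D hT (isOpen_extChartAt_target (I := 𝓡 3) x₀))
    fun y _ => coefT_ddt hT h x₀ r y

theorem SmoothForm.zero {k : ℕ} : SmoothForm (0 : TForm M T k) :=
  smoothForm_iff.2 fun _ _ => tsmooth_zero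

theorem SmoothForm.add {k : ℕ} {w w' : TForm M T k} (h : SmoothForm w) (h' : SmoothForm w') :
    SmoothForm (w + w') :=
  smoothForm_iff.2 fun x₀ r => (smoothForm_iff.1 h x₀ r).add (smoothForm_iff.1 h' x₀ r)

theorem SmoothForm.neg {k : ℕ} {w : TForm M T k} (h : SmoothForm w) : SmoothForm (-w) :=
  smoothForm_iff.2 fun x₀ r => (smoothForm_iff.1 h x₀ r).neg

theorem SmoothForm.sub {k : ℕ} {w w' : TForm M T k} (h : SmoothForm w) (h' : SmoothForm w') :
    SmoothForm (w - w') :=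
  smoothForm_iff.2 fun x₀ r => (smoothForm_iff.1 h x₀ r).sub (smoothForm_iff.1 h' x₀ r)

theorem SmoothForm.const_smul {k : ℕ} {w : TForm M T k} (h : SmoothForm w) (c : ℝ) :
    SmoothForm (c • w) :=
  smoothForm_iff.2 fun x₀ r => (smoothForm_iff.1 h x₀ r).const_smul c

theorem SmoothForm.smul {k : ℕ} {f : TFun M T} {w : TForm M T k} (hf : SmoothFun f)
    (h : SmoothForm w) : SmoothForm (TForm.smul f w) :=
  smoothForm_iff.2 fun x₀ r => tsmooth_congr
    ((smoothFun_iff.1 hf x₀).mul (smoothForm_iff.1 h x₀ r)) fun _ _ => ev_smul f w _ _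

theorem SmoothForm.wedge {a b k : ℕ} (h : a + b = k) {α : TForm M T a} {β : TForm M T b}
    (hα : SmoothForm α) (hβ : SmoothForm β) : SmoothForm (TForm.wedge h α β) :=
  smoothForm_iff.2 fun x₀ r => tsmooth_congr
    ((TSmooth.sum Finset.univ fun (σ : Equiv.Perm (Fin k)) _ =>
      ((smoothForm_iff.1 hα x₀ fun c => r (σ (Fin.cast h (Fin.castAdd b c)))).mul
        (smoothForm_iff.1 hβ x₀ fun c => r (σ (Fin.cast h (Fin.natAdd a c))))).const_smul
          ((Equiv.Perm.sign σ : ℤ) : ℝ)).const_smul ((a ! * b ! : ℕ) : ℝ)⁻¹)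
    fun _ _ => ev_wedge h α β _ _

theorem SmoothFun.ofFun {f : TFun M T} (h : SmoothFun f) :
    SmoothForm fun i => Form.ofFun (f i) :=
  smoothForm_iff.2 fun x₀ _ => smoothFun_iff.1 h x₀

theorem SmoothForm.toFun {w : TForm M T 0} (h : SmoothForm w) :
    SmoothFun fun i => Form.toFun (w i) :=
  smoothFun_iff.2 fun x₀ => tsmooth_congr (smoothForm_iff.1 h x₀ ![]) fun y _ => by
    rw [evF_toFun, coefT_eq]
    exact congrArg _ (Subsingleton.elim _ _)

theorem SmoothFun.inv {f : TFun M T} (h : SmoothFun f)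
    (hne : ∀ i, T.IsInstant i → ∀ x, f i x ≠ 0) : SmoothFun (TFun.inv f) :=
  smoothFun_iff.2 fun x₀ => (smoothFun_iff.1 h x₀).recip fun _ _ i hi => hne i hi _

/-- The logarithm of a time-dependent function. -/
def TFun.log (f : TFun M T) : TFun M T := fun i x => (Scalar.log T (evF f x)).val i

theorem SmoothFun.log {f : TFun M T} (h : SmoothFun f)
    (hpos : ∀ i, T.IsInstant i → ∀ x, 0 < f i x) : SmoothFun (TFun.log f) :=
  smoothFun_iff.2 fun x₀ => (smoothFun_iff.1 h x₀).log fun _ _ i hi => hpos i hi _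

theorem coefT_d {k : ℕ} {w : TForm M T k} (hw : SmoothForm w) {x₀ : M} {y : E3}
    (hy : y ∈ (extChartAt (𝓡 3) x₀).target) (r : Fin (k + 1) → Fin 3) :
    coefT (TForm.d w) x₀ r y = ∑ j : Fin (k + 1), (-1 : ℝ) ^ (j : ℕ) •
      pd (EuclideanSpace.basisFun (Fin 3) ℝ (r j)) (coefT w x₀ fun a => r (j.succAbove a)) y := by
  refine Scalar.ext (funext fun i => ?_)
  rw [Scalar.sum_val]
  exact coef_d (hw.slice i) hy r

theorem SmoothForm.d (hT : T.Good) {k : ℕ} {w : TForm M T k} (h : SmoothForm w) :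
    SmoothForm (TForm.d w) :=
  smoothForm_iff.2 fun x₀ r => tsmooth_congr
    (TSmooth.sum Finset.univ fun (j : Fin (k + 1)) _ => ((smoothForm_iff.1 h x₀ fun a => r (j.succAbove a)).pd hT
      (isOpen_extChartAt_target (I := 𝓡 3) x₀) _).const_smul ((-1 : ℝ) ^ (j : ℕ)))
    fun _ hy => coefT_d h hy r

theorem TForm.d_d {k : ℕ} {w : TForm M T k} (h : SmoothForm w) : TForm.d (TForm.d w) = 0 :=
  funext fun i => FluidHPT.d_d (h.slice i)

theorem TForm.d_add {k : ℕ} {w w' : TForm M T k} (h : SmoothForm w) (h' : SmoothForm w') :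
    TForm.d (w + w') = TForm.d w + TForm.d w' := by
  refine form_ext_coefT fun x r => ?_
  have hy := mem_extChartAt_target (I := 𝓡 3) x
  have hU := isOpen_extChartAt_target (I := 𝓡 3) x
  change _ = coefT (TForm.d w) x r _ + coefT (TForm.d w') x r _
  rw [coefT_d (h.add h') hy, coefT_d h hy, coefT_d h' hy, ← Finset.sum_add_distrib]
  refine Finset.sum_congr rfl fun j _ => ?_
  rw [← smul_add, ← pd_add hU (smoothForm_iff.1 h x _) (smoothForm_iff.1 h' x _) _ hy]
  rfl

/-- In coordinates this reduces to the commutation of each partial derivative with the time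
derivative, `pd_D`. -/
theorem TForm.d_ddt (hT : T.Good) {k : ℕ} {w : TForm M T k} (h : SmoothForm w) :
    TForm.d (TForm.ddt w) = TForm.ddt (TForm.d w) := by
  refine form_ext_coefT fun x r => ?_
  have hy := mem_extChartAt_target (I := 𝓡 3) x
  have hU := isOpen_extChartAt_target (I := 𝓡 3) x
  have hD : ∀ j : Fin (k + 1), T.Diff ((-1 : ℝ) ^ (j : ℕ) • pd (EuclideanSpace.basisFun (Fin 3) ℝ (r j))
      (coefT w x fun a => r (j.succAbove a)) (extChartAt (𝓡 3) x x)).val := fun j =>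
    (((smoothForm_iff.1 h x fun a => r (j.succAbove a)).pd hT hU _).const_smul _).diff hy
  rw [coefT_ddt hT (h.d hT), coefT_d (h.ddt hT) hy, coefT_d h hy]
  have h2 : (∑ j : Fin (k + 1), (-1 : ℝ) ^ (j : ℕ) • pd (EuclideanSpace.basisFun (Fin 3) ℝ (r j))
      (coefT w x fun a => r (j.succAbove a)) (extChartAt (𝓡 3) x x)).D =
      ∑ j : Fin (k + 1), ((-1 : ℝ) ^ (j : ℕ) • pd (EuclideanSpace.basisFun (Fin 3) ℝ (r j))
      (coefT w x fun a => r (j.succAbove a)) (extChartAt (𝓡 3) x x)).D := by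
    refine Scalar.ext (funext fun i => ?_)
    rw [Scalar.sum_val]
    have h3 := congrFun (ddt_sum hT Finset.univ fun j _ => hD j) i
    rw [Finset.sum_apply] at h3
    refine Eq.trans ?_ h3
    refine congrFun (congrArg T.ddt (funext fun i => ?_)) i
    rw [Scalar.sum_val, Finset.sum_apply]
  rw [h2]
  refine Finset.sum_congr rfl fun j _ => ?_
  have h4 : ∀ (c : ℝ) (a : T.Scalar), T.Diff a.val → (c • a).D = c • a.D := fun c a ha =>
    Scalar.ext (funext fun i => ddt_map hT ha (c • ContinuousLinearMap.id ℝ ℝ) i)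
  rw [h4 _ _ (((smoothForm_iff.1 h x _).pd hT hU _).diff hy),
    ← pd_D hT hU (smoothForm_iff.1 h x _) _ hy]
  refine congrArg _ (pd_congr hU (fun y _ => ?_) _ hy)
  exact coefT_ddt hT h x _ y

/-- The Leibniz rule for a function times a form. Expansion of the wedge with a one-form along its
slots is a hypothesis, to be discharged by the explicit formulas in the degrees k = 0, 1, 2 that
occur. -/
theorem TForm.d_smul {k : ℕ} (hk : 1 + k = k + 1)
    (hwedge : ∀ (x : M) (α : TangentSpace (𝓡 3) x [⋀^Fin 1]→ₗ[ℝ] ℝ)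
      (β : TangentSpace (𝓡 3) x [⋀^Fin k]→ₗ[ℝ] ℝ) (v : Fin (k + 1) → TangentSpace (𝓡 3) x),
      FluidHPT.wedge hk α β v =
        ∑ j : Fin (k + 1), (-1 : ℝ) ^ (j : ℕ) * (α ![v j] * β fun a => v (j.succAbove a)))
    {f : TFun M T} {w : TForm M T k} (hf : SmoothFun f) (h : SmoothForm w) :
    TForm.d (TForm.smul f w) = TForm.smul f (TForm.d w) +
      TForm.wedge hk (TForm.d fun i => Form.ofFun (f i)) w := by
  refine form_ext_coefT fun x r => ?_
  have hy := mem_extChartAt_target (I := 𝓡 3) x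
  have hU := isOpen_extChartAt_target (I := 𝓡 3) x
  rw [coefT_eq (_ + _), ev_add, ev_smul, ev_wedge_of hk _ _ _ _ Finset.univ _ _ _ (hwedge _ · · _),
    ← coefT_eq, coefT_d (h.smul hf) hy, coefT_d h hy, Finset.mul_sum, ← Finset.sum_add_distrib]
  refine Finset.sum_congr rfl fun j _ => ?_
  have h1 : coefT (TForm.smul f w) x (fun a => r (j.succAbove a)) = fun y =>
      evF f ((extChartAt (𝓡 3) x).symm y) * coefT w x (fun a => r (j.succAbove a)) y :=
    funext fun y => ev_smul f w _ _
  rw [h1, pd_mul hU (smoothFun_iff.1 hf x) (smoothForm_iff.1 h x _) _ hy, smul_add, mul_smul_comm]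
  congr 3
  -- The partial derivatives of f are the coefficients of its differential; for a zero-form the sum
  -- has one term.
  have h2 := coefT_d hf.ofFun hy ![r j]
  rw [Finset.sum_eq_single 0 (fun b _ hb => absurd (Fin.ext (by omega)) hb) (by simp)] at h2
  rw [Fin.val_zero, pow_zero, one_smul] at h2
  refine h2.symm.trans ?_
  rw [coefT_eq]
  refine congrArg _ (funext fun a => ?_)
  rw [show a = 0 from Fin.ext (by omega)]
  rfl

end Manifold
end FluidHPT

namespace FluidHPT
open TimeModel

/-! ### The Hodge star, the codifferential and the musical isomorphisms -/

section Manifold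

variable {M : Type*} [TopologicalSpace M] [ChartedSpace E3 M] {T : TimeModel}

section Coordinates

variable [IsManifold (𝓡 3) ∞ M]

theorem coordBasis_repr (x₀ x : M)
    (hx : x ∈ (trivializationAt E3 (TangentSpace (𝓡 3)) x₀).baseSet) (v : TangentSpace (𝓡 3) x)
    (a : Fin 3) : (coordBasis x₀ x hx).repr v a =
      (trivializationAt E3 (TangentSpace (𝓡 3)) x₀).continuousLinearMapAt ℝ x v a := by
  conv_lhs => rw [eq_sum_coordVec x₀ x hx v]
  simp only [← coordBasis_apply x₀ x hx]
  rw [Module.Basis.repr_sum_self]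

/-- The common mechanism for the star in all degrees: a fibrewise linear operator whose matrix in
every chart is smooth and time-independent preserves smoothness. -/
theorem SmoothForm.of_comb {k k' : ℕ} {w : TForm M T k} {w' : TForm M T k'} (hw : SmoothForm w)
    {ι : Type} (s : Finset ι)
    (c : M → (Fin k' → Fin 3) → ι → E3 → ℝ) (p : (Fin k' → Fin 3) → ι → Fin k → Fin 3)
    (hc : ∀ x₀ r, ∀ j ∈ s, ContDiffOn ℝ ∞ (c x₀ r j) (extChartAt (𝓡 3) x₀).target)
    (h : ∀ x₀ r, ∀ y ∈ (extChartAt (𝓡 3) x₀).target, ∀ i, coef (w' i) x₀ r y =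
      ∑ j ∈ s, c x₀ r j y * coef (w i) x₀ (p r j) y) : SmoothForm w' :=
  smoothForm_iff.2 fun x₀ r => tsmooth_congr
    (TSmooth.sum s fun j hj => (smoothForm_iff.1 hw x₀ (p r j)).smulFun (hc x₀ r j hj))
    fun y hy => Scalar.ext (funext fun i => by
      rw [Scalar.sum_val]
      exact h x₀ r y hy i)

theorem coef_eq_coordBasis {k : ℕ} (w : Form M k) {x₀ : M} {y : E3}
    (hy : y ∈ (extChartAt (𝓡 3) x₀).target) (r : Fin k → Fin 3) : coef w x₀ r y =
      w ((extChartAt (𝓡 3) x₀).symm y) fun a => coordBasis x₀ ((extChartAt (𝓡 3) x₀).symm y)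
        (symm_mem_baseSet hy) (r a) := by
  simp only [coordBasis_apply]
  rfl

theorem TForm.ext_zero {M : Type*} [TopologicalSpace M] [ChartedSpace E3 M] {w w' : TForm M T 0}
    (h : ∀ x, ev w x ![] = ev w' x ![]) : w = w' :=
  funext fun i => funext fun x => zero_form_ext (congrFun (congrArg Scalar.val (h x)) i)

end Coordinates

variable [RiemannianBundle (fun x : M => TangentSpace (𝓡 3) x)]
  (o : (x : M) → Orientation ℝ (TangentSpace (𝓡 3) x) (Fin 3))

theorem TForm.ext_one {w w' : TForm M T 1}
    (h : ∀ x a, ev w x ![frame (o x) a] = ev w' x ![frame (o x) a]) : w = w' :=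
  funext fun i => funext fun x => one_form_ext (frame (o x)).toBasis fun a => by
    rw [OrthonormalBasis.coe_toBasis]
    exact congrFun (congrArg Scalar.val (h x a)) i

theorem TForm.ext_two {w w' : TForm M T 2}
    (h0 : ∀ x, ev w x ![frame (o x) 1, frame (o x) 2] = ev w' x ![frame (o x) 1, frame (o x) 2])
    (h1 : ∀ x, ev w x ![frame (o x) 2, frame (o x) 0] = ev w' x ![frame (o x) 2, frame (o x) 0])
    (h2 : ∀ x, ev w x ![frame (o x) 0, frame (o x) 1] = ev w' x ![frame (o x) 0, frame (o x) 1]) :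
    w = w' := by
  funext i x
  refine two_form_ext (frame (o x)).toBasis ?_ ?_ ?_ <;> rw [OrthonormalBasis.coe_toBasis]
  · exact congrFun (congrArg Scalar.val (h0 x)) i
  · exact congrFun (congrArg Scalar.val (h1 x)) i
  · exact congrFun (congrArg Scalar.val (h2 x)) i

theorem TForm.ext_three {w w' : TForm M T 3}
    (h : ∀ x, ev w x ![frame (o x) 0, frame (o x) 1, frame (o x) 2] =
      ev w' x ![frame (o x) 0, frame (o x) 1, frame (o x) 2]) : w = w' := by
  funext i x
  refine three_form_ext (frame (o x)).toBasis ?_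
  rw [OrthonormalBasis.coe_toBasis]
  exact congrFun (congrArg Scalar.val (h x)) i

theorem ev_hodge_one (h : 1 + 2 = 3) (w : TForm M T 1) (x : M) :
    ev (TForm.hodge o h w) x ![frame (o x) 1, frame (o x) 2] = ev w x ![frame (o x) 0] ∧
    ev (TForm.hodge o h w) x ![frame (o x) 2, frame (o x) 0] = ev w x ![frame (o x) 1] ∧
    ev (TForm.hodge o h w) x ![frame (o x) 0, frame (o x) 1] = ev w x ![frame (o x) 2] :=
  ⟨Scalar.ext (funext fun i => (hodge_one_two_frame (o x) h (w i x)).1),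
    Scalar.ext (funext fun i => (hodge_one_two_frame (o x) h (w i x)).2.1),
    Scalar.ext (funext fun i => (hodge_one_two_frame (o x) h (w i x)).2.2)⟩

theorem ev_hodge_two (h : 2 + 1 = 3) (w : TForm M T 2) (x : M) :
    ev (TForm.hodge o h w) x ![frame (o x) 0] = ev w x ![frame (o x) 1, frame (o x) 2] ∧
    ev (TForm.hodge o h w) x ![frame (o x) 1] = ev w x ![frame (o x) 2, frame (o x) 0] ∧
    ev (TForm.hodge o h w) x ![frame (o x) 2] = ev w x ![frame (o x) 0, frame (o x) 1] :=
  ⟨Scalar.ext (funext fun i => (hodge_two_one_frame (o x) h (w i x)).1),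
    Scalar.ext (funext fun i => (hodge_two_one_frame (o x) h (w i x)).2.1),
    Scalar.ext (funext fun i => (hodge_two_one_frame (o x) h (w i x)).2.2)⟩

theorem ev_hodge_three (h : 3 + 0 = 3) (w : TForm M T 3) (x : M) :
    ev (TForm.hodge o h w) x ![] = ev w x ![frame (o x) 0, frame (o x) 1, frame (o x) 2] :=
  Scalar.ext (funext fun i => hodge_three_zero_frame (o x) h (w i x))

theorem TForm.hodge_hodge_zero (h : 0 + 3 = 3) (h' : 3 + 0 = 3) (w : TForm M T 0) :
    TForm.hodge o h' (TForm.hodge o h w) = w :=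
  funext fun i => funext fun x => FluidHPT.hodge_hodge_zero (o x) h h' (w i x)

theorem TForm.hodge_hodge_one (h : 1 + 2 = 3) (h' : 2 + 1 = 3) (w : TForm M T 1) :
    TForm.hodge o h' (TForm.hodge o h w) = w :=
  funext fun i => funext fun x => FluidHPT.hodge_hodge_one (o x) h h' (w i x)

theorem TForm.hodge_hodge_two (h : 2 + 1 = 3) (h' : 1 + 2 = 3) (w : TForm M T 2) :
    TForm.hodge o h' (TForm.hodge o h w) = w :=
  funext fun i => funext fun x => FluidHPT.hodge_hodge_two (o x) h h' (w i x)

theorem TForm.hodge_hodge_three (h : 3 + 0 = 3) (h' : 0 + 3 = 3) (w : TForm M T 3) :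
    TForm.hodge o h' (TForm.hodge o h w) = w :=
  funext fun i => funext fun x => FluidHPT.hodge_hodge_three (o x) h h' (w i x)

theorem TForm.hodge_neg {k j : ℕ} (h : k + j = 3) (w : TForm M T k) :
    TForm.hodge o h (-w) = -TForm.hodge o h w :=
  funext fun i => funext fun x => map_neg (hodgeLin (o x) h) (w i x)

theorem TForm.hodge_zero {k j : ℕ} (h : k + j = 3) :
    TForm.hodge o h (0 : TForm M T k) = 0 :=
  funext fun _ => funext fun x => map_zero (hodgeLin (o x) h)

theorem TForm.hodge_add {k j : ℕ} (h : k + j = 3) (w w' : TForm M T k) :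
    TForm.hodge o h (w + w') = TForm.hodge o h w + TForm.hodge o h w' :=
  funext fun i => funext fun x => map_add (hodgeLin (o x) h) (w i x) (w' i x)

theorem TForm.hodge_smul {k j : ℕ} (h : k + j = 3) (f : TFun M T) (w : TForm M T k) :
    TForm.hodge o h (TForm.smul f w) = TForm.smul f (TForm.hodge o h w) := by
  funext i x
  refine (map_conv T (hodgeLin (o x) h).toAddMonoidHom _ (fun j => f j x) (fun j => w j x) i).trans ?_
  have h1 : (fun (a : ℝ) (β : TangentSpace (𝓡 3) x [⋀^Fin k]→ₗ[ℝ] ℝ) =>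
      (hodgeLin (o x) h).toAddMonoidHom (a • β)) = fun a β => a • FluidHPT.hodge (o x) h β :=
    funext fun a => funext fun β => map_smul (hodgeLin (o x) h) a β
  rw [h1]
  cases T <;> rfl

variable [IsManifold (𝓡 3) ∞ M]

/-- The sign (−1)^{3i+1} is +, −, + for i = 1, 2, 3; this and the next two lemmas fix it once and
for all. -/
theorem TForm.codiff_one (w : TForm M T 1) : TForm.codiff o (k := 0) w =
    TForm.hodge o (rfl : 3 + 0 = 3) (TForm.d (TForm.hodge o (rfl : 1 + 2 = 3) w)) := by
  funext i
  change FluidHPT.codiff o (k := 0) (w i) = _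
  unfold FluidHPT.codiff
  rw [dif_pos (by norm_num)]
  norm_num
  rfl

theorem TForm.codiff_two (w : TForm M T 2) : TForm.codiff o (k := 1) w =
    -TForm.hodge o (rfl : 2 + 1 = 3) (TForm.d (TForm.hodge o (rfl : 2 + 1 = 3) w)) := by
  funext i
  change FluidHPT.codiff o (k := 1) (w i) = _
  unfold FluidHPT.codiff
  rw [dif_pos (by norm_num)]
  norm_num
  exact neg_one_smul ℝ (Form.hodge o (rfl : 2 + 1 = 3)
    (FluidHPT.d (Form.hodge o (rfl : 2 + 1 = 3) (w i))))

theorem TForm.codiff_three (w : TForm M T 3) : TForm.codiff o (k := 2) w =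
    TForm.hodge o (rfl : 1 + 2 = 3) (TForm.d (TForm.hodge o (rfl : 3 + 0 = 3) w)) := by
  funext i
  change FluidHPT.codiff o (k := 2) (w i) = _
  unfold FluidHPT.codiff
  rw [dif_pos (by norm_num)]
  norm_num
  rfl

theorem TForm.codiff_of_three_le {k : ℕ} (hk : 3 ≤ k) (w : TForm M T (k + 1)) :
    TForm.codiff o w = 0 := by
  funext i
  exact dif_neg (by omega)

section Smooth

/-- The Gram matrix of the coordinate vectors. -/
def metricMat (x₀ : M) (y : E3) : Matrix (Fin 3) (Fin 3) ℝ :=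
  Matrix.of fun a c => metricCoef x₀ a c ((extChartAt (𝓡 3) x₀).symm y)

theorem gram_coordBasis {x₀ : M} {y : E3} (hy : y ∈ (extChartAt (𝓡 3) x₀).target) :
    gram (coordBasis x₀ ((extChartAt (𝓡 3) x₀).symm y) (symm_mem_baseSet hy)) = metricMat x₀ y := by
  ext a c
  rw [gram, Matrix.of_apply, coordBasis_apply, coordBasis_apply]
  rfl

theorem volCoef_coordBasis {x₀ : M} {y : E3} (hy : y ∈ (extChartAt (𝓡 3) x₀).target) :
    (o ((extChartAt (𝓡 3) x₀).symm y)).volumeForm (coordBasis x₀ ((extChartAt (𝓡 3) x₀).symm y)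
      (symm_mem_baseSet hy)) = volCoef o x₀ ((extChartAt (𝓡 3) x₀).symm y) := by
  rw [coordBasis_coe]
  rfl

variable [IsContMDiffRiemannianBundle (𝓡 3) ∞ E3 (fun x : M => TangentSpace (𝓡 3) x)]

theorem contDiffOn_metricMat_inv (x₀ : M) (a c : Fin 3) :
    ContDiffOn ℝ ∞ (fun y => (metricMat x₀ y).det⁻¹ * (metricMat x₀ y).adjugate a c)
      (extChartAt (𝓡 3) x₀).target := by
  have hG : ∀ a c, ContDiffOn ℝ ∞ (fun y => metricMat x₀ y a c) (extChartAt (𝓡 3) x₀).target :=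
    contDiffOn_metricCoef x₀
  refine ((contDiffOn_det hG).inv fun y hy => ?_).mul (contDiffOn_adjugate hG a c)
  -- An auxiliary orientation of one tangent space, chosen only to see that the Gram determinant is
  -- a nonzero square.
  let o : Orientation ℝ (TangentSpace (𝓡 3) ((extChartAt (𝓡 3) x₀).symm y)) (Fin 3) :=
    (coordBasis x₀ ((extChartAt (𝓡 3) x₀).symm y) (symm_mem_baseSet hy)).orientation
  rw [← gram_coordBasis hy, gram, ← volumeForm_sq o]
  exact pow_ne_zero 2 (volumeForm_basis_ne_zero o _)

variable {o}

theorem SmoothForm.hodge_zero (ho : IsOrientation o) (h : 0 + 3 = 3) {w : TForm M T 0} (hw : SmoothForm w) :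
    SmoothForm (TForm.hodge o h w) := by
  refine hw.of_comb (Finset.univ : Finset Unit)
    (fun x₀ r _ y => volCoef o x₀ ((extChartAt (𝓡 3) x₀).symm y) *
      Matrix.det (Matrix.of fun l m => if l = r m then (1 : ℝ) else 0)) (fun _ _ => ![])
    (fun x₀ r _ _ => (contDiffOn_volCoef o ho x₀).mul contDiffOn_const) fun x₀ r y hy i => ?_
  rw [Finset.univ_unique, Finset.sum_singleton, coef_eq_coordBasis _ hy, coef_eq_coordBasis _ hy, TForm.hodge,
    Form.hodge, hodge_zero_three, volumeForm_basis_comp, volCoef_coordBasis o hy, mul_comm]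
  exact congrArg _ (congrArg _ (Subsingleton.elim _ _))

theorem SmoothForm.hodge_three (ho : IsOrientation o) (h : 3 + 0 = 3) {w : TForm M T 3} (hw : SmoothForm w) :
    SmoothForm (TForm.hodge o h w) := by
  refine hw.of_comb (Finset.univ : Finset Unit)
    (fun x₀ r _ y => (volCoef o x₀ ((extChartAt (𝓡 3) x₀).symm y))⁻¹) (fun _ _ => id)
    (fun x₀ r _ _ => (contDiffOn_volCoef o ho x₀).inv fun y hy =>
      volCoef_ne_zero o (symm_mem_baseSet hy)) fun x₀ r y hy i => ?_
  rw [Finset.univ_unique, Finset.sum_singleton, coef_eq_coordBasis _ hy, coef_eq_coordBasis _ hy, TForm.hodge,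
    Form.hodge, ← volCoef_coordBasis o hy]
  refine Eq.trans (congrArg _ (Subsingleton.elim _ _)) (hodge_three_zero_basis _ _ h _)

theorem SmoothForm.hodge_two (ho : IsOrientation o) (h : 2 + 1 = 3) {w : TForm M T 2} (hw : SmoothForm w) :
    SmoothForm (TForm.hodge o h w) := by
  refine hw.of_comb (Finset.univ : Finset (Fin 3))
    (fun x₀ r j y => (volCoef o x₀ ((extChartAt (𝓡 3) x₀).symm y))⁻¹ * metricMat x₀ y j (r 0))
    (fun r j => ![![1, 2], ![2, 0], ![0, 1]] j)
    (fun x₀ r j _ => ((contDiffOn_volCoef o ho x₀).inv fun y hy =>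
      volCoef_ne_zero o (symm_mem_baseSet hy)).mul (contDiffOn_metricCoef x₀ j (r 0)))
      fun x₀ r y hy i => ?_
  simp only [coef_eq_coordBasis _ hy, ← volCoef_coordBasis o hy, ← gram_coordBasis hy]
  have h1 := hodge_two_one_basis (o _) (coordBasis x₀ ((extChartAt (𝓡 3) x₀).symm y)
    (symm_mem_baseSet hy)) h (w i _) (r 0)
  rw [fin_one_eta fun a : Fin 1 => (coordBasis x₀ ((extChartAt (𝓡 3) x₀).symm y)
    (symm_mem_baseSet hy)) (r a)]
  refine h1.trans ?_
  rw [Fin.sum_univ_three]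
  simp only [gram, Matrix.of_apply]
  rw [fin_two_eta fun a => (coordBasis x₀ ((extChartAt (𝓡 3) x₀).symm y) (symm_mem_baseSet hy))
      ((![![1, 2], ![2, 0], ![0, 1]] : Fin 3 → Fin 2 → Fin 3) 0 a),
    fin_two_eta fun a => (coordBasis x₀ ((extChartAt (𝓡 3) x₀).symm y) (symm_mem_baseSet hy))
      ((![![1, 2], ![2, 0], ![0, 1]] : Fin 3 → Fin 2 → Fin 3) 1 a),
    fin_two_eta fun a => (coordBasis x₀ ((extChartAt (𝓡 3) x₀).symm y) (symm_mem_baseSet hy))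
      ((![![1, 2], ![2, 0], ![0, 1]] : Fin 3 → Fin 2 → Fin 3) 2 a)]
  simp only [Matrix.cons_val_zero, Matrix.cons_val_one, Matrix.cons_val]
  ring

theorem SmoothForm.hodge_one (ho : IsOrientation o) (h : 1 + 2 = 3) {w : TForm M T 1} (hw : SmoothForm w) :
    SmoothForm (TForm.hodge o h w) := by
  refine hw.of_comb (Finset.univ : Finset (Fin 3 × Fin 3))
    (fun x₀ r j y => ((metricMat x₀ y).det⁻¹ * (metricMat x₀ y).adjugate j.1 j.2) *
      (volCoef o x₀ ((extChartAt (𝓡 3) x₀).symm y) * Matrix.det (Matrix.of fun l m =>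
        if l = (![j.1, r 0, r 1] : Fin 3 → Fin 3) m then (1 : ℝ) else 0)))
    (fun r j => ![j.2])
    (fun x₀ r j _ => (contDiffOn_metricMat_inv x₀ j.1 j.2).mul
      ((contDiffOn_volCoef o ho x₀).mul contDiffOn_const)) fun x₀ r y hy i => ?_
  simp only [coef_eq_coordBasis _ hy, ← volCoef_coordBasis o hy, ← gram_coordBasis hy,
    ← volumeForm_basis_vec]
  set b := coordBasis x₀ ((extChartAt (𝓡 3) x₀).symm y) (symm_mem_baseSet hy)
  rw [fin_two_eta fun a : Fin 2 => b (r a)]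
  refine (hodge_one_two_sharp _ h _ _ _).trans ?_
  conv_lhs => rw [← b.sum_repr (sharp _ (w i _))]
  rw [volumeForm_sum_left, Fintype.sum_prod_type]
  refine Finset.sum_congr rfl fun a _ => ?_
  rw [repr_sharp, Finset.mul_sum, Finset.sum_mul]
  refine Finset.sum_congr rfl fun c _ => ?_
  rw [fin_one_eta fun a : Fin 1 => b (![c] a), Matrix.cons_val_zero]
  ring

theorem SmoothForm.sharp {w : TForm M T 1} (hw : SmoothForm w) : SmoothVec (TForm.sharp o w) := by
  refine smoothVec_iff.2 fun x₀ a => tsmooth_congr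
    (TSmooth.sum Finset.univ fun (c : Fin 3) _ => (smoothForm_iff.1 hw x₀ ![c]).smulFun
      (contDiffOn_metricMat_inv x₀ a c)) fun y hy => Scalar.ext (funext fun i => ?_)
  rw [Scalar.sum_val]
  have h1 := repr_sharp (o _) (coordBasis x₀ ((extChartAt (𝓡 3) x₀).symm y)
    (symm_mem_baseSet hy)) (w i _) a
  rw [coordBasis_repr, gram_coordBasis hy, Finset.mul_sum] at h1
  refine h1.trans (Finset.sum_congr rfl fun c _ => ?_)
  rw [← mul_assoc]
  refine congrArg _ ?_
  refine Eq.trans ?_ (coef_eq_coordBasis (w i) hy ![c]).symm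
  rw [fin_one_eta fun a : Fin 1 => (coordBasis x₀ ((extChartAt (𝓡 3) x₀).symm y)
    (symm_mem_baseSet hy)) (![c] a), Matrix.cons_val_zero]

theorem SmoothVec.flat {u : TVec M T} (hu : SmoothVec u) : SmoothForm (TVec.flat u) := by
  refine smoothForm_iff.2 fun x₀ r => tsmooth_congr
    (TSmooth.sum Finset.univ fun (a : Fin 3) _ => (smoothVec_iff.1 hu x₀ a).smulFun
      (contDiffOn_metricCoef x₀ a (r 0))) fun y hy => Scalar.ext (funext fun i => ?_)
  rw [Scalar.sum_val]
  refine (coef_eq (TVec.flat u i) x₀ r y).trans ?_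
  rw [fin_one_eta fun a : Fin 1 => coordVec x₀ ((extChartAt (𝓡 3) x₀).symm y) (r a)]
  refine (flat_apply _ _).trans ?_
  conv_lhs => rw [eq_sum_coordVec x₀ _ (symm_mem_baseSet hy) (u i _)]
  rw [sum_inner]
  refine Finset.sum_congr rfl fun a _ => ?_
  rw [inner_smul_left]
  exact mul_comm _ _

end Smooth
end Manifold
end FluidHPT

namespace FluidHPT
open TimeModel

/-! ### Powers and exponentials of elements of degree zero -/

section Manifold

variable {M : Type*} [TopologicalSpace M] [ChartedSpace E3 M] {T : TimeModel}

/-- The exterior product as a form of degree `k`, which is zero unless `k` is the sum of the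
degrees. -/
def wedgeD {a b : ℕ} (k : ℕ) (α : TForm M T a) (β : TForm M T b) : TForm M T k :=
  if h : a + b = k then TForm.wedge h α β else 0

theorem TForm.zero_wedge {a b k : ℕ} (h : a + b = k) (β : TForm M T b) :
    TForm.wedge h (0 : TForm M T a) β = 0 := by
  refine ev_ext fun x v => ?_
  rw [ev_wedge]
  simp [ev_zero]

theorem TForm.wedge_zero {a b k : ℕ} (h : a + b = k) (α : TForm M T a) :
    TForm.wedge h α (0 : TForm M T b) = 0 := by
  refine ev_ext fun x v => ?_
  rw [ev_wedge]
  simp [ev_zero]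

theorem zero_wedgeD {a b k : ℕ} (β : TForm M T b) : wedgeD k (0 : TForm M T a) β = 0 := by
  unfold wedgeD
  split_ifs
  · exact TForm.zero_wedge _ _
  · rfl

theorem wedgeD_zero {a b k : ℕ} (α : TForm M T a) : wedgeD k α (0 : TForm M T b) = 0 := by
  unfold wedgeD
  split_ifs
  · exact TForm.wedge_zero _ _
  · rfl

theorem wedgeD_eq {a b k : ℕ} (h : a + b = k) (α : TForm M T a) (β : TForm M T b) :
    wedgeD k α β = TForm.wedge h α β := dif_pos h

namespace Coll

/-- Elements of degree zero. -/
def DegreeZero (𝒳 : Coll M T) : Prop := ∀ m k, k ≠ m.deg → 𝒳 m k = 0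

/-- Trades the sum over degree splittings carrying a proof for a plain one, so that concrete
coefficients can be computed by simplification. -/
theorem mul_eq (𝒳 𝒴 : Coll M T) (m : Mono) (k : ℕ) : mul 𝒳 𝒴 m k =
    ∑ c₁ : Fin 2, ∑ c₂ : Fin 2, ∑ a₁ : Fin 2, ∑ a₂ : Fin 2,
    ∑ b ∈ Finset.HasAntidiagonal.antidiagonal m.dep, ∑ q ∈ Finset.HasAntidiagonal.antidiagonal k,
      if (c₁ : ℕ) + c₂ = m.dt ∧ (a₁ : ℕ) + a₂ = m.ep then
        (-1 : ℝ) ^ (Mono.deg ⟨c₁, a₁, b.1⟩ * q.2 + a₁ * c₂) •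
          wedgeD k (𝒳 ⟨c₁, a₁, b.1⟩ q.1) (𝒴 ⟨c₂, a₂, b.2⟩ q.2)
      else 0 := by
  refine Finset.sum_congr rfl fun c₁ _ => Finset.sum_congr rfl fun c₂ _ =>
    Finset.sum_congr rfl fun a₁ _ => Finset.sum_congr rfl fun a₂ _ =>
    Finset.sum_congr rfl fun b _ => ?_
  rw [← Finset.sum_attach (Finset.HasAntidiagonal.antidiagonal k)]
  refine Finset.sum_congr rfl fun q _ => ?_
  rw [wedgeD_eq (Finset.HasAntidiagonal.mem_antidiagonal.1 q.2)]

variable {𝒳 𝒴 : Coll M T}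

theorem DegreeZero.mul (h𝒳 : 𝒳.DegreeZero) (h𝒴 : 𝒴.DegreeZero) : (mul 𝒳 𝒴).DegreeZero := by
  intro m k hk
  rw [mul_eq]
  refine Finset.sum_eq_zero fun c₁ _ => Finset.sum_eq_zero fun c₂ _ =>
    Finset.sum_eq_zero fun a₁ _ => Finset.sum_eq_zero fun a₂ _ =>
    Finset.sum_eq_zero fun b hb => Finset.sum_eq_zero fun q hq => ?_
  rw [Finset.HasAntidiagonal.mem_antidiagonal] at hb hq
  split_ifs with hc
  · have hd : m.deg = Mono.deg ⟨c₁, a₁, b.1⟩ + Mono.deg ⟨c₂, a₂, b.2⟩ := by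
      simp only [Mono.deg]
      omega
    by_cases h1 : q.1 = Mono.deg ⟨c₁, a₁, b.1⟩
    · rw [h𝒴 ⟨c₂, a₂, b.2⟩ q.2 (by omega), wedgeD_zero, smul_zero]
    · rw [h𝒳 _ _ h1, zero_wedgeD, smul_zero]
  · rfl

theorem DegreeZero.one : (one : Coll M T).DegreeZero := by
  intro m k hk
  funext i x
  refine dif_neg fun h => hk ?_
  rw [h.2, Mono.deg, h.1.1, h.1.2.1, h.1.2.2]
  rfl

theorem DegreeZero.pow (h : 𝒳.DegreeZero) (n : ℕ) : (pow 𝒳 n).DegreeZero := by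
  induction n with
  | zero => exact DegreeZero.one
  | succ n ih => exact h.mul ih

theorem mul_unit (𝒳 𝒴 : Coll M T) : mul 𝒳 𝒴 ⟨0, 0, 0⟩ 0 =
    TForm.wedge rfl (𝒳 ⟨0, 0, 0⟩ 0) (𝒴 ⟨0, 0, 0⟩ 0) := by
  rw [mul_eq]
  simp [Fin.sum_univ_two, wedgeD_eq (rfl : 0 + 0 = 0), Mono.deg]

theorem mul_dt (h𝒳 : 𝒳.DegreeZero) (h𝒴 : 𝒴.DegreeZero) : mul 𝒳 𝒴 ⟨1, 0, 0⟩ 1 =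
    TForm.wedge rfl (𝒳 ⟨0, 0, 0⟩ 0) (𝒴 ⟨1, 0, 0⟩ 1) +
      TForm.wedge rfl (𝒳 ⟨1, 0, 0⟩ 1) (𝒴 ⟨0, 0, 0⟩ 0) := by
  rw [mul_eq]
  simp [Fin.sum_univ_two, Finset.Nat.antidiagonal_succ, wedgeD_eq, Mono.deg,
    h𝒳 ⟨0, 0, 0⟩ 1 (by decide), h𝒴 ⟨0, 0, 0⟩ 1 (by decide), TForm.zero_wedge,
    TForm.wedge_zero]

theorem mul_ep (h𝒳 : 𝒳.DegreeZero) (h𝒴 : 𝒴.DegreeZero) : mul 𝒳 𝒴 ⟨0, 1, 0⟩ 1 =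
    TForm.wedge rfl (𝒳 ⟨0, 0, 0⟩ 0) (𝒴 ⟨0, 1, 0⟩ 1) +
      TForm.wedge rfl (𝒳 ⟨0, 1, 0⟩ 1) (𝒴 ⟨0, 0, 0⟩ 0) := by
  rw [mul_eq]
  simp [Fin.sum_univ_two, Finset.Nat.antidiagonal_succ, wedgeD_eq, Mono.deg,
    h𝒳 ⟨0, 0, 0⟩ 1 (by decide), h𝒴 ⟨0, 0, 0⟩ 1 (by decide), TForm.zero_wedge,
    TForm.wedge_zero]

theorem mul_dep (h𝒳 : 𝒳.DegreeZero) (h𝒴 : 𝒴.DegreeZero) : mul 𝒳 𝒴 ⟨0, 0, 1⟩ 2 =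
    TForm.wedge rfl (𝒳 ⟨0, 0, 0⟩ 0) (𝒴 ⟨0, 0, 1⟩ 2) +
      TForm.wedge rfl (𝒳 ⟨0, 0, 1⟩ 2) (𝒴 ⟨0, 0, 0⟩ 0) := by
  rw [mul_eq]
  simp [Fin.sum_univ_two, Finset.Nat.antidiagonal_succ, wedgeD_eq, Mono.deg,
    h𝒳 ⟨0, 0, 0⟩ 1 (by decide), h𝒴 ⟨0, 0, 0⟩ 1 (by decide),
    h𝒳 ⟨0, 0, 0⟩ 2 (by decide), h𝒴 ⟨0, 0, 0⟩ 2 (by decide), TForm.zero_wedge,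
    TForm.wedge_zero]

/-- Moving `dt` past the one-form coefficient of `ε` costs a minus sign. In the opposite order the
same sign is cancelled by `ε dt = -dt ε`. -/
theorem mul_dt_ep (h𝒳 : 𝒳.DegreeZero) (h𝒴 : 𝒴.DegreeZero) : mul 𝒳 𝒴 ⟨1, 1, 0⟩ 2 =
    TForm.wedge rfl (𝒳 ⟨0, 0, 0⟩ 0) (𝒴 ⟨1, 1, 0⟩ 2) +
      TForm.wedge rfl (𝒳 ⟨1, 1, 0⟩ 2) (𝒴 ⟨0, 0, 0⟩ 0) -
      TForm.wedge rfl (𝒳 ⟨1, 0, 0⟩ 1) (𝒴 ⟨0, 1, 0⟩ 1) +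
      TForm.wedge rfl (𝒳 ⟨0, 1, 0⟩ 1) (𝒴 ⟨1, 0, 0⟩ 1) := by
  rw [mul_eq]
  simp [Fin.sum_univ_two, Finset.Nat.antidiagonal_succ, wedgeD_eq, Mono.deg,
    h𝒳 ⟨0, 0, 0⟩ 1 (by decide), h𝒴 ⟨0, 0, 0⟩ 1 (by decide),
    h𝒳 ⟨0, 0, 0⟩ 2 (by decide), h𝒴 ⟨0, 0, 0⟩ 2 (by decide),
    h𝒳 ⟨1, 0, 0⟩ 0 (by decide), h𝒴 ⟨1, 0, 0⟩ 0 (by decide),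
    h𝒳 ⟨0, 1, 0⟩ 0 (by decide), h𝒴 ⟨0, 1, 0⟩ 0 (by decide), TForm.zero_wedge,
    TForm.wedge_zero]
  have h1 : ∀ w : TForm M T 2, (-1 : ℝ) • w = -w := fun w => neg_one_smul ℝ w
  rw [h1]
  abel

theorem mul_dt_dep (h𝒳 : 𝒳.DegreeZero) (h𝒴 : 𝒴.DegreeZero) : mul 𝒳 𝒴 ⟨1, 0, 1⟩ 3 =
    TForm.wedge rfl (𝒳 ⟨0, 0, 0⟩ 0) (𝒴 ⟨1, 0, 1⟩ 3) +
      TForm.wedge rfl (𝒳 ⟨1, 0, 1⟩ 3) (𝒴 ⟨0, 0, 0⟩ 0) +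
      TForm.wedge rfl (𝒳 ⟨1, 0, 0⟩ 1) (𝒴 ⟨0, 0, 1⟩ 2) +
      TForm.wedge rfl (𝒳 ⟨0, 0, 1⟩ 2) (𝒴 ⟨1, 0, 0⟩ 1) := by
  rw [mul_eq]
  simp [Fin.sum_univ_two, Finset.Nat.antidiagonal_succ, wedgeD_eq, Mono.deg,
    h𝒳 ⟨0, 0, 0⟩ 1 (by decide), h𝒴 ⟨0, 0, 0⟩ 1 (by decide),
    h𝒳 ⟨0, 0, 0⟩ 2 (by decide), h𝒴 ⟨0, 0, 0⟩ 2 (by decide),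
    h𝒳 ⟨0, 0, 0⟩ 3 (by decide), h𝒴 ⟨0, 0, 0⟩ 3 (by decide),
    h𝒳 ⟨1, 0, 0⟩ 0 (by decide), h𝒴 ⟨1, 0, 0⟩ 0 (by decide),
    h𝒳 ⟨1, 0, 0⟩ 2 (by decide), h𝒴 ⟨1, 0, 0⟩ 2 (by decide),
    h𝒳 ⟨1, 0, 0⟩ 3 (by decide), h𝒴 ⟨1, 0, 0⟩ 3 (by decide), TForm.zero_wedge,
    TForm.wedge_zero]
  abel

theorem mul_ep_dep (h𝒳 : 𝒳.DegreeZero) (h𝒴 : 𝒴.DegreeZero) : mul 𝒳 𝒴 ⟨0, 1, 1⟩ 3 =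
    TForm.wedge rfl (𝒳 ⟨0, 0, 0⟩ 0) (𝒴 ⟨0, 1, 1⟩ 3) +
      TForm.wedge rfl (𝒳 ⟨0, 1, 1⟩ 3) (𝒴 ⟨0, 0, 0⟩ 0) +
      TForm.wedge rfl (𝒳 ⟨0, 1, 0⟩ 1) (𝒴 ⟨0, 0, 1⟩ 2) +
      TForm.wedge rfl (𝒳 ⟨0, 0, 1⟩ 2) (𝒴 ⟨0, 1, 0⟩ 1) := by
  rw [mul_eq]
  simp [Fin.sum_univ_two, Finset.Nat.antidiagonal_succ, wedgeD_eq, Mono.deg,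
    h𝒳 ⟨0, 0, 0⟩ 1 (by decide), h𝒴 ⟨0, 0, 0⟩ 1 (by decide),
    h𝒳 ⟨0, 0, 0⟩ 2 (by decide), h𝒴 ⟨0, 0, 0⟩ 2 (by decide),
    h𝒳 ⟨0, 0, 0⟩ 3 (by decide), h𝒴 ⟨0, 0, 0⟩ 3 (by decide),
    h𝒳 ⟨0, 1, 0⟩ 0 (by decide), h𝒴 ⟨0, 1, 0⟩ 0 (by decide),
    h𝒳 ⟨0, 1, 0⟩ 2 (by decide), h𝒴 ⟨0, 1, 0⟩ 2 (by decide),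
    h𝒳 ⟨0, 1, 0⟩ 3 (by decide), h𝒴 ⟨0, 1, 0⟩ 3 (by decide), TForm.zero_wedge,
    TForm.wedge_zero]
  abel

/-- The coefficients of degree at least one. -/
def nil (𝒳 : Coll M T) : Coll M T := fun m k => if m.deg = 0 then 0 else 𝒳 m k

/-- For `𝒳 = f + N` and `ρ = exp f` this is `ρ (1 + N + N² / 2) = exp 𝒳`. -/
def expColl (ρ : TFun M T) (𝒳 : Coll M T) : Coll M T := fun m k =>
  TForm.smul ρ (one m k + nil 𝒳 m k + (2⁻¹ : ℝ) • mul (nil 𝒳) (nil 𝒳) m k)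

theorem DegreeZero.nil (h : 𝒳.DegreeZero) : (nil 𝒳).DegreeZero := by
  intro m k hk
  unfold Coll.nil
  rw [h m k hk, ite_self]

theorem DegreeZero.expColl (h : 𝒳.DegreeZero) (ρ : TFun M T) : (expColl ρ 𝒳).DegreeZero := by
  intro m k hk
  refine ev_ext fun x v => ?_
  unfold Coll.expColl
  rw [DegreeZero.one m k hk, h.nil m k hk, h.nil.mul h.nil m k hk, smul_zero, add_zero, add_zero,
    ev_smul, ev_zero, mul_zero]

theorem one_of_deg_ne {m : Mono} (h : m.deg ≠ 0) (k : ℕ) : (one : Coll M T) m k = 0 := by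
  funext i x
  refine dif_neg fun h' => h ?_
  rw [Mono.deg, h'.1.1, h'.1.2.1, h'.1.2.2]
  rfl

theorem ev_one (x : M) (v : Fin 0 → TangentSpace (𝓡 3) x) :
    ev ((one : Coll M T) ⟨0, 0, 0⟩ 0) x v = 1 := by
  refine Scalar.ext (funext fun i => ?_)
  change (one : Coll M T) ⟨0, 0, 0⟩ 0 i x v = T.one i
  unfold one
  rw [dif_pos ⟨⟨rfl, rfl, rfl⟩, rfl⟩]
  exact mul_one _

variable (ρ : TFun M T) (x : M)

theorem expColl_unit : expColl ρ 𝒳 ⟨0, 0, 0⟩ 0 = fun i => Form.ofFun (ρ i) := by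
  refine ev_ext fun x v => ?_
  have h0 : nil 𝒳 ⟨0, 0, 0⟩ 0 = 0 := rfl
  rw [expColl, ev_smul, ev_add, ev_add, ev_one, ev_const_smul, mul_unit, h0, TForm.zero_wedge,
    ev_zero, smul_zero, add_zero, add_zero, mul_one]
  rfl

theorem expColl_dt (h : 𝒳.DegreeZero) : expColl ρ 𝒳 ⟨1, 0, 0⟩ 1 = TForm.smul ρ 𝒳.X := by
  have h0 : nil 𝒳 ⟨0, 0, 0⟩ 0 = 0 := rfl
  rw [expColl, one_of_deg_ne (by decide), mul_dt h.nil h.nil, h0, TForm.zero_wedge,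
    TForm.wedge_zero, add_zero, smul_zero, add_zero, zero_add]
  rfl

theorem expColl_ep (h : 𝒳.DegreeZero) : expColl ρ 𝒳 ⟨0, 1, 0⟩ 1 = TForm.smul ρ 𝒳.V := by
  have h0 : nil 𝒳 ⟨0, 0, 0⟩ 0 = 0 := rfl
  rw [expColl, one_of_deg_ne (by decide), mul_ep h.nil h.nil, h0, TForm.zero_wedge,
    TForm.wedge_zero, add_zero, smul_zero, add_zero, zero_add]
  rfl

theorem expColl_dep (h : 𝒳.DegreeZero) : expColl ρ 𝒳 ⟨0, 0, 1⟩ 2 = TForm.smul ρ 𝒳.σ := by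
  have h0 : nil 𝒳 ⟨0, 0, 0⟩ 0 = 0 := rfl
  rw [expColl, one_of_deg_ne (by decide), mul_dep h.nil h.nil, h0, TForm.zero_wedge,
    TForm.wedge_zero, add_zero, smul_zero, add_zero, zero_add]
  rfl

theorem wedge_one_one_swap (α β : TForm M T 1) :
    TForm.wedge (rfl : 1 + 1 = 2) β α = -TForm.wedge (rfl : 1 + 1 = 2) α β := by
  refine ev_ext fun x v => ?_
  rw [ev_neg, ev_wedge_one_one, ev_wedge_one_one]
  ring

theorem wedge_two_one_swap (α : TForm M T 1) (β : TForm M T 2) :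
    TForm.wedge (rfl : 2 + 1 = 3) β α = TForm.wedge (rfl : 1 + 2 = 3) α β := by
  refine ev_ext fun x v => ?_
  rw [ev_wedge_two_one, ev_wedge_one_two]

theorem half_smul_add_self {k : ℕ} (w : TForm M T k) : (2⁻¹ : ℝ) • (w + w) = w := by
  rw [← two_smul ℝ w, smul_smul, inv_mul_cancel₀ two_ne_zero, one_smul]

theorem expColl_dt_ep (h : 𝒳.DegreeZero) : expColl ρ 𝒳 ⟨1, 1, 0⟩ 2 =
    TForm.smul ρ (𝒳.π - TForm.wedge (rfl : 1 + 1 = 2) 𝒳.X 𝒳.V) := by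
  have h0 : nil 𝒳 ⟨0, 0, 0⟩ 0 = 0 := rfl
  have h1 : nil 𝒳 ⟨1, 0, 0⟩ 1 = 𝒳.X := rfl
  have h2 : nil 𝒳 ⟨0, 1, 0⟩ 1 = 𝒳.V := rfl
  rw [expColl, one_of_deg_ne (by decide), mul_dt_ep h.nil h.nil, h0, TForm.zero_wedge,
    TForm.wedge_zero, h1, h2, wedge_one_one_swap 𝒳.X 𝒳.V]
  simp only [zero_add, zero_sub]
  rw [half_smul_add_self, sub_eq_add_neg]
  rfl

theorem expColl_dt_dep (h : 𝒳.DegreeZero) : expColl ρ 𝒳 ⟨1, 0, 1⟩ 3 =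
    TForm.smul ρ (𝒳.Φ + TForm.wedge (rfl : 1 + 2 = 3) 𝒳.X 𝒳.σ) := by
  have h0 : nil 𝒳 ⟨0, 0, 0⟩ 0 = 0 := rfl
  have h1 : nil 𝒳 ⟨1, 0, 0⟩ 1 = 𝒳.X := rfl
  have h2 : nil 𝒳 ⟨0, 0, 1⟩ 2 = 𝒳.σ := rfl
  rw [expColl, one_of_deg_ne (by decide), mul_dt_dep h.nil h.nil, h0, TForm.zero_wedge,
    TForm.wedge_zero, h1, h2, wedge_two_one_swap]
  simp only [zero_add]
  rw [half_smul_add_self]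
  rfl

theorem expColl_ep_dep (h : 𝒳.DegreeZero) : expColl ρ 𝒳 ⟨0, 1, 1⟩ 3 =
    TForm.smul ρ (𝒳.Ψ + TForm.wedge (rfl : 1 + 2 = 3) 𝒳.V 𝒳.σ) := by
  have h0 : nil 𝒳 ⟨0, 0, 0⟩ 0 = 0 := rfl
  have h1 : nil 𝒳 ⟨0, 1, 0⟩ 1 = 𝒳.V := rfl
  have h2 : nil 𝒳 ⟨0, 0, 1⟩ 2 = 𝒳.σ := rfl
  rw [expColl, one_of_deg_ne (by decide), mul_ep_dep h.nil h.nil, h0, TForm.zero_wedge,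
    TForm.wedge_zero, h1, h2, wedge_two_one_swap]
  simp only [zero_add]
  rw [half_smul_add_self]
  rfl

/-- The seven monomials of degree at most three. -/
theorem deg_cases {P : Mono → ℕ → Prop} (h0 : P ⟨0, 0, 0⟩ 0) (h1 : P ⟨1, 0, 0⟩ 1)
    (h2 : P ⟨0, 1, 0⟩ 1) (h3 : P ⟨1, 1, 0⟩ 2) (h4 : P ⟨0, 0, 1⟩ 2) (h5 : P ⟨1, 0, 1⟩ 3)
    (h6 : P ⟨0, 1, 1⟩ 3) {m : Mono} (hm : m.deg ≤ 3) : P m m.deg := by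
  obtain ⟨a, b, c⟩ := m
  have hc : c = 0 ∨ c = 1 := by
    simp only [Mono.deg] at hm
    omega
  rcases hc with rfl | rfl <;> fin_cases a <;> fin_cases b
  · exact h0
  · exact h2
  · exact h1
  · exact h3
  · exact h4
  · exact h6
  · exact h5
  · exact absurd hm (by decide)

theorem form_eq_zero_of_three_lt {k : ℕ} (hk : 3 < k) (w : TForm M T k) : w = 0 :=
  funext fun i => funext fun x =>
    FluidHPT.form_eq_zero_of_three_lt (V := TangentSpace (𝓡 3) x)
      (EuclideanSpace.basisFun (Fin 3) ℝ).toBasis hk (w i x)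

theorem ext_of_degreeZero (h𝒳 : 𝒳.DegreeZero) (h𝒴 : 𝒴.DegreeZero)
    (h0 : 𝒳 ⟨0, 0, 0⟩ 0 = 𝒴 ⟨0, 0, 0⟩ 0) (h1 : 𝒳.X = 𝒴.X) (h2 : 𝒳.V = 𝒴.V) (h3 : 𝒳.π = 𝒴.π)
    (h4 : 𝒳.σ = 𝒴.σ) (h5 : 𝒳.Φ = 𝒴.Φ) (h6 : 𝒳.Ψ = 𝒴.Ψ) : 𝒳 = 𝒴 := by
  funext m k
  by_cases hk : k = m.deg
  · subst hk
    by_cases hm : m.deg ≤ 3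
    · exact deg_cases (P := fun m k => 𝒳 m k = 𝒴 m k) h0 h1 h2 h3 h4 h5 h6 hm
    · rw [form_eq_zero_of_three_lt (by omega) (𝒳 m m.deg),
        form_eq_zero_of_three_lt (by omega) (𝒴 m m.deg)]
  · rw [h𝒳 m k hk, h𝒴 m k hk]

/-! ### The exponential series -/

/-- Here and in the next lemma the numerical factor vanishes exactly where truncated subtraction
would spoil the exponent. -/
theorem mul_pow_sub_one (a : T.Scalar) (n : ℕ) : (n : T.Scalar) * (a * a ^ (n - 1)) = n * a ^ n := by
  rcases n with _ | n
  · simp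
  · rw [add_tsub_cancel_right, ← pow_succ']

theorem mul_pow_sub_two (a : T.Scalar) (n : ℕ) :
    ((n * (n - 1) : ℕ) : T.Scalar) * (a * a ^ (n - 2)) = ((n * (n - 1) : ℕ) : T.Scalar) * a ^ (n - 1) := by
  rcases n with _ | _ | n
  · simp
  · simp
  · rw [show n + 1 + 1 - 2 = n from rfl, show n + 1 + 1 - 1 = n + 1 from rfl, ← pow_succ']

theorem pow_unit (n : ℕ) (v : Fin 0 → TangentSpace (𝓡 3) x) :
    ev (pow 𝒳 n ⟨0, 0, 0⟩ 0) x v = evF 𝒳.f x ^ n := by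
  induction n generalizing v with
  | zero => rw [pow_zero]; exact ev_one x v
  | succ n ih =>
    refine (congrArg (fun w => ev w x v) (mul_unit 𝒳 (pow 𝒳 n))).trans ?_
    rw [ev_wedge_zero_left, ih, pow_succ']
    rfl

/-- The linear coefficients of a power. -/
theorem pow_linear (n : ℕ) {m : Mono} {k : ℕ}
    (hm : (one : Coll M T) m k = 0)
    (hmul : ∀ n, Coll.mul 𝒳 (pow 𝒳 n) m k = TForm.wedge (zero_add k) (𝒳 ⟨0, 0, 0⟩ 0) (pow 𝒳 n m k) +
      TForm.wedge (add_zero k) (𝒳 m k) (pow 𝒳 n ⟨0, 0, 0⟩ 0)) (v : Fin k → TangentSpace (𝓡 3) x) :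
    ev (pow 𝒳 n m k) x v = n * (evF 𝒳.f x ^ (n - 1) * ev (𝒳 m k) x v) := by
  induction n with
  | zero =>
    rw [Nat.cast_zero, zero_mul]
    exact congrArg (fun w => ev w x v) hm
  | succ n ih =>
    refine (congrArg (fun w => ev w x v) (hmul n)).trans ?_
    rw [ev_add, ev_wedge_zero_left, ev_wedge_zero_right, ih, pow_unit, add_tsub_cancel_right]
    have h1 := mul_pow_sub_one (evF 𝒳.f x) n
    change evF 𝒳.f x * _ + _ = _
    push_cast
    linear_combination ev (𝒳 m k) x v * h1

theorem pow_dt (h : 𝒳.DegreeZero) (n : ℕ) (v : Fin 1 → TangentSpace (𝓡 3) x) :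
    ev (pow 𝒳 n ⟨1, 0, 0⟩ 1) x v = n * (evF 𝒳.f x ^ (n - 1) * ev 𝒳.X x v) :=
  pow_linear x n (one_of_deg_ne (by decide) _) (fun n => mul_dt h (h.pow n)) v

theorem pow_ep (h : 𝒳.DegreeZero) (n : ℕ) (v : Fin 1 → TangentSpace (𝓡 3) x) :
    ev (pow 𝒳 n ⟨0, 1, 0⟩ 1) x v = n * (evF 𝒳.f x ^ (n - 1) * ev 𝒳.V x v) :=
  pow_linear x n (one_of_deg_ne (by decide) _) (fun n => mul_ep h (h.pow n)) v

theorem pow_dep (h : 𝒳.DegreeZero) (n : ℕ) (v : Fin 2 → TangentSpace (𝓡 3) x) :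
    ev (pow 𝒳 n ⟨0, 0, 1⟩ 2) x v = n * (evF 𝒳.f x ^ (n - 1) * ev 𝒳.σ x v) :=
  pow_linear x n (one_of_deg_ne (by decide) _) (fun n => mul_dep h (h.pow n)) v

/-- The quadratic coefficients of a power. -/
theorem pow_quadratic (n : ℕ) {m : Mono} {k : ℕ} (Q : TForm M T k)
    (hm : (one : Coll M T) m k = 0) (R : ℕ → TForm M T k)
    (hR : ∀ n v, ev (R n) x v = 2 * (n * (evF 𝒳.f x ^ (n - 1) * ev Q x v)))
    (hmul : ∀ n, Coll.mul 𝒳 (pow 𝒳 n) m k = TForm.wedge (zero_add k) (𝒳 ⟨0, 0, 0⟩ 0) (pow 𝒳 n m k) +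
      TForm.wedge (add_zero k) (𝒳 m k) (pow 𝒳 n ⟨0, 0, 0⟩ 0) + R n)
    (v : Fin k → TangentSpace (𝓡 3) x) :
    ev (pow 𝒳 n m k) x v = n * (evF 𝒳.f x ^ (n - 1) * ev (𝒳 m k) x v) +
      ((n * (n - 1) : ℕ) : T.Scalar) * (evF 𝒳.f x ^ (n - 2) * ev Q x v) := by
  induction n with
  | zero =>
    rw [Nat.zero_mul, Nat.cast_zero, zero_mul, zero_mul, add_zero]
    exact congrArg (fun w => ev w x v) hm
  | succ n ih =>
    refine (congrArg (fun w => ev w x v) (hmul n)).trans ?_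
    rw [ev_add, ev_add, ev_wedge_zero_left, ev_wedge_zero_right, ih, pow_unit,
      add_tsub_cancel_right, hR]
    have h1 := mul_pow_sub_one (evF 𝒳.f x) n
    have h2 := mul_pow_sub_two (evF 𝒳.f x) n
    -- The new factor of 𝒳 either contributes `f`, leaving the n(n − 1) old quadratic terms, or
    -- pairs with one of the n linear terms; `Q` is half of such a pair, hence 2n.
    have h3 : (((n + 1) * n : ℕ) : T.Scalar) = ((n * (n - 1) : ℕ) : T.Scalar) + 2 * n := by
      rcases n with _ | n
      · simp
      · rw [add_tsub_cancel_right]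
        push_cast
        ring
    change evF 𝒳.f x * _ + _ + _ = _
    rw [h3, show n + 1 - 2 = n - 1 from rfl]
    push_cast at h2 ⊢
    linear_combination ev (𝒳 m k) x v * h1 + ev Q x v * h2

theorem pow_dt_ep (h : 𝒳.DegreeZero) (n : ℕ) (v : Fin 2 → TangentSpace (𝓡 3) x) :
    ev (pow 𝒳 n ⟨1, 1, 0⟩ 2) x v = n * (evF 𝒳.f x ^ (n - 1) * ev 𝒳.π x v) +
      ((n * (n - 1) : ℕ) : T.Scalar) * (evF 𝒳.f x ^ (n - 2) *
        ev (-TForm.wedge (rfl : 1 + 1 = 2) 𝒳.X 𝒳.V) x v) := by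
  refine pow_quadratic x n _ (one_of_deg_ne (by decide) _)
    (fun n => TForm.wedge rfl (𝒳 ⟨0, 1, 0⟩ 1) (pow 𝒳 n ⟨1, 0, 0⟩ 1) -
      TForm.wedge rfl (𝒳 ⟨1, 0, 0⟩ 1) (pow 𝒳 n ⟨0, 1, 0⟩ 1)) (fun n v => ?_) (fun n => ?_) v
  · rw [ev_sub, ev_neg, ev_wedge_one_one, ev_wedge_one_one, ev_wedge_one_one]
    simp only [pow_dt x h, pow_ep x h]
    change ev 𝒳.V x _ * _ - ev 𝒳.V x _ * _ - (ev 𝒳.X x _ * _ - ev 𝒳.X x _ * _) = _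
    ring
  · rw [mul_dt_ep h (h.pow n)]
    abel

theorem pow_dt_dep (h : 𝒳.DegreeZero) (n : ℕ) (v : Fin 3 → TangentSpace (𝓡 3) x) :
    ev (pow 𝒳 n ⟨1, 0, 1⟩ 3) x v = n * (evF 𝒳.f x ^ (n - 1) * ev 𝒳.Φ x v) +
      ((n * (n - 1) : ℕ) : T.Scalar) * (evF 𝒳.f x ^ (n - 2) *
        ev (TForm.wedge (rfl : 1 + 2 = 3) 𝒳.X 𝒳.σ) x v) := by
  refine pow_quadratic x n _ (one_of_deg_ne (by decide) _)
    (fun n => TForm.wedge rfl (𝒳 ⟨1, 0, 0⟩ 1) (pow 𝒳 n ⟨0, 0, 1⟩ 2) +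
      TForm.wedge rfl (𝒳 ⟨0, 0, 1⟩ 2) (pow 𝒳 n ⟨1, 0, 0⟩ 1)) (fun n v => ?_) (fun n => ?_) v
  · rw [ev_add, ev_wedge_one_two, ev_wedge_two_one, ev_wedge_one_two]
    simp only [pow_dt x h, pow_dep x h]
    change ev 𝒳.X x _ * _ - ev 𝒳.X x _ * _ + ev 𝒳.X x _ * _ + (_ * ev 𝒳.σ x _ - _ * ev 𝒳.σ x _ +
      _ * ev 𝒳.σ x _) = _
    ring
  · rw [mul_dt_dep h (h.pow n)]
    abel

theorem pow_ep_dep (h : 𝒳.DegreeZero) (n : ℕ) (v : Fin 3 → TangentSpace (𝓡 3) x) :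
    ev (pow 𝒳 n ⟨0, 1, 1⟩ 3) x v = n * (evF 𝒳.f x ^ (n - 1) * ev 𝒳.Ψ x v) +
      ((n * (n - 1) : ℕ) : T.Scalar) * (evF 𝒳.f x ^ (n - 2) *
        ev (TForm.wedge (rfl : 1 + 2 = 3) 𝒳.V 𝒳.σ) x v) := by
  refine pow_quadratic x n _ (one_of_deg_ne (by decide) _)
    (fun n => TForm.wedge rfl (𝒳 ⟨0, 1, 0⟩ 1) (pow 𝒳 n ⟨0, 0, 1⟩ 2) +
      TForm.wedge rfl (𝒳 ⟨0, 0, 1⟩ 2) (pow 𝒳 n ⟨0, 1, 0⟩ 1)) (fun n v => ?_) (fun n => ?_) v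
  · rw [ev_add, ev_wedge_one_two, ev_wedge_two_one, ev_wedge_one_two]
    simp only [pow_ep x h, pow_dep x h]
    change ev 𝒳.V x _ * _ - ev 𝒳.V x _ * _ + ev 𝒳.V x _ * _ + (_ * ev 𝒳.σ x _ - _ * ev 𝒳.σ x _ +
      _ * ev 𝒳.σ x _) = _
    ring
  · rw [mul_ep_dep h (h.pow n)]
    abel

variable {ρ}

theorem isExp_evF (hρ : IsExpFun 𝒳.f ρ) (x : M) : Scalar.IsExp (evF 𝒳.f x) (evF ρ x) := by
  intro i
  refine (hρ i x).congr_fun fun n => ?_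
  rw [← Scalar.pow_val]
  rfl

theorem hasSum_of_linear {m : Mono} {k : ℕ} (hρ : IsExpFun 𝒳.f ρ) {w : TForm M T k}
    {v : Fin k → TangentSpace (𝓡 3) x}
    (h : ∀ n : ℕ, ev (pow 𝒳 n m k) x v = n * (evF 𝒳.f x ^ (n - 1) * ev w x v)) (i : T.Idx) :
    HasSum (fun n : ℕ => (n ! : ℝ)⁻¹ * pow 𝒳 n m k i x v) (TForm.smul ρ w i x v) := by
  have h1 := (isExp_evF hρ x).hasSum_linear (ev w x v) i
  simp only [← h] at h1
  rw [← ev_smul] at h1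
  exact h1

theorem hasSum_of_quadratic {m : Mono} {k : ℕ} (hρ : IsExpFun 𝒳.f ρ) {w Q : TForm M T k}
    {v : Fin k → TangentSpace (𝓡 3) x}
    (h : ∀ n : ℕ, ev (pow 𝒳 n m k) x v = n * (evF 𝒳.f x ^ (n - 1) * ev w x v) +
      ((n * (n - 1) : ℕ) : T.Scalar) * (evF 𝒳.f x ^ (n - 2) * ev Q x v)) (i : T.Idx) :
    HasSum (fun n : ℕ => (n ! : ℝ)⁻¹ * pow 𝒳 n m k i x v) (TForm.smul ρ (w + Q) i x v) := by
  have h1 := ((isExp_evF hρ x).hasSum_linear (ev w x v) i).add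
    ((isExp_evF hρ x).hasSum_quadratic (ev Q x v) i)
  have h2 : ev (TForm.smul ρ (w + Q)) x v = evF ρ x * ev w x v + evF ρ x * ev Q x v := by
    rw [ev_smul, ev_add, mul_add]
  have h3 : TForm.smul ρ (w + Q) i x v = _ := congrFun (congrArg Scalar.val h2) i
  rw [h3]
  refine h1.congr_fun fun n => ?_
  rw [← mul_add]
  exact congrArg _ (congrFun (congrArg Scalar.val (h n)) i)

/-- In each of the seven coefficients the powers are polynomial in `f`, with numerical factors n and
n(n − 1). Divided by n! these resum to exp f again. Form degrees above three vanish, so no higher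
power of `dε` survives. -/
theorem isExp_expColl (h : 𝒳.DegreeZero) (hρ : IsExpFun 𝒳.f ρ) : IsExp 𝒳 (expColl ρ 𝒳) := by
  intro m k
  by_cases hk : k = m.deg
  · subst hk
    by_cases hm : m.deg ≤ 3
    · refine deg_cases (P := fun m k => ∀ i x (v : Fin k → TangentSpace (𝓡 3) x),
        HasSum (fun n : ℕ => (n ! : ℝ)⁻¹ * Coll.pow 𝒳 n m k i x v) (expColl ρ 𝒳 m k i x v))
        ?_ ?_ ?_ ?_ ?_ ?_ ?_ hm <;> intro i x v
      · rw [expColl_unit]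
        refine (isExp_evF hρ x i).congr_fun fun n => ?_
        rw [← pow_unit x n v]
        rfl
      · rw [expColl_dt ρ h]
        exact hasSum_of_linear x hρ (fun n => pow_dt x h n v) i
      · rw [expColl_ep ρ h]
        exact hasSum_of_linear x hρ (fun n => pow_ep x h n v) i
      · rw [expColl_dt_ep ρ h, sub_eq_add_neg]
        exact hasSum_of_quadratic x hρ (fun n => pow_dt_ep x h n v) i
      · rw [expColl_dep ρ h]
        exact hasSum_of_linear x hρ (fun n => pow_dep x h n v) i
      · rw [expColl_dt_dep ρ h]
        exact hasSum_of_quadratic x hρ (fun n => pow_dt_dep x h n v) i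
      · rw [expColl_ep_dep ρ h]
        exact hasSum_of_quadratic x hρ (fun n => pow_ep_dep x h n v) i
    · intro i x v
      rw [form_eq_zero_of_three_lt (by omega) (expColl ρ 𝒳 m m.deg)]
      refine hasSum_zero.congr_fun fun n => ?_
      rw [form_eq_zero_of_three_lt (by omega) (pow 𝒳 n m m.deg)]
      exact mul_zero _
  · intro i x v
    rw [h.expColl ρ m k hk]
    refine hasSum_zero.congr_fun fun n => ?_
    rw [h.pow n m k hk]
    exact mul_zero _

theorem IsExp.unique {𝓔 𝓔' : Coll M T} (h : IsExp 𝒳 𝓔) (h' : IsExp 𝒳 𝓔') : 𝓔 = 𝓔' := by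
  funext m k i x
  ext v
  exact (h m k i x v).unique (h' m k i x v)

/-- The coefficient at 1 involves `f` alone, so a density, together with its regularity, can be read
off from the exponential of the whole collection. -/
theorem IsExp.isExpFun {𝓔 : Coll M T} (h : IsExp 𝒳 𝓔) :
    IsExpFun 𝒳.f fun i => Form.toFun (𝓔 ⟨0, 0, 0⟩ 0 i) := by
  intro i x
  refine (h ⟨0, 0, 0⟩ 0 i x ![]).congr_fun fun n => ?_
  have h1 := pow_unit (𝒳 := 𝒳) x n ![]
  have h2 : T.pow (fun j => 𝒳.f j x) n i = (evF 𝒳.f x ^ n).val i :=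
    congrFun (Scalar.pow_val (evF 𝒳.f x) n) i
  rw [h2, ← h1]
  rfl

end Coll
end Manifold
end FluidHPT

namespace FluidHPT
open TimeModel

/-! ### The balance laws of a collection -/

section Smooth

variable {M : Type*} [TopologicalSpace M] [ChartedSpace E3 M] {T : TimeModel}

namespace Coll

theorem smul_instant {k : ℕ} (ρ : TFun M T) (w : TForm M T k) {s : T.Idx} (hs : T.IsInstant s) :
    TForm.smul (T := point) (fun _ => ρ s) (fun _ => w s) = fun _ => TForm.smul ρ w s :=
  funext fun _ => funext fun x => (conv_instant T
    (fun (a : ℝ) (β : TangentSpace (𝓡 3) x [⋀^Fin k]→ₗ[ℝ] ℝ) => a • β)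
    (fun j => ρ j x) (fun j => w j x) hs).symm

theorem wedge_instant {a b k : ℕ} (h : a + b = k) (α : TForm M T a) (β : TForm M T b) {s : T.Idx}
    (hs : T.IsInstant s) :
    TForm.wedge (T := point) h (fun _ => α s) (fun _ => β s) = fun _ => TForm.wedge h α β s :=
  funext fun _ => funext fun x => (conv_instant T (FluidHPT.wedge (V := TangentSpace (𝓡 3) x) h)
    (fun j => α j x) (fun j => β j x) hs).symm

theorem smul_zero_form {k : ℕ} (ρ : TFun M T) : TForm.smul ρ (0 : TForm M T k) = 0 :=
  ev_ext fun x v => by rw [ev_smul, ev_zero, mul_zero]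

end Coll

variable [IsManifold (𝓡 3) ∞ M]

namespace Coll

variable {𝒳 : Coll M T}

theorem smooth_mul (h𝒳 : ∀ m k, SmoothForm (𝒳 m k)) : ∀ m k, SmoothForm (mul 𝒳 𝒳 m k) := by
  intro m k
  have hsum : ∀ {ι : Type} (s : Finset ι) (w : ι → TForm M T k), (∀ j ∈ s, SmoothForm (w j)) →
      SmoothForm (∑ j ∈ s, w j) := fun s w hw =>
    Finset.sum_induction w SmoothForm (fun _ _ => SmoothForm.add) SmoothForm.zero hw
  refine hsum _ _ fun c₁ _ => hsum _ _ fun c₂ _ => hsum _ _ fun a₁ _ => hsum _ _ fun a₂ _ =>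
    hsum _ _ fun b _ => hsum _ _ fun q _ => ?_
  split_ifs
  · exact ((h𝒳 _ _).wedge _ (h𝒳 _ _)).const_smul _
  · exact SmoothForm.zero

theorem smooth_one (m : Mono) (k : ℕ) : SmoothForm ((one : Coll M T) m k) := by
  by_cases h : m = ⟨0, 0, 0⟩ ∧ k = 0
  · obtain ⟨rfl, rfl⟩ := h
    refine smoothForm_iff.2 fun x₀ r => tsmooth_congr (W := fun _ => 1) ?_ fun y _ =>
      (coefT_eq _ _ _ _).trans (ev_one _ _)
    cases T with
    | point => exact contDiffOn_const
    | formal => exact fun n => contDiffOn_const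
    | interval J =>
      exact (contDiffOn_const (c := (1 : ℝ))).congr fun q hq => spaceTime_of_mem (fun _ => 1) hq.1
  · have : (one : Coll M T) m k = 0 := by
      funext i x
      refine dif_neg fun h' => h ⟨?_, h'.2⟩
      obtain ⟨a, b, c⟩ := m
      obtain ⟨⟨rfl, rfl, rfl⟩, -⟩ := h'
      rfl
    rw [this]
    exact SmoothForm.zero

theorem smooth_expColl {ρ : TFun M T} (h𝒳 : ∀ m k, SmoothForm (𝒳 m k)) (hρ : SmoothFun ρ) (m : Mono)
    (k : ℕ) : SmoothForm (expColl ρ 𝒳 m k) := by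
  have hn : ∀ m k, SmoothForm (nil 𝒳 m k) := by
    intro m k
    unfold nil
    split_ifs
    · exact SmoothForm.zero
    · exact h𝒳 m k
  exact SmoothForm.smul hρ (((smooth_one m k).add (hn m k)).add ((smooth_mul hn m k).const_smul _))

end Coll
end Smooth

section Manifold

variable {M : Type*} [TopologicalSpace M] [ChartedSpace E3 M] {T : TimeModel}
  [RiemannianBundle (fun x : M => TangentSpace (𝓡 3) x)]
  (o : (x : M) → Orientation ℝ (TangentSpace (𝓡 3) x) (Fin 3))
  [IsManifold (𝓡 3) ∞ M]

theorem TForm.d_zero {M : Type*} [TopologicalSpace M] [ChartedSpace E3 M] [IsManifold (𝓡 3) ∞ M]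
    {k : ℕ} : TForm.d (0 : TForm M T k) = 0 := by
  have h := TForm.d_add (SmoothForm.zero (M := M) (T := T) (k := k)) SmoothForm.zero
  rw [add_zero] at h
  exact left_eq_add.1 h

theorem TForm.ddt_zero {M : Type*} [TopologicalSpace M] [ChartedSpace E3 M] [IsManifold (𝓡 3) ∞ M]
    (hT : T.Good) {k : ℕ} : TForm.ddt (0 : TForm M T k) = 0 := by
  refine ev_ext fun x v => ?_
  rw [ev_ddt hT SmoothForm.zero]
  exact Scalar.ext TimeModel.ddt_zero

theorem TForm.ddt_neg {M : Type*} [TopologicalSpace M] [ChartedSpace E3 M] [IsManifold (𝓡 3) ∞ M]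
    (hT : T.Good) {k : ℕ} {w : TForm M T k} (hw : SmoothForm w) :
    TForm.ddt (-w) = -TForm.ddt w := by
  refine ev_ext fun x v => ?_
  rw [ev_ddt hT hw.neg, ev_neg, ev_neg, ev_ddt hT hw]
  exact Scalar.ext (funext fun i => ddt_map hT (hw.diff_ev x v) (-ContinuousLinearMap.id ℝ ℝ) i)

theorem TForm.codiff_zero {k : ℕ} : TForm.codiff o (0 : TForm M T (k + 1)) = 0 := by
  rcases k with _ | _ | _ | k
  · rw [TForm.codiff_one, TForm.hodge_zero, TForm.d_zero, TForm.hodge_zero]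
  · rw [TForm.codiff_two, TForm.hodge_zero, TForm.d_zero, TForm.hodge_zero, neg_zero]
  · rw [TForm.codiff_three, TForm.hodge_zero, TForm.d_zero, TForm.hodge_zero]
  · exact TForm.codiff_of_three_le o (by omega) _

variable [IsContMDiffRiemannianBundle (𝓡 3) ∞ E3 (fun x : M => TangentSpace (𝓡 3) x)]
variable {o}

theorem TForm.hodge_two_ddt (hT : T.Good) (ho : IsOrientation o) {w : TForm M T 2}
    (hw : SmoothForm w) : TForm.hodge o (rfl : 2 + 1 = 3) (TForm.ddt w) =
      TForm.ddt (TForm.hodge o (rfl : 2 + 1 = 3) w) := by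
  refine TForm.ext_one o fun x a => ?_
  rw [ev_ddt hT (hw.hodge_two ho rfl)]
  obtain ⟨h0, h1, h2⟩ := ev_hodge_two o rfl (TForm.ddt w) x
  obtain ⟨k0, k1, k2⟩ := ev_hodge_two o rfl w x
  fin_cases a
  · refine h0.trans ?_
    rw [ev_ddt hT hw, ← k0]
    rfl
  · refine h1.trans ?_
    rw [ev_ddt hT hw, ← k1]
    rfl
  · refine h2.trans ?_
    rw [ev_ddt hT hw, ← k2]
    rfl

theorem TForm.codiff_two_ddt (hT : T.Good) (ho : IsOrientation o) {w : TForm M T 2}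
    (hw : SmoothForm w) : TForm.codiff o (k := 1) (TForm.ddt w) =
      TForm.ddt (TForm.codiff o (k := 1) w) := by
  have h1 := hw.hodge_two ho rfl
  rw [TForm.codiff_two, TForm.codiff_two, TForm.hodge_two_ddt hT ho hw, TForm.d_ddt hT h1,
    TForm.hodge_two_ddt hT ho (h1.d hT), TForm.ddt_neg hT ((h1.d hT).hodge_two ho rfl)]

/-- The two inner stars cancel, leaving ⋆dd⋆ up to sign. -/
theorem TForm.codiff_codiff_two (hT : T.Good) (ho : IsOrientation o) {w : TForm M T 2} (hw : SmoothForm w) :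
    TForm.codiff o (k := 0) (TForm.codiff o (k := 1) w) = 0 := by
  rw [TForm.codiff_two, TForm.codiff_one, TForm.hodge_neg, TForm.hodge_hodge_two]
  have h1 := (hw.hodge_two ho rfl).d hT
  have h3 := TForm.d_add h1 h1.neg
  rw [add_neg_cancel, TForm.d_zero, TForm.d_d (hw.hodge_two ho rfl), zero_add] at h3
  rw [← h3, TForm.hodge_zero]

theorem TForm.codiff_codiff_three (ho : IsOrientation o) {w : TForm M T 3} (hw : SmoothForm w) :
    TForm.codiff o (k := 1) (TForm.codiff o (k := 2) w) = 0 := by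
  rw [TForm.codiff_three, TForm.codiff_two, TForm.hodge_hodge_one,
    TForm.d_d (hw.hodge_three ho rfl), TForm.hodge_zero, neg_zero]

theorem SmoothForm.codiff_three (hT : T.Good) (ho : IsOrientation o) {w : TForm M T 3}
    (hw : SmoothForm w) : SmoothForm (TForm.codiff o (k := 2) w) := by
  rw [TForm.codiff_three]
  exact ((hw.hodge_three ho rfl).d hT).hodge_one ho rfl

theorem TForm.codiff_two_add (ho : IsOrientation o) {w w' : TForm M T 2}
    (hw : SmoothForm w) (hw' : SmoothForm w') : TForm.codiff o (k := 1) (w + w') =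
      TForm.codiff o (k := 1) w + TForm.codiff o (k := 1) w' := by
  simp only [TForm.codiff_two]
  rw [TForm.hodge_add, TForm.d_add (hw.hodge_two ho rfl) (hw'.hodge_two ho rfl), TForm.hodge_add,
    neg_add]

theorem neg_one_smul_form {M : Type*} [TopologicalSpace M] [ChartedSpace E3 M] {k : ℕ}
    (w : TForm M T k) : (-1 : ℝ) • w = -w := neg_one_smul ℝ w

namespace Coll

variable {𝓔 𝒳 : Coll M T}

/-- The hypotheses are the coefficients at `dt`, `dε`, `dt dε` and `(dε)²`. The others are
redundant: at `ε` by δδ = 0, at `dt ε` by applying δ to `hC` and commuting it with ∂ₜ, and at `ε dε`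
and `dt ε dε` because the coefficient in `hD` is zero. -/
theorem diff_eq_zero_of (hT : T.Good) (ho : IsOrientation o) (h : 𝓔.DegreeZero)
    (hs : ∀ m k, SmoothForm (𝓔 m k))
    (hA : TForm.codiff o (𝓔 ⟨1, 0, 0⟩ 1) + TForm.ddt (𝓔 ⟨0, 0, 0⟩ 0) = 0)
    (hB : 𝓔 ⟨0, 1, 0⟩ 1 = TForm.codiff o (𝓔 ⟨0, 0, 1⟩ 2))
    (hC : TForm.codiff o (𝓔 ⟨1, 0, 1⟩ 3) + TForm.ddt (𝓔 ⟨0, 0, 1⟩ 2) = 𝓔 ⟨1, 1, 0⟩ 2)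
    (hD : 𝓔 ⟨0, 1, 1⟩ 3 = 0) : diff o 𝓔 = 0 := by
  -- Without `dt`, the only monomial whose coefficient is a three-form is `ε dε`.
  have hD' : ∀ m : Mono, m.dt = 0 → 𝓔 m 3 = 0 := by
    rintro ⟨a, b, c⟩ rfl
    by_cases hm : 3 = Mono.deg ⟨0, b, c⟩
    · have : c = 1 ∧ b = 1 := by
        fin_cases b <;> simp [Mono.deg] at hm ⊢ <;> omega
      rw [this.1, this.2, hD]
    · exact h _ _ hm
  have hdeg : ∀ (m : Mono) (k : ℕ), k + 1 ≠ m.deg → diff o 𝓔 m k = 0 := by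
    intro m k hk
    have h1 : 𝓔 m (k + 1) = 0 := h m _ hk
    unfold diff
    rw [h1, TForm.codiff_zero, zero_add]
    have h2 : m.dt = 1 → 𝓔 ⟨0, m.ep, m.dep⟩ k = 0 := fun hm => h _ _ fun h' => hk (by
      rw [h']
      simp only [Mono.deg, hm]
      simp
      omega)
    have h3 : m.ep = 0 ∧ 0 < m.dep → 𝓔 ⟨m.dt, 1, m.dep - 1⟩ k = 0 := fun hm => h _ _ fun h' => hk (by
      rw [h']
      simp only [Mono.deg, hm.1]
      simp
      omega)
    split_ifs with ha hb hb
    · rw [h2 ha, h3 hb, TForm.ddt_zero hT, smul_zero, smul_zero, add_zero]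
    · rw [h2 ha, TForm.ddt_zero hT, smul_zero, add_zero]
    · rw [h3 hb, smul_zero, add_zero]
    · rw [add_zero]
  have hsmall : ∀ m : Mono, m.deg ≤ 3 → ∀ k, k + 1 = m.deg → diff o 𝓔 m k = 0 := by
    intro m hm
    refine deg_cases (P := fun m k => ∀ k', k' + 1 = k → diff o 𝓔 m k' = 0)
      ?_ ?_ ?_ ?_ ?_ ?_ ?_ hm
    · intro k' hk'
      omega
    · rintro k' hk'
      obtain rfl : k' = 0 := by omega
      simpa [diff] using hA
    · rintro k' hk'
      obtain rfl : k' = 0 := by omega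
      simpa [diff, hB] using TForm.codiff_codiff_two hT ho (hs _ _)
    · rintro k' hk'
      obtain rfl : k' = 1 := by omega
      -- Substituting `hC` and `hB`: the δδ term drops out and the two time derivatives of δ(ρσ)
      -- appear with opposite signs.
      have h1 : 𝓔 ⟨1, 1, 0⟩ (1 + 1) = TForm.codiff o (𝓔 ⟨1, 0, 1⟩ 3) + TForm.ddt (𝓔 ⟨0, 0, 1⟩ 2) :=
        hC.symm
      simp only [diff, h1, hB]
      rw [TForm.codiff_two_add ho ((hs _ _).codiff_three hT ho) ((hs _ _).ddt hT),
        TForm.codiff_codiff_three ho (hs _ _), TForm.codiff_two_ddt hT ho (hs _ _)]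
      simp [neg_one_smul_form]
    · rintro k' hk'
      obtain rfl : k' = 1 := by omega
      simp [diff, hB, neg_one_smul_form]
    · rintro k' hk'
      obtain rfl : k' = 2 := by omega
      have h3 : (-1 : ℝ) ^ 3 = -1 := by norm_num
      simp [diff, hC, h3, neg_one_smul_form]
    · rintro k' hk'
      obtain rfl : k' = 2 := by omega
      simp [diff, hD, TForm.codiff_zero]
  funext m k
  by_cases hk : k + 1 = m.deg
  · rcases lt_trichotomy k 3 with h3 | rfl | h3
    · exact hsmall m (by omega) k hk
    -- In form degree three the codifferential term would start from a four-form, so only time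
    -- derivatives and multiples of the `ε dε` coefficient remain.
    · unfold diff
      rw [TForm.codiff_of_three_le o le_rfl, zero_add]
      have h2 : 𝓔 ⟨0, m.ep, m.dep⟩ 3 = 0 := hD' _ rfl
      have h3 : m.ep = 0 ∧ 0 < m.dep → 𝓔 ⟨m.dt, 1, m.dep - 1⟩ 3 = 0 := fun hm => hD' _ (by
        have h4 : m.deg = m.dt + m.ep + 2 * m.dep := rfl
        rw [hm.1, Fin.val_zero] at h4
        exact Fin.ext (by
          change (m.dt : ℕ) = 0
          omega))
      rw [h2, TForm.ddt_zero hT, smul_zero, ite_self, zero_add]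
      split_ifs with hb
      · rw [h3 hb, smul_zero]
        rfl
      · rfl
    · exact form_eq_zero_of_three_lt h3 _
  · exact hdeg m k hk

variable (o) in
/-- The balance laws equivalent to the closedness of `exp 𝒳`. -/
structure BalanceLaws (ρ : TFun M T) (𝒳 : Coll M T) : Prop where
  mass : TForm.codiff o (TForm.smul ρ 𝒳.X) + TForm.ddt (fun i => Form.ofFun (ρ i)) = 0
  vorticity : TForm.smul ρ 𝒳.V = TForm.codiff o (TForm.smul ρ 𝒳.σ)
  momentum : TForm.codiff o (TForm.smul ρ (𝒳.Φ + TForm.wedge (rfl : 1 + 2 = 3) 𝒳.X 𝒳.σ)) +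
    TForm.ddt (TForm.smul ρ 𝒳.σ) =
      TForm.smul ρ (𝒳.π - TForm.wedge (rfl : 1 + 1 = 2) 𝒳.X 𝒳.V)
  helicity : TForm.smul ρ (𝒳.Ψ + TForm.wedge (rfl : 1 + 2 = 3) 𝒳.V 𝒳.σ) = 0

theorem isCollection_of_balanceLaws (hT : T.Good) (ho : IsOrientation o) {ρ : TFun M T}
    (h : 𝒳.DegreeZero) (hs : ∀ m k, SmoothForm (𝒳 m k)) (hρ : IsExpFun 𝒳.f ρ) (hρs : SmoothFun ρ)
    (hb : BalanceLaws o ρ 𝒳) : IsCollection o 𝒳 where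
  degree_zero := h
  smooth := hs
  closed := by
    refine ⟨expColl ρ 𝒳, isExp_expColl h hρ, smooth_expColl hs hρs,
      diff_eq_zero_of hT ho (h.expColl ρ) (smooth_expColl hs hρs) ?_ ?_ ?_ ?_⟩
    · rw [expColl_dt ρ h, expColl_unit]
      exact hb.mass
    · rw [expColl_ep ρ h, expColl_dep ρ h]
      exact hb.vorticity
    · rw [expColl_dt_dep ρ h, expColl_dep ρ h, expColl_dt_ep ρ h]
      exact hb.momentum
    · rw [expColl_ep_dep ρ h]
      exact hb.helicity

/-- The exponential is unique, so the given closed one is `expColl ρ 𝒳` with ρ its coefficient at 1,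
and the laws are four coefficients of its differential. -/
theorem balanceLaws_of_isCollection (h𝒳 : IsCollection o 𝒳) :
    ∃ ρ : TFun M T, SmoothFun ρ ∧ IsExpFun 𝒳.f ρ ∧ BalanceLaws o ρ 𝒳 := by
  obtain ⟨𝓔, hE, hs, hd⟩ := h𝒳.closed
  have h : 𝒳.DegreeZero := h𝒳.degree_zero
  -- Smoothness of ρ is inherited from the exponential. Making ρ opaque allows `𝓔` to be eliminated
  -- afterwards.
  obtain ⟨ρ, hρ, hρs⟩ : ∃ ρ, IsExpFun 𝒳.f ρ ∧ SmoothFun ρ := ⟨_, hE.isExpFun, (hs _ _).toFun⟩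
  obtain rfl : 𝓔 = expColl ρ 𝒳 := hE.unique (isExp_expColl h hρ)
  have hm : ∀ m k, diff o (expColl ρ 𝒳) m k = 0 := fun m k => congrFun (congrFun hd m) k
  have hA := hm ⟨1, 0, 0⟩ 0
  have hB := hm ⟨0, 0, 1⟩ 1
  have hC := hm ⟨1, 0, 1⟩ 2
  -- Differentiating `ε` in `ε dε` produces `(dε)²`; this coefficient carries the law for Ψ, as
  -- there is no four-form to contribute.
  have hD := hm ⟨0, 0, 2⟩ 3
  have h3 : (-1 : ℝ) ^ 3 = -1 := by norm_num
  simp only [diff] at hA hB hC hD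
  rw [TForm.codiff_of_three_le o le_rfl] at hD
  simp [h3, neg_one_smul_form] at hA hB hC hD
  refine ⟨ρ, hρs, hρ, ?_, ?_, ?_, ?_⟩
  · rw [← expColl_dt ρ h, ← expColl_unit ρ (𝒳 := 𝒳)]
    exact hA
  · rw [← expColl_ep ρ h, ← expColl_dep ρ h]
    exact (add_neg_eq_zero.1 hB).symm
  · rw [← expColl_dt_dep ρ h, ← expColl_dep ρ h, ← expColl_dt_ep ρ h]
    exact add_neg_eq_zero.1 hC
  · rw [← expColl_ep_dep ρ h]
    exact hD

/-- Evaluation at an instant is multiplicative, so the laws for V and Ψ restrict to it. The mass and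
momentum laws become trivial, since every term has a `dt` coefficient or a time derivative. -/
theorem isParamCollection_evalAt (ho : IsOrientation o) {ρ : TFun M T}
    (h : 𝒳.DegreeZero) (hs : ∀ m k, SmoothForm (𝒳 m k)) (hρ : IsExpFun 𝒳.f ρ) (hρs : SmoothFun ρ)
    (hb : BalanceLaws o ρ 𝒳) {s : T.Idx} (hi : T.IsInstant s) :
    IsParamCollection o (𝒳.evalAt s) := by
  have hz : ∀ m k, m.dt = 1 → 𝒳.evalAt s m k = 0 := by
    rintro ⟨a, b, c⟩ k rfl
    rfl
  refine ⟨isCollection_of_balanceLaws (T := point) trivial ho (ρ := fun _ => ρ s) ?_ ?_ ?_ ?_ ?_, hz⟩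
  · intro m k hk
    funext _
    unfold evalAt
    rw [h m k hk]
    exact ite_self 0
  · intro m k
    unfold evalAt
    split_ifs
    · exact (hs m k).slice s
    · exact SmoothForm.zero
  · intro _ x
    have h1 : Scalar.IsExp (⟨fun _ => 𝒳.f s x⟩ : point.Scalar) ⟨fun _ => ρ s x⟩ :=
      Scalar.isExp_point_iff.2 fun _ => (isExp_evF hρ x).val_instant hi
    refine (h1 ()).congr_fun fun n => ?_
    rw [← Scalar.pow_val]
    rfl
  · intro x₀
    exact (smoothFun_iff.1 hρs x₀).slice s
  · have hX : (𝒳.evalAt s).X = 0 := rfl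
    have hπ : (𝒳.evalAt s).π = 0 := rfl
    have hΦ : (𝒳.evalAt s).Φ = 0 := rfl
    have hV : (𝒳.evalAt s).V = fun _ => 𝒳.V s := rfl
    have hσ : (𝒳.evalAt s).σ = fun _ => 𝒳.σ s := rfl
    have hΨ : (𝒳.evalAt s).Ψ = fun _ => 𝒳.Ψ s := rfl
    have hddt : ∀ {k : ℕ} (w : TForm M point k), TForm.ddt w = 0 := by
      intro k w
      funext i x
      ext v
      rfl
    refine ⟨?_, ?_, ?_, ?_⟩
    · rw [hX, smul_zero_form, TForm.codiff_zero, hddt, add_zero]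
    · rw [hV, hσ, smul_instant ρ 𝒳.V hi, smul_instant ρ 𝒳.σ hi]
      exact funext fun _ => congrFun hb.vorticity s
    · rw [hX, hπ, hΦ, hddt, TForm.zero_wedge, TForm.zero_wedge]
      simp only [add_zero, sub_zero, smul_zero_form, TForm.codiff_zero]
    · rw [hΨ, hV, hσ, wedge_instant _ 𝒳.V 𝒳.σ hi]
      refine (smul_instant ρ (𝒳.Ψ + TForm.wedge rfl 𝒳.V 𝒳.σ) hi).trans ?_
      exact funext fun _ => congrFun hb.helicity s

theorem isHomotopy_of_balanceLaws (hT : T.Good) (ho : IsOrientation o) {ρ : TFun M T}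
    (h : 𝒳.DegreeZero) (hs : ∀ m k, SmoothForm (𝒳 m k)) (hρ : IsExpFun 𝒳.f ρ) (hρs : SmoothFun ρ)
    (hb : BalanceLaws o ρ 𝒳) : IsHomotopy o 𝒳 :=
  ⟨isCollection_of_balanceLaws hT ho h hs hρ hρs hb,
    fun _ hi => isParamCollection_evalAt ho h hs hρ hρs hb hi⟩

end Coll
end Manifold
end FluidHPT

namespace FluidHPT
open TimeModel

/-! ### Vector calculus -/

section Fibre

variable {V : Type} [NormedAddCommGroup V] [InnerProductSpace ℝ V]

/-- The inner product with a fixed vector. -/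
def innerHom (v : V) : V →+ ℝ where
  toFun w := inner ℝ w v
  map_zero' := inner_zero_left v
  map_add' w w' := inner_add_left w w' v

variable [Fact (Module.finrank ℝ V = 3)] (o : Orientation ℝ V (Fin 3))

theorem inner_cross (v w : V) :
    inner ℝ (cross o v w) (frame o 0) = inner ℝ v (frame o 1) * inner ℝ w (frame o 2) -
      inner ℝ v (frame o 2) * inner ℝ w (frame o 1) ∧
    inner ℝ (cross o v w) (frame o 1) = inner ℝ v (frame o 2) * inner ℝ w (frame o 0) -
      inner ℝ v (frame o 0) * inner ℝ w (frame o 2) ∧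
    inner ℝ (cross o v w) (frame o 2) = inner ℝ v (frame o 0) * inner ℝ w (frame o 1) -
      inner ℝ v (frame o 1) * inner ℝ w (frame o 0) := by
  obtain ⟨h0, h1, h2⟩ := hodge_two_one_frame o rfl (wedge rfl (flat v) (flat w))
  simp only [wedge_one_one] at h0 h1 h2
  simp only [← flat_apply, flat_cross]
  exact ⟨h0, h1, h2⟩

end Fibre

section Manifold

variable {M : Type*} [TopologicalSpace M] [ChartedSpace E3 M] {T : TimeModel}

theorem TForm.smul_smul_inv {k : ℕ} {ρ : TFun M T} (hρ : ∀ i, T.IsInstant i → ∀ x, ρ i x ≠ 0)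
    (w : TForm M T k) : TForm.smul ρ (TForm.smul (TFun.inv ρ) w) = w := by
  refine ev_ext fun x v => ?_
  have h1 : evF ρ x * evF (TFun.inv ρ) x = 1 := Scalar.mul_recip fun i hi => hρ i hi x
  rw [ev_smul, ev_smul, ← mul_assoc, h1, one_mul]

theorem TForm.smul_left_cancel {k : ℕ} {ρ : TFun M T} (hρ : ∀ i, T.IsInstant i → ∀ x, ρ i x ≠ 0)
    {w w' : TForm M T k} (h : TForm.smul ρ w = TForm.smul ρ w') : w = w' := by
  refine ev_ext fun x v => ?_
  have h1 := congrArg (fun z => ev z x v) h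
  simp only [ev_smul] at h1
  exact Scalar.mul_left_cancel_of_instant (fun i hi => hρ i hi x) h1

theorem TForm.smul_neg {k : ℕ} (ρ : TFun M T) (w : TForm M T k) :
    TForm.smul ρ (-w) = -TForm.smul ρ w :=
  ev_ext fun x v => by rw [ev_smul, ev_neg, ev_neg, ev_smul, mul_neg]

variable [RiemannianBundle (fun x : M => TangentSpace (𝓡 3) x)]
  (o : (x : M) → Orientation ℝ (TangentSpace (𝓡 3) x) (Fin 3))

theorem TVec.flat_smul (ρ : TFun M T) (u : TVec M T) :
    TVec.flat (TVec.smul ρ u) = TForm.smul ρ (TVec.flat u) := by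
  refine ev_ext fun x v => ?_
  rw [ev_smul, fin_one_eta v]
  refine Scalar.ext (funext fun i => ?_)
  refine (map_conv T (innerHom (v 0)) (fun (a : ℝ) (w : TangentSpace (𝓡 3) x) => a • w)
    (fun j => ρ j x) (fun j => u j x) i).trans ?_
  have h1 : (fun (a : ℝ) (w : TangentSpace (𝓡 3) x) => innerHom (v 0) (a • w)) =
      fun a w => a * innerHom (v 0) w := by
    funext a w
    exact real_inner_smul_left w (v 0) a
  rw [h1]
  exact congrFun (Scalar.conv_mul (T := T) (fun a : ℝ => a) (innerHom (v 0)) (fun j => ρ j x)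
    (fun j => u j x)) i

theorem evF_inner (u w : TVec M T) (x : M) : evF (TVec.inner u w) x =
    ∑ a, ev (TVec.flat u) x ![frame (o x) a] * ev (TVec.flat w) x ![frame (o x) a] := by
  refine Scalar.ext (funext fun i => ?_)
  have h1 : (fun v w : TangentSpace (𝓡 3) x => inner ℝ v w) = fun v w =>
      ∑ a, innerHom (frame (o x) a) v * innerHom (frame (o x) a) w :=
    funext fun v => funext fun w => inner_eq_sum_frame (o x) v w
  change T.conv (fun v w : TangentSpace (𝓡 3) x => inner ℝ v w) (fun j => u j x)
    (fun j => w j x) i = _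
  rw [h1, conv_fun_sum, Finset.sum_apply, Scalar.sum_val]
  refine Finset.sum_congr rfl fun a _ => ?_
  rw [Scalar.conv_mul]
  rfl

theorem conv_cross_component (u w : TVec M T) (x : M) (a b c : TangentSpace (𝓡 3) x)
    (h : ∀ v w : TangentSpace (𝓡 3) x, inner ℝ (FluidHPT.cross (o x) v w) a =
      inner ℝ v b * inner ℝ w c - inner ℝ v c * inner ℝ w b) :
    ev (TVec.flat (TVec.cross o u w)) x ![a] =
      ev (TVec.flat u) x ![b] * ev (TVec.flat w) x ![c] -
        ev (TVec.flat u) x ![c] * ev (TVec.flat w) x ![b] := by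
  refine Scalar.ext (funext fun i => ?_)
  refine (map_conv T (innerHom a) (FluidHPT.cross (o x)) (fun j => u j x) (fun j => w j x) i).trans ?_
  have h1 : (fun v w : TangentSpace (𝓡 3) x => innerHom a (FluidHPT.cross (o x) v w)) = fun v w =>
      innerHom b v * innerHom c w + (-1 : ℝ) • (innerHom c v * innerHom b w) := by
    funext v w
    refine (h v w).trans ?_
    rw [smul_eq_mul, neg_one_mul, sub_eq_add_neg]
    rfl
  rw [h1, conv_fun_add, conv_fun_smul, Scalar.conv_mul, Scalar.conv_mul, neg_one_smul,
    sub_eq_add_neg]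
  rfl

theorem ev_flat_cross (u w : TVec M T) (x : M) :
    ev (TVec.flat (TVec.cross o u w)) x ![frame (o x) 0] =
      ev (TVec.flat u) x ![frame (o x) 1] * ev (TVec.flat w) x ![frame (o x) 2] -
        ev (TVec.flat u) x ![frame (o x) 2] * ev (TVec.flat w) x ![frame (o x) 1] ∧
    ev (TVec.flat (TVec.cross o u w)) x ![frame (o x) 1] =
      ev (TVec.flat u) x ![frame (o x) 2] * ev (TVec.flat w) x ![frame (o x) 0] -
        ev (TVec.flat u) x ![frame (o x) 0] * ev (TVec.flat w) x ![frame (o x) 2] ∧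
    ev (TVec.flat (TVec.cross o u w)) x ![frame (o x) 2] =
      ev (TVec.flat u) x ![frame (o x) 0] * ev (TVec.flat w) x ![frame (o x) 1] -
        ev (TVec.flat u) x ![frame (o x) 1] * ev (TVec.flat w) x ![frame (o x) 0] :=
  ⟨conv_cross_component o u w x _ _ _ fun v w => (inner_cross (o x) v w).1,
    conv_cross_component o u w x _ _ _ fun v w => (inner_cross (o x) v w).2.1,
    conv_cross_component o u w x _ _ _ fun v w => (inner_cross (o x) v w).2.2⟩

theorem TForm.flat_sharp (α : TForm M T 1) : TVec.flat (TForm.sharp o α) = α :=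
  funext fun i => funext fun x => FluidHPT.flat_sharp (o x) (α i x)

variable [IsManifold (𝓡 3) ∞ M]

theorem flat_grad (p : TFun M T) :
    TVec.flat (fun i => grad o (p i)) = TForm.d fun i => Form.ofFun (p i) :=
  TForm.flat_sharp o (TForm.d fun i => Form.ofFun (p i))

theorem flat_curl (u : TVec M T) : TVec.flat (fun i => curl o (u i)) =
    TForm.hodge o (rfl : 2 + 1 = 3) (TForm.d (TVec.flat u)) :=
  TForm.flat_sharp o (TForm.hodge o (rfl : 2 + 1 = 3) (TForm.d (TVec.flat u)))

theorem SmoothVec.diff {u : TVec M T} (hu : SmoothVec u) (x : M) : T.Diff fun i => u i x := by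
  have hx : x ∈ (trivializationAt E3 (TangentSpace (𝓡 3)) x).baseSet :=
    mem_baseSet_iff.2 (mem_extChartAt_source x)
  have h1 : ∀ a : Fin 3, T.Diff fun i =>
      (trivializationAt E3 (TangentSpace (𝓡 3)) x).continuousLinearMapAt ℝ x (u i x) a := by
    intro a
    have h2 := (smoothVec_iff.1 hu x a).diff (mem_extChartAt_target x)
    unfold vecCoef at h2
    rwa [extChartAt_to_inv] at h2
  have h3 := Diff.sum (T := T) Finset.univ fun (a : Fin 3) _ =>
    (h1 a).map (ContinuousLinearMap.toSpanSingleton ℝ (coordVec x x a))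
  have h4 : (fun i => u i x) = ∑ a : Fin 3, fun i => ContinuousLinearMap.toSpanSingleton ℝ
      (coordVec x x a) ((trivializationAt E3 (TangentSpace (𝓡 3)) x).continuousLinearMapAt ℝ x
        (u i x) a) := by
    funext i
    rw [Finset.sum_apply]
    exact eq_sum_coordVec x x hx (u i x)
  rw [h4]
  exact h3

theorem inner_ddt (hT : T.Good) {u : TVec M T} (hu : SmoothVec u) (x : M)
    (v : TangentSpace (𝓡 3) x) (i : T.Idx) :
    inner ℝ (T.ddt (fun j => u j x) i) v = (ev (TVec.flat u) x ![v]).D.val i := by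
  have h := ddt_map hT (hu.diff x) (innerSL ℝ v) i
  rw [real_inner_comm]
  refine h.symm.trans ?_
  refine congrFun (congrArg T.ddt (funext fun j => ?_)) i
  exact real_inner_comm (u j x) v

end Manifold
end FluidHPT

namespace FluidHPT
open TimeModel

/-! ### The balance of momentum -/

section Manifold

variable {M : Type*} [TopologicalSpace M] [ChartedSpace E3 M] {T : TimeModel}

theorem ofFun_toFun (w : TForm M T 0) : (fun i => Form.ofFun (Form.toFun (w i))) = w :=
  ev_ext fun x v => by
    rw [ev_ofFun, evF_toFun]
    exact congrArg _ (Subsingleton.elim _ _)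

section Leibniz

variable [IsManifold (𝓡 3) ∞ M]

theorem ev_d_smul_zero {f : TFun M T} {w : TForm M T 0} (hf : SmoothFun f) (hw : SmoothForm w)
    (x : M) (v : Fin 1 → TangentSpace (𝓡 3) x) : ev (TForm.d (TForm.smul f w)) x v =
      evF f x * ev (TForm.d w) x v + ev (TForm.d fun i => Form.ofFun (f i)) x v * ev w x ![] := by
  rw [TForm.d_smul (k := 0) rfl (fun x α β v => ?_) hf hw, ev_add, ev_smul, ev_wedge_zero_right]
  rw [wedge_zero_right, Fin.sum_univ_succ, Fin.sum_univ_zero, add_zero, Fin.val_zero, pow_zero,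
    one_mul, fin_one_eta v]
  exact congrArg _ (congrArg _ (Subsingleton.elim _ _))

theorem ev_d_smul_one {f : TFun M T} {w : TForm M T 1} (hf : SmoothFun f) (hw : SmoothForm w)
    (x : M) (v v' : TangentSpace (𝓡 3) x) : ev (TForm.d (TForm.smul f w)) x ![v, v'] =
      evF f x * ev (TForm.d w) x ![v, v'] +
        (ev (TForm.d fun i => Form.ofFun (f i)) x ![v] * ev w x ![v'] -
          ev (TForm.d fun i => Form.ofFun (f i)) x ![v'] * ev w x ![v]) := by
  rw [TForm.d_smul (k := 1) rfl (fun x α β v => ?_) hf hw, ev_add, ev_smul, ev_wedge_one_one]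
  · rfl
  rw [wedge_one_one]
  simp only [fin_one_eta fun a : Fin 1 => v _]
  simp [Fin.sum_univ_succ]
  ring

theorem ev_d_smul_two {f : TFun M T} {w : TForm M T 2} (hf : SmoothFun f) (hw : SmoothForm w)
    (x : M) (v₀ v₁ v₂ : TangentSpace (𝓡 3) x) : ev (TForm.d (TForm.smul f w)) x ![v₀, v₁, v₂] =
      evF f x * ev (TForm.d w) x ![v₀, v₁, v₂] +
        (ev (TForm.d fun i => Form.ofFun (f i)) x ![v₀] * ev w x ![v₁, v₂] +
          ev (TForm.d fun i => Form.ofFun (f i)) x ![v₁] * ev w x ![v₂, v₀] +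
          ev (TForm.d fun i => Form.ofFun (f i)) x ![v₂] * ev w x ![v₀, v₁]) := by
  rw [TForm.d_smul (k := 2) rfl (fun x α β v => ?_) hf hw, ev_add, ev_smul, ev_wedge_one_two,
    ev_two_swap w x v₀ v₂]
  · simp
    ring
  rw [wedge_one_two]
  simp only [fin_two_eta fun a : Fin 2 => v _]
  simp [Fin.sum_univ_succ]
  ring

end Leibniz

variable [RiemannianBundle (fun x : M => TangentSpace (𝓡 3) x)]
  (o : (x : M) → Orientation ℝ (TangentSpace (𝓡 3) x) (Fin 3))

/-- The squared length of a one-form. -/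
def normSq (X : TForm M T 1) : TFun M T := fun i => Form.toFun
  (TForm.hodge o (rfl : 3 + 0 = 3)
    (TForm.wedge (rfl : 1 + 2 = 3) X (TForm.hodge o (rfl : 1 + 2 = 3) X)) i)

theorem ev_wedge_hodge (α β : TForm M T 1) (x : M) :
    ev (TForm.wedge (rfl : 1 + 2 = 3) α (TForm.hodge o (rfl : 1 + 2 = 3) β)) x
      ![frame (o x) 0, frame (o x) 1, frame (o x) 2] =
      ev α x ![frame (o x) 0] * ev β x ![frame (o x) 0] +
        ev α x ![frame (o x) 1] * ev β x ![frame (o x) 1] +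
        ev α x ![frame (o x) 2] * ev β x ![frame (o x) 2] := by
  obtain ⟨h0, h1, h2⟩ := ev_hodge_one o rfl β x
  rw [ev_wedge_one_two]
  simp only [Matrix.cons_val_zero, Matrix.cons_val_one, Matrix.cons_val]
  rw [ev_two_swap _ _ (frame (o x) 2) (frame (o x) 0), h0, h1, h2]
  ring

theorem evF_normSq (X : TForm M T 1) (x : M) : evF (normSq o X) x =
    ev X x ![frame (o x) 0] * ev X x ![frame (o x) 0] +
        ev X x ![frame (o x) 1] * ev X x ![frame (o x) 1] +
        ev X x ![frame (o x) 2] * ev X x ![frame (o x) 2] := by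
  unfold normSq
  rw [evF_toFun, ev_hodge_three, ev_wedge_hodge]

variable [IsManifold (𝓡 3) ∞ M]

theorem ofFun_normSq (X : TForm M T 1) : (fun i => Form.ofFun (normSq o X i)) =
    TForm.hodge o (rfl : 3 + 0 = 3)
      (TForm.wedge (rfl : 1 + 2 = 3) X (TForm.hodge o (rfl : 1 + 2 = 3) X)) := ofFun_toFun _

/-- The one-form `u × curl u` for the vector field `u` with `X = u♭`. -/
def lambForm (X : TForm M T 1) : TForm M T 1 :=
  TForm.hodge o (rfl : 2 + 1 = 3) (TForm.wedge (rfl : 1 + 1 = 2) X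
    (TForm.hodge o (rfl : 2 + 1 = 3) (TForm.d X)))

theorem flat_cross_curl (u : TVec M T) :
    TVec.flat (TVec.cross o u fun j => curl o (u j)) = lambForm o (TVec.flat u) := by
  refine TForm.ext_one o fun x a => ?_
  obtain ⟨h0, h1, h2⟩ := ev_flat_cross o u (fun j => curl o (u j)) x
  obtain ⟨k0, k1, k2⟩ := ev_hodge_two o rfl (TForm.wedge (rfl : 1 + 1 = 2) (TVec.flat u)
    (TForm.hodge o (rfl : 2 + 1 = 3) (TForm.d (TVec.flat u)))) x
  rw [ev_wedge_one_one] at k0 k1 k2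
  rw [flat_curl] at h0 h1 h2
  fin_cases a
  · exact h0.trans k0.symm
  · exact h1.trans k1.symm
  · exact h2.trans k2.symm

theorem ev_lambForm (X : TForm M T 1) (x : M) :
    ev (lambForm o X) x ![frame (o x) 0] =
      ev X x ![frame (o x) 1] * ev (TForm.d X) x ![frame (o x) 0, frame (o x) 1] -
        ev X x ![frame (o x) 2] * ev (TForm.d X) x ![frame (o x) 2, frame (o x) 0] ∧
    ev (lambForm o X) x ![frame (o x) 1] =
      ev X x ![frame (o x) 2] * ev (TForm.d X) x ![frame (o x) 1, frame (o x) 2] -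
        ev X x ![frame (o x) 0] * ev (TForm.d X) x ![frame (o x) 0, frame (o x) 1] ∧
    ev (lambForm o X) x ![frame (o x) 2] =
      ev X x ![frame (o x) 0] * ev (TForm.d X) x ![frame (o x) 2, frame (o x) 0] -
        ev X x ![frame (o x) 1] * ev (TForm.d X) x ![frame (o x) 1, frame (o x) 2] := by
  obtain ⟨k0, k1, k2⟩ := ev_hodge_two o rfl (TForm.wedge (rfl : 1 + 1 = 2) X
    (TForm.hodge o (rfl : 2 + 1 = 3) (TForm.d X))) x
  obtain ⟨h0, h1, h2⟩ := ev_hodge_two o rfl (TForm.d X) x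
  simp only [ev_wedge_one_one, Matrix.cons_val_zero, Matrix.cons_val_one, h0, h1, h2] at k0 k1 k2
  exact ⟨k0, k1, k2⟩

variable [IsContMDiffRiemannianBundle (𝓡 3) ∞ E3 (fun x : M => TangentSpace (𝓡 3) x)]
  {o} {ρ h P : TFun M T} {X V : TForm M T 1} {Φ Ψ : TForm M T 3}

theorem smoothFun_normSq (ho : IsOrientation o) (hX : SmoothForm X) : SmoothFun (normSq o X) :=
  ((hX.wedge _ (hX.hodge_one ho rfl)).hodge_three ho rfl).toFun

theorem ev_codiff_smul_one (ho : IsOrientation o) (hρ : SmoothFun ρ) (hX : SmoothForm X) (x : M) :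
    ev (TForm.codiff o (k := 0) (TForm.smul ρ X)) x ![] =
      evF ρ x * ev (TForm.codiff o (k := 0) X) x ![] +
      (ev (TForm.d fun i => Form.ofFun (ρ i)) x ![frame (o x) 0] * ev X x ![frame (o x) 0] +
        ev (TForm.d fun i => Form.ofFun (ρ i)) x ![frame (o x) 1] * ev X x ![frame (o x) 1] +
        ev (TForm.d fun i => Form.ofFun (ρ i)) x ![frame (o x) 2] * ev X x ![frame (o x) 2]) := by
  obtain ⟨h0, h1, h2⟩ := ev_hodge_one o rfl X x
  rw [TForm.codiff_one, TForm.codiff_one, ev_hodge_three, ev_hodge_three, TForm.hodge_smul,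
    ev_d_smul_two hρ (hX.hodge_one ho rfl), h0, h1, h2]

theorem codiff_smul_hodge (ρ : TFun M T) (X : TForm M T 1) :
    TForm.codiff o (k := 1) (TForm.smul ρ (TForm.hodge o (rfl : 1 + 2 = 3) X)) =
      -TForm.hodge o (rfl : 2 + 1 = 3) (TForm.d (TForm.smul ρ X)) := by
  rw [TForm.codiff_two, ← TForm.hodge_smul, TForm.hodge_hodge_one]

theorem ev_codiff_smul_hodge (hρ : SmoothFun ρ) (hX : SmoothForm X) (x : M) :
    ev (TForm.codiff o (k := 1) (TForm.smul ρ (TForm.hodge o (rfl : 1 + 2 = 3) X))) x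
      ![frame (o x) 0] =
      -(evF ρ x * ev (TForm.d X) x ![frame (o x) 1, frame (o x) 2] +
        (ev (TForm.d fun i => Form.ofFun (ρ i)) x ![frame (o x) 1] * ev X x ![frame (o x) 2] -
          ev (TForm.d fun i => Form.ofFun (ρ i)) x ![frame (o x) 2] * ev X x ![frame (o x) 1])) ∧
    ev (TForm.codiff o (k := 1) (TForm.smul ρ (TForm.hodge o (rfl : 1 + 2 = 3) X))) x
      ![frame (o x) 1] =
      -(evF ρ x * ev (TForm.d X) x ![frame (o x) 2, frame (o x) 0] +
        (ev (TForm.d fun i => Form.ofFun (ρ i)) x ![frame (o x) 2] * ev X x ![frame (o x) 0] -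
          ev (TForm.d fun i => Form.ofFun (ρ i)) x ![frame (o x) 0] * ev X x ![frame (o x) 2])) ∧
    ev (TForm.codiff o (k := 1) (TForm.smul ρ (TForm.hodge o (rfl : 1 + 2 = 3) X))) x
      ![frame (o x) 2] =
      -(evF ρ x * ev (TForm.d X) x ![frame (o x) 0, frame (o x) 1] +
        (ev (TForm.d fun i => Form.ofFun (ρ i)) x ![frame (o x) 0] * ev X x ![frame (o x) 1] -
          ev (TForm.d fun i => Form.ofFun (ρ i)) x ![frame (o x) 1] * ev X x ![frame (o x) 0])) := by
  obtain ⟨h0, h1, h2⟩ := ev_hodge_two o rfl (TForm.d (TForm.smul ρ X)) x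
  rw [codiff_smul_hodge, ev_neg, ev_neg, ev_neg, h0, h1, h2, ev_d_smul_one hρ hX,
    ev_d_smul_one hρ hX, ev_d_smul_one hρ hX]
  exact ⟨rfl, rfl, rfl⟩

/-- The difference of the two sides of the balance of momentum. -/
theorem momentum_balance (hT : T.Good) (ho : IsOrientation o) (hρ : SmoothFun ρ)
    (hX : SmoothForm X) (hh : SmoothFun h) (hhX : ∀ x, evF h x + evF h x = evF (normSq o X) x)
    (hP : SmoothFun P)
    (hPΦ : TForm.hodge o (rfl : 3 + 0 = 3) (TForm.smul ρ Φ) = fun i => Form.ofFun (P i))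
    (mass : TForm.codiff o (TForm.smul ρ X) + TForm.ddt (fun i => Form.ofFun (ρ i)) = 0)
    (vorticity : TForm.smul ρ V =
      TForm.codiff o (TForm.smul ρ (TForm.hodge o (rfl : 1 + 2 = 3) X))) :
    TForm.codiff o (TForm.smul ρ (Φ + TForm.wedge (rfl : 1 + 2 = 3) X
        (TForm.hodge o (rfl : 1 + 2 = 3) X))) +
      TForm.ddt (TForm.smul ρ (TForm.hodge o (rfl : 1 + 2 = 3) X)) -
        TForm.smul ρ (kinetic o X - TForm.wedge (rfl : 1 + 1 = 2) X V) =
    TForm.hodge o (rfl : 1 + 2 = 3) (TForm.smul ρ (TForm.ddt X + TForm.d (fun i => Form.ofFun (h i))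
      - lambForm o X) + TForm.d fun i => Form.ofFun (P i)) := by
  have hsX := hX.hodge_one ho rfl
  have hq := smoothFun_normSq ho hX
  -- The function h is half of |X|²; using h + h avoids dividing in the identities below.
  have hq2 : (fun i => Form.ofFun (h i)) + (fun i => Form.ofFun (h i)) =
      fun i => Form.ofFun (normSq o X i) := TForm.ext_zero fun x => by
    rw [ev_add, ev_ofFun, ev_ofFun, hhX]
  have hdq : ∀ x v, ev (TForm.d fun i => Form.ofFun (normSq o X i)) x v =
      ev (TForm.d fun i => Form.ofFun (h i)) x v + ev (TForm.d fun i => Form.ofFun (h i)) x v := by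
    intro x v
    rw [← hq2, TForm.d_add hh.ofFun hh.ofFun, ev_add]
  -- Since X∧⋆X is |X|² times the volume form, the three-form under δ is dual to the function P +
  -- ρ|X|².
  have hZ : TForm.hodge o (rfl : 3 + 0 = 3) (TForm.smul ρ (Φ + TForm.wedge (rfl : 1 + 2 = 3) X
      (TForm.hodge o (rfl : 1 + 2 = 3) X))) = (fun i => Form.ofFun (P i)) +
        TForm.smul ρ fun i => Form.ofFun (normSq o X i) := by
    rw [← hPΦ, ofFun_normSq, ← TForm.hodge_smul, ← TForm.hodge_add]
    congr 1
    refine ev_ext fun x v => ?_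
    rw [ev_add, ev_smul, ev_smul, ev_smul, ev_add, mul_add]
  have hdZ : ∀ x v, ev (TForm.d ((fun i => Form.ofFun (P i)) +
        TForm.smul ρ fun i => Form.ofFun (normSq o X i))) x v =
      ev (TForm.d fun i => Form.ofFun (P i)) x v +
      (evF ρ x * (ev (TForm.d fun i => Form.ofFun (h i)) x v +
        ev (TForm.d fun i => Form.ofFun (h i)) x v) +
        ev (TForm.d fun i => Form.ofFun (ρ i)) x v * evF (normSq o X) x) := by
    intro x v
    rw [TForm.d_add hP.ofFun (hq.ofFun.smul hρ), ev_add, ev_d_smul_zero hρ hq.ofFun, hdq, ev_ofFun]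
  have hkin : kinetic o X = (1 / 2 : ℝ) • TForm.hodge o (rfl : 1 + 2 = 3)
      (TForm.d fun i => Form.ofFun (normSq o X i)) -
      TForm.smul (fun i => Form.toFun (TForm.codiff o (k := 0) X i))
        (TForm.hodge o (rfl : 1 + 2 = 3) X) := by
    rw [ofFun_normSq, ← TForm.codiff_three]
    rfl
  have hhalf : ∀ a : T.Scalar, (1 / 2 : ℝ) • (a + a) = a := by
    intro a
    rw [← two_smul ℝ a, smul_smul]
    norm_num
  have hmass : ∀ x, ev (TForm.codiff o (TForm.smul ρ X)) x ![] + (evF ρ x).D = 0 := by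
    intro x
    have h1 := congrArg (fun w => ev w x ![]) mass
    simp only [ev_add, ev_ddt hT hρ.ofFun] at h1
    exact h1
  have hmass' := fun x => ev_codiff_smul_one ho hρ hX x
  have hvort : ∀ x a, evF ρ x * ev V x ![frame (o x) a] = ev (TForm.codiff o (TForm.smul ρ
      (TForm.hodge o (rfl : 1 + 2 = 3) X))) x ![frame (o x) a] := by
    intro x a
    rw [← vorticity, ev_smul]
  rw [TForm.codiff_three, hZ, hkin]
  have hD := fun x v => Scalar.D_mul hT (hρ.diff_ev x) (hX.diff_ev x v)
  -- Both sides are two-forms, compared on the three cyclic pairs of an oriented orthonormal frame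
  -- at x; the second and third cases are cyclic shifts of the first.
  refine TForm.ext_two o ?_ ?_ ?_ <;> intro x <;>
    obtain ⟨w0, w1, w2⟩ := ev_codiff_smul_hodge (o := o) hρ hX x <;>
    obtain ⟨s0, s1, s2⟩ := ev_hodge_one o rfl X x <;>
    obtain ⟨l0, l1, l2⟩ := ev_lambForm o X x <;>
    have m1 := hmass x <;>
    rw [hmass'] at m1 <;>
    have v0 := hvort x 0 <;>
    have v1 := hvort x 1 <;>
    have v2 := hvort x 2 <;>
    rw [w0] at v0 <;>
    rw [w1] at v1 <;>
    rw [w2] at v2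
  · simp only [ev_sub, ev_add, ev_smul, ev_const_smul, ev_ddt hT (hsX.smul hρ), ev_ddt hT hX,
      (ev_hodge_one o rfl _ x).1, hdZ, hdq, hhalf, evF_normSq, evF_toFun, ev_wedge_one_one, l0,
      Matrix.cons_val_zero, Matrix.cons_val_one]
    -- The mass law times the component of X removes ∂ₜρ and δX, the formula for ρV rewrites X∧V,
    -- and the product rule expands ∂ₜ(ρX). The remaining terms in dρ cancel by the double cross
    -- product identity, which is polynomial.
    linear_combination ev X x ![frame (o x) 0] * m1 + ev X x ![frame (o x) 1] * v2 -
      ev X x ![frame (o x) 2] * v1 + hD x ![frame (o x) 0]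
  · simp only [ev_sub, ev_add, ev_smul, ev_const_smul, ev_ddt hT (hsX.smul hρ), ev_ddt hT hX,
      (ev_hodge_one o rfl _ x).2.1, hdZ, hdq, hhalf, evF_normSq, evF_toFun, ev_wedge_one_one, l1,
      Matrix.cons_val_zero, Matrix.cons_val_one]
    linear_combination ev X x ![frame (o x) 1] * m1 + ev X x ![frame (o x) 2] * v0 -
      ev X x ![frame (o x) 0] * v2 + hD x ![frame (o x) 1]
  · simp only [ev_sub, ev_add, ev_smul, ev_const_smul, ev_ddt hT (hsX.smul hρ), ev_ddt hT hX,
      (ev_hodge_one o rfl _ x).2.2, hdZ, hdq, hhalf, evF_normSq, evF_toFun, ev_wedge_one_one, l2,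
      Matrix.cons_val_zero, Matrix.cons_val_one]
    linear_combination ev X x ![frame (o x) 2] * m1 + ev X x ![frame (o x) 0] * v1 -
      ev X x ![frame (o x) 1] * v0 + hD x ![frame (o x) 2]

end Manifold
end FluidHPT

namespace FluidHPT
open TimeModel

/-! ### Homotopies and the compressible Euler equations -/

section Manifold

variable {M : Type*} [TopologicalSpace M] [ChartedSpace E3 M] {T : TimeModel}
  [RiemannianBundle (fun x : M => TangentSpace (𝓡 3) x)]
  (o : (x : M) → Orientation ℝ (TangentSpace (𝓡 3) x) (Fin 3))

/-- Half of the squared length of a vector field. -/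
def TVec.halfSq (u : TVec M T) : TFun M T := fun i x => TVec.inner u u i x / 2

theorem evF_halfSq_add (u : TVec M T) (x : M) : evF (TVec.halfSq u) x + evF (TVec.halfSq u) x =
    evF (normSq o (TVec.flat u)) x := by
  rw [evF_normSq, ← Fin.sum_univ_three fun a =>
    ev (TVec.flat u) x ![frame (o x) a] * ev (TVec.flat u) x ![frame (o x) a],
    ← evF_inner]
  exact Scalar.ext (funext fun i => add_halves _)

theorem TVec.flat_eq_zero_iff (u : TVec M T) : TVec.flat u = 0 ↔ u = 0 := by
  refine ⟨fun h => ?_, fun h => ?_⟩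
  · funext i x
    have h1 := congrArg (fun w : TForm M T 1 => w i x ![u i x]) h
    exact inner_self_eq_zero (𝕜 := ℝ).1 h1
  · subst h
    refine ev_ext fun x v => Scalar.ext (funext fun i => ?_)
    exact inner_zero_left (𝕜 := ℝ) (v 0)

variable [IsManifold (𝓡 3) ∞ M]

theorem TForm.hodge_one_eq_zero_iff (h : 1 + 2 = 3) (w : TForm M T 1) :
    TForm.hodge o h w = 0 ↔ w = 0 := by
  refine ⟨fun h1 => ?_, fun h1 => by rw [h1, TForm.hodge_zero]⟩
  rw [← TForm.hodge_hodge_one o h rfl w, h1, TForm.hodge_zero]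

theorem hodge_smul_eq_ofFun_iff {ρ p : TFun M T} {Φ : TForm M T 3}
    (hρ : ∀ i, T.IsInstant i → ∀ x, ρ i x ≠ 0) :
    TForm.hodge o (rfl : 3 + 0 = 3) (TForm.smul ρ Φ) = (fun i => Form.ofFun (p i)) ↔
      Φ = TForm.smul (TFun.inv ρ) (TForm.hodge o (rfl : 0 + 3 = 3) fun i => Form.ofFun (p i)) := by
  refine ⟨fun h => TForm.smul_left_cancel hρ ?_, fun h => ?_⟩
  · rw [TForm.smul_smul_inv hρ, ← h, TForm.hodge_hodge_three]
  · rw [h, TForm.smul_smul_inv hρ, TForm.hodge_hodge_zero]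

variable [IsContMDiffRiemannianBundle (𝓡 3) ∞ E3 (fun x : M => TangentSpace (𝓡 3) x)]

theorem smul_eq_codiff_iff {ρ : TFun M T} {X V : TForm M T 1}
    (hρ : ∀ i, T.IsInstant i → ∀ x, ρ i x ≠ 0) :
    TForm.smul ρ V = TForm.codiff o (TForm.smul ρ (TForm.hodge o (rfl : 1 + 2 = 3) X)) ↔
      V = -TForm.smul (TFun.inv ρ)
        (TForm.hodge o (rfl : 2 + 1 = 3) (TForm.d (TForm.smul ρ X))) := by
  rw [codiff_smul_hodge]
  refine ⟨fun h => TForm.smul_left_cancel hρ ?_, fun h => ?_⟩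
  · rw [TForm.smul_neg, TForm.smul_smul_inv hρ, h]
  · rw [h, TForm.smul_neg, TForm.smul_smul_inv hρ]

theorem mass_iff (hT : T.Good) {ρ : TFun M T} {u : TVec M T} (hρ : SmoothFun ρ) :
    (∀ i x, T.ddt (fun j => ρ j x) i + div o (TVec.smul ρ u i) x = 0) ↔
      TForm.codiff o (TForm.smul ρ (TVec.flat u)) + TForm.ddt (fun i => Form.ofFun (ρ i)) = 0 := by
  have h1 : ∀ i x, T.ddt (fun j => ρ j x) i + div o (TVec.smul ρ u i) x =
      (ev (TForm.codiff o (k := 0) (TForm.smul ρ (TVec.flat u)) +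
        TForm.ddt (fun i => Form.ofFun (ρ i))) x ![]).val i := by
    intro i x
    rw [ev_add, ev_ddt hT hρ.ofFun, ev_ofFun, ← TVec.flat_smul, add_comm]
    rfl
  refine ⟨fun h => TForm.ext_zero fun x => Scalar.ext (funext fun i => ?_), fun h i x => ?_⟩
  · exact (h1 i x).symm.trans (h i x)
  · rw [h1, h]
    rfl

/-- Lower the index and multiply by ρ. Both operations are injective, ♭ by nondegeneracy of the
metric and the product because ρ is nonzero at all instants. -/
theorem euler_iff (hT : T.Good) {ρ p : TFun M T} {u : TVec M T} (hu : SmoothVec u)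
    (huX : SmoothForm (TVec.flat u)) (hρ : ∀ i, T.IsInstant i → ∀ x, ρ i x ≠ 0) :
    (∀ i x, T.ddt (fun j => u j x) i + grad o (fun y => TVec.inner u u i y / 2) x
      - TVec.cross o u (fun j => curl o (u j)) i x
      + TVec.smul (TFun.inv ρ) (fun j => grad o (p j)) i x = 0) ↔
    TForm.smul ρ (TForm.ddt (TVec.flat u) + TForm.d (fun i => Form.ofFun (TVec.halfSq u i)) -
      lambForm o (TVec.flat u)) + TForm.d (fun i => Form.ofFun (p i)) = 0 := by
  set W : TVec M T := fun i x => T.ddt (fun j => u j x) i + grad o (fun y => TVec.inner u u i y / 2) x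
      - TVec.cross o u (fun j => curl o (u j)) i x
      + TVec.smul (TFun.inv ρ) (fun j => grad o (p j)) i x with hW
  have h1 : TVec.flat W = TForm.ddt (TVec.flat u) +
      TForm.d (fun i => Form.ofFun (TVec.halfSq u i)) - lambForm o (TVec.flat u) +
        TForm.smul (TFun.inv ρ) (TForm.d (fun i => Form.ofFun (p i))) := by
    rw [← flat_cross_curl, ← flat_grad o, ← flat_grad o, ← TVec.flat_smul]
    refine ev_ext fun x v => ?_
    rw [ev_add, ev_sub, ev_add, ev_ddt hT huX, fin_one_eta v]
    refine Scalar.ext (funext fun i => ?_)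
    have h2 : inner ℝ (W i x) (v 0) = inner ℝ (T.ddt (fun j => u j x) i) (v 0) +
        inner ℝ (grad o (fun y => TVec.inner u u i y / 2) x) (v 0) -
        inner ℝ (TVec.cross o u (fun j => curl o (u j)) i x) (v 0) +
        inner ℝ (TVec.smul (TFun.inv ρ) (fun j => grad o (p j)) i x) (v 0) := by
      rw [hW, inner_add_left, inner_sub_left, inner_add_left]
    rw [inner_ddt hT hu] at h2
    exact h2
  have h3 : TForm.smul ρ (TVec.flat W) = TForm.smul ρ (TForm.ddt (TVec.flat u) +
      TForm.d (fun i => Form.ofFun (TVec.halfSq u i)) - lambForm o (TVec.flat u)) +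
        TForm.d (fun i => Form.ofFun (p i)) := by
    conv_rhs => rw [← TForm.smul_smul_inv hρ (TForm.d (fun i => Form.ofFun (p i)))]
    rw [h1]
    refine ev_ext fun x v => ?_
    rw [ev_add, ev_smul, ev_smul ρ, ev_smul ρ, ev_add, mul_add]
  rw [← h3]
  refine ⟨fun h => ?_, fun h i x => ?_⟩
  · have h4 : W = 0 := funext fun i => funext fun x => h i x
    rw [(TVec.flat_eq_zero_iff W).2 h4, Coll.smul_zero_form]
  · have h4 : W = 0 := (TVec.flat_eq_zero_iff W).1
      (TForm.smul_left_cancel hρ (h.trans (Coll.smul_zero_form ρ).symm))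
    exact congrFun (congrFun h4 i) x

variable {o} {ρ p : TFun M T} {u : TVec M T} {𝒳 : Coll M T}

theorem SmoothVec.halfSq (ho : IsOrientation o) (hu : SmoothVec u) : SmoothFun (TVec.halfSq u) := by
  have h1 := ((smoothFun_normSq ho hu.flat).ofFun.const_smul (1 / 2)).toFun
  refine cast (congrArg SmoothFun (evF_ext fun x => ?_)) h1
  rw [evF_toFun, ev_const_smul, ev_ofFun, ← evF_halfSq_add, ← two_smul ℝ (evF _ x), smul_smul]
  norm_num

/-- Since ρV = −⋆d(ρX), one has ρV∧⋆X = −X∧d(ρX) = −ρ X∧dX, the term X∧dρ∧X being zero. -/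
theorem smul_helicity {X V : TForm M T 1} (Ψ : TForm M T 3) (hρ : SmoothFun ρ) (hX : SmoothForm X)
    (vorticity : TForm.smul ρ V =
      TForm.codiff o (TForm.smul ρ (TForm.hodge o (rfl : 1 + 2 = 3) X))) :
    TForm.smul ρ (Ψ + TForm.wedge (rfl : 1 + 2 = 3) V (TForm.hodge o (rfl : 1 + 2 = 3) X)) =
      TForm.smul ρ (Ψ - TForm.wedge (rfl : 1 + 2 = 3) X (TForm.d X)) := by
  refine TForm.ext_three o fun x => ?_
  obtain ⟨w0, w1, w2⟩ := ev_codiff_smul_hodge (o := o) hρ hX x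
  rw [← vorticity, ev_smul] at w0 w1 w2
  rw [ev_smul, ev_smul, ev_add, ev_sub, ev_wedge_hodge, ev_wedge_one_two]
  simp only [Matrix.cons_val_zero, Matrix.cons_val_one, Matrix.cons_val]
  rw [ev_two_swap _ _ (frame (o x) 2) (frame (o x) 0)]
  linear_combination ev X x ![frame (o x) 0] * w0 + ev X x ![frame (o x) 1] * w1 +
    ev X x ![frame (o x) 2] * w2

/-- Under the constraints on `σ` and `π`, the balance laws are the compressible Euler equations
together with the formulas for `V` and `Ψ`. -/
theorem balanceLaws_iff (hT : T.Good) (ho : IsOrientation o) (hρs : SmoothFun ρ)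
    (hρ : ∀ i, T.IsInstant i → ∀ x, ρ i x ≠ 0) (hu : SmoothVec u) (hp : SmoothFun p)
    (hX : 𝒳.X = TVec.flat u) (hσ : 𝒳.σ = TForm.hodge o (rfl : 1 + 2 = 3) 𝒳.X)
    (hπ : 𝒳.π = kinetic o 𝒳.X)
    (hΦ : TForm.hodge o (rfl : 3 + 0 = 3) (TForm.smul ρ 𝒳.Φ) = fun i => Form.ofFun (p i)) :
    Coll.BalanceLaws o ρ 𝒳 ↔
    (∀ i x, T.ddt (fun j => ρ j x) i + div o (TVec.smul ρ u i) x = 0) ∧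
    (∀ i x, T.ddt (fun j => u j x) i + grad o (fun y => TVec.inner u u i y / 2) x
      - TVec.cross o u (fun j => curl o (u j)) i x
      + TVec.smul (TFun.inv ρ) (fun j => grad o (p j)) i x = 0) ∧
    (𝒳.V = -TForm.smul (TFun.inv ρ)
      (TForm.hodge o (rfl : 2 + 1 = 3) (TForm.d (TForm.smul ρ 𝒳.X)))) ∧
    𝒳.Ψ = TForm.wedge (rfl : 1 + 2 = 3) 𝒳.X (TForm.d 𝒳.X) := by
  have hXs : SmoothForm 𝒳.X := hX ▸ hu.flat
  rw [mass_iff o hT hρs, euler_iff o hT hu hu.flat hρ, ← smul_eq_codiff_iff o hρ, ← hX]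
  have key := momentum_balance (V := 𝒳.V) hT ho hρs hXs (hu.halfSq ho) (fun x => by
    rw [hX]; exact evF_halfSq_add o u x) hp hΦ
  refine ⟨fun hb => ?_, fun ⟨h1, h2, h3, h4⟩ => ?_⟩
  · have hv := hb.vorticity
    rw [hσ] at hv
    refine ⟨hb.mass, ?_, hv, ?_⟩
    · rw [← TForm.hodge_one_eq_zero_iff o rfl, ← key hb.mass hv, sub_eq_zero, ← hσ, ← hπ]
      exact hb.momentum
    · have h5 := hb.helicity
      rw [hσ, smul_helicity _ hρs hXs hv, ← Coll.smul_zero_form ρ] at h5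
      exact sub_eq_zero.1 (TForm.smul_left_cancel hρ h5)
  · refine ⟨h1, hσ.symm ▸ h3, ?_, ?_⟩
    · have h5 := key h1 h3
      rw [h2, TForm.hodge_zero, sub_eq_zero, ← hσ, ← hπ] at h5
      exact h5
    · rw [hσ, smul_helicity _ hρs hXs h3, h4, sub_self, Coll.smul_zero_form]

namespace Coll

/-- The element `f + X dt + V ε + κ dt ε + σ dε + Φ dt dε + Ψ ε dε`. -/
def ofComponents (f : TForm M T 0) (X V : TForm M T 1) (κ σ : TForm M T 2) (Φ Ψ : TForm M T 3) :
    Coll M T := fun m k =>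
  match m, k with
  | ⟨0, 0, 0⟩, 0 => f
  | ⟨1, 0, 0⟩, 1 => X
  | ⟨0, 1, 0⟩, 1 => V
  | ⟨1, 1, 0⟩, 2 => κ
  | ⟨0, 0, 1⟩, 2 => σ
  | ⟨1, 0, 1⟩, 3 => Φ
  | ⟨0, 1, 1⟩, 3 => Ψ
  | _, _ => 0

theorem degreeZero_ofComponents (f : TForm M T 0) (X V : TForm M T 1) (κ σ : TForm M T 2)
    (Φ Ψ : TForm M T 3) : (ofComponents f X V κ σ Φ Ψ).DegreeZero := by
  intro m k hk
  unfold ofComponents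
  split <;> first | rfl | exact absurd rfl hk

theorem smooth_ofComponents {f : TForm M T 0} {X V : TForm M T 1} {κ σ : TForm M T 2}
    {Φ Ψ : TForm M T 3} (hf : SmoothForm f) (hX : SmoothForm X) (hV : SmoothForm V)
    (hκ : SmoothForm κ) (hσ : SmoothForm σ) (hΦ : SmoothForm Φ) (hΨ : SmoothForm Ψ) (m : Mono)
    (k : ℕ) : SmoothForm (ofComponents f X V κ σ Φ Ψ m k) := by
  unfold ofComponents
  split <;> first | assumption | exact SmoothForm.zero

end Coll

theorem SmoothForm.kinetic (hT : T.Good) (ho : IsOrientation o) {X : TForm M T 1}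
    (hX : SmoothForm X) : SmoothForm (kinetic o X) := by
  have h1 : SmoothForm (TForm.codiff o (k := 0) X) := by
    rw [TForm.codiff_one]
    exact ((hX.hodge_one ho rfl).d hT).hodge_three ho rfl
  exact (((hX.wedge rfl (hX.hodge_one ho rfl)).codiff_three hT ho).const_smul _).sub
    ((hX.hodge_one ho rfl).smul h1.toFun)

theorem isExpFun_log (hρ : ∀ i, T.IsInstant i → ∀ x, 0 < ρ i x) : IsExpFun (TFun.log ρ) ρ := by
  intro i x
  refine (Scalar.isExp_log (r := evF ρ x) (fun i hi => hρ i hi x) i).congr_fun fun n => ?_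
  rw [← Scalar.pow_val]
  rfl

theorem IsExpFun.injective {f g : TFun M T} (hf : IsExpFun f ρ) (hg : IsExpFun g ρ) : f = g := by
  have h1 : ∀ {f : TFun M T}, IsExpFun f ρ → ∀ x, Scalar.IsExp (evF f x) (evF ρ x) := by
    intro f hf x i
    refine (hf i x).congr_fun fun n => ?_
    rw [← Scalar.pow_val]
    rfl
  exact evF_ext fun x => (h1 hf x).injective (h1 hg x)

/-- Six of the seven components are given by formulas in ρ, u, p; the remaining one, f, is recovered
from ρ because the exponential is injective in every time model. -/
theorem identified_unique {𝒴 : Coll M T} (h𝒳 : 𝒳.DegreeZero) (h𝒴 : 𝒴.DegreeZero)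
    (hx : Identified o ρ u p 𝒳) (hy : Identified o ρ u p 𝒴) : 𝒳 = 𝒴 := by
  have hX : 𝒳.X = 𝒴.X := hx.X_eq.trans hy.X_eq.symm
  refine Coll.ext_of_degreeZero h𝒳 h𝒴 ?_ hX ?_ ?_ ?_ (hx.Φ_eq.trans hy.Φ_eq.symm) ?_
  · have h1 := hx.density.injective hy.density
    rw [← ofFun_toFun (𝒳 ⟨0, 0, 0⟩ 0), ← ofFun_toFun (𝒴 ⟨0, 0, 0⟩ 0)]
    exact funext fun i => congrArg Form.ofFun (congrFun h1 i)
  · rw [hx.V_eq, hy.V_eq, hX]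
  · rw [hx.π_eq, hy.π_eq, hX]
  · rw [hx.σ_eq, hy.σ_eq, hX]
  · rw [hx.Ψ_eq, hy.Ψ_eq, hX]

/-- The identifications, read as definitions with f = log ρ, give smooth components, and the Euler
equations supply the balance laws, which in turn give closedness globally and at every instant. -/
theorem exists_homotopy (hT : T.Good) (ho : IsOrientation o) (h : IsEulerSolution o ρ u p) :
    ∃ 𝒳 : Coll M T, IsHomotopy o 𝒳 ∧ Identified o ρ u p 𝒳 := by
  have hρ : ∀ i, T.IsInstant i → ∀ x, ρ i x ≠ 0 := fun i hi x => (h.density_pos i hi x).ne'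
  have hX := h.smooth_velocity.flat
  have hinv := h.smooth_density.inv hρ
  have hexp := isExpFun_log h.density_pos
  obtain ⟨𝒳, h𝒳⟩ : ∃ 𝒳 : Coll M T, 𝒳 = Coll.ofComponents
      (fun i => Form.ofFun (TFun.log ρ i)) (TVec.flat u)
      (-TForm.smul (TFun.inv ρ) (TForm.hodge o rfl (TForm.d (TForm.smul ρ (TVec.flat u)))))
      (kinetic o (TVec.flat u)) (TForm.hodge o rfl (TVec.flat u))
      (TForm.smul (TFun.inv ρ) (TForm.hodge o rfl fun i => Form.ofFun (p i)))
      (TForm.wedge rfl (TVec.flat u) (TForm.d (TVec.flat u))) := ⟨_, rfl⟩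
  have h0 : 𝒳.DegreeZero := h𝒳 ▸ Coll.degreeZero_ofComponents _ _ _ _ _ _ _
  have hs : ∀ m k, SmoothForm (𝒳 m k) := h𝒳 ▸ Coll.smooth_ofComponents
    (h.smooth_density.log h.density_pos).ofFun hX
    ((((hX.smul h.smooth_density).d hT).hodge_two ho rfl).smul hinv).neg
    (hX.kinetic hT ho) (hX.hodge_one ho rfl)
    ((h.smooth_pressure.ofFun.hodge_zero ho rfl).smul hinv) (hX.wedge rfl (hX.d hT))
  have hid : Identified o ρ u p 𝒳 := by
    subst h𝒳
    exact ⟨hexp, rfl, rfl, rfl, rfl, rfl, rfl⟩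
  refine ⟨𝒳, Coll.isHomotopy_of_balanceLaws hT ho h0 hs hid.density h.smooth_density ?_, hid⟩
  exact (balanceLaws_iff hT ho h.smooth_density hρ h.smooth_velocity h.smooth_pressure hid.X_eq
    hid.σ_eq hid.π_eq ((hodge_smul_eq_ofFun_iff o hρ).2 hid.Φ_eq)).2
    ⟨h.mass, h.momentum, hid.V_eq, hid.Ψ_eq⟩

/-- Closedness of the homotopy itself yields all four laws. The density is positive at instants as a
real exponential, and the velocity and pressure are smooth because ♯ and the star preserve
smoothness. -/
theorem exists_eulerSolution (hT : T.Good) (ho : IsOrientation o) (h : IsHomotopy o 𝒳)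
    (hσ : 𝒳.σ = TForm.hodge o (rfl : 1 + 2 = 3) 𝒳.X) (hπ : 𝒳.π = kinetic o 𝒳.X) :
    ∃ ρ : TFun M T, IsExpFun 𝒳.f ρ ∧
      IsEulerSolution o ρ (TForm.sharp o 𝒳.X)
        (fun i => Form.toFun (TForm.hodge o (rfl : 3 + 0 = 3) (TForm.smul ρ 𝒳.Φ) i)) ∧
      Identified o ρ (TForm.sharp o 𝒳.X)
        (fun i => Form.toFun (TForm.hodge o (rfl : 3 + 0 = 3) (TForm.smul ρ 𝒳.Φ) i)) 𝒳 := by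
  obtain ⟨ρ, hρs, hexp, hb⟩ := Coll.balanceLaws_of_isCollection h.isCollection
  have hs := h.isCollection.smooth
  have hpos : ∀ i, T.IsInstant i → ∀ x, 0 < ρ i x := fun i hi x => by
    have h1 := (Coll.isExp_evF hexp x).val_instant hi
    exact lt_of_lt_of_eq (Real.exp_pos _) h1.symm
  have hne : ∀ i, T.IsInstant i → ∀ x, ρ i x ≠ 0 := fun i hi x => (hpos i hi x).ne'
  have hX : SmoothForm 𝒳.X := hs _ _
  have hΦ : SmoothForm 𝒳.Φ := hs _ _
  have hu : SmoothVec (TForm.sharp o 𝒳.X) := hX.sharp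
  have hp := ((hΦ.smul hρs).hodge_three ho rfl).toFun
  have hXu := (TForm.flat_sharp o 𝒳.X).symm
  have hΦp := (ofFun_toFun (TForm.hodge o (rfl : 3 + 0 = 3) (TForm.smul ρ 𝒳.Φ))).symm
  obtain ⟨h1, h2, h3, h4⟩ := (balanceLaws_iff hT ho hρs hne hu hp hXu hσ hπ hΦp).1 hb
  exact ⟨ρ, hexp, ⟨hρs, hu, hp, hpos, h1, h2⟩,
    ⟨hexp, hXu, h3, hπ, hσ, (hodge_smul_eq_ofFun_iff o hne).1 hΦp, h4⟩⟩

end Manifold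
end FluidHPT

end

/-! ### The correspondence between homotopies and Euler solutions -/

open FluidHPT in
theorem mainTheorem5 {M : Type*} [TopologicalSpace M] [ChartedSpace E3 M]
    [IsManifold (𝓡 3) ∞ M]
    [RiemannianBundle (fun x : M => TangentSpace (𝓡 3) x)]
    [IsContMDiffRiemannianBundle (𝓡 3) ∞ E3 (fun x : M => TangentSpace (𝓡 3) x)]
    (o : (x : M) → Orientation ℝ (TangentSpace (𝓡 3) x) (Fin 3)) (ho : IsOrientation o)
    (T : TimeModel) (hT : T.IsTime) :
    (∀ (ρ : TFun M T) (u : TVec M T) (p : TFun M T), IsEulerSolution o ρ u p →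
      ∃! 𝒳 : Coll M T, IsHomotopy o 𝒳 ∧ Identified o ρ u p 𝒳) ∧
    (∀ 𝒳 : Coll M T, IsHomotopy o 𝒳 →
      𝒳.σ = TForm.hodge o (rfl : 1 + 2 = 3) 𝒳.X →
      𝒳.π = kinetic o 𝒳.X →
      ∃ (ρ : TFun M T) (u : TVec M T) (p : TFun M T),
        IsExpFun 𝒳.f ρ ∧
        u = TForm.sharp o 𝒳.X ∧
        p = (fun i => Form.toFun (TForm.hodge o (rfl : 3 + 0 = 3) (TForm.smul ρ 𝒳.Φ) i)) ∧
        IsEulerSolution o ρ u p ∧ Identified o ρ u p 𝒳) := by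
  refine ⟨fun ρ u p h => ?_, fun 𝒳 h hσ hπ => ?_⟩
  · obtain ⟨𝒳, h𝒳, hid⟩ := exists_homotopy hT.good ho h
    exact ⟨𝒳, ⟨h𝒳, hid⟩, fun 𝒴 h𝒴 => identified_unique h𝒴.1.isCollection.degree_zero
      h𝒳.isCollection.degree_zero h𝒴.2 hid⟩
  · obtain ⟨ρ, hexp, hE, hid⟩ := exists_eulerSolution hT.good ho h hσ hπ
    exact ⟨ρ, _, _, hexp, rfl, rfl, hE, hid⟩
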